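/- Let $G$ be a compact Lie group with Lie algebra $\mathfrak g$, an $\mathrm{Ad}$-invariant inner product on $\mathfrak g$ and an orthonormal basis $(e_a)$; repeated indices are summed, $f_{abc}=e_a\cdot[e_b,e_c]$, $\theta^L,\theta^R$ are the left- and right-invariant Maurer–Cartan forms with components $\theta^L_a,\theta^R_a$, and $e_a^L,e_a^R$ are the left- and right-invariant vector fields. For a smooth action of a Lie group on $M$ let $\xi_M(m)=\frac{d}{dt}\big|_{t=0}\exp(-t\xi).m$, extended to $\wedge^\bullet$ of the Lie algebra. For a 2-form $\omega$ and a bivector field $P$ put $\omega^\flat(v)=\omega(v,\cdot)$, $P^\sharp(\alpha)=P(\alpha,\cdot)$, where $(\alpha\wedge\beta)(v,w)=\alpha(v)\beta(w)-\alpha(w)\beta(v)$, and likewise for bivectors. Let $\eta=\frac1{12}f_{abc}\theta^R_a\wedge\theta^R_b\wedge\theta^R_c$ and $\phi=\frac1{12}f_{abc}e_a\wedge e_b\wedge e_c$. For a smooth $\mathrm{Ad}$-equivariant map $\Phi:M\to G$ on a $G$-manifold $M$: * $(M,\omega,\Phi)$ is a quasi-Hamiltonian $G$-space if $\omega$ is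 an invariant 2-form with $d\omega=\Phi^*\eta$, $\iota((e_a)_M)\omega=\frac12\Phi^*(\theta^L_a+\theta^R_a)$ and $\ker\omega_m=\{\xi_M(m):(1+\mathrm{Ad}_{\Phi(m)})\xi=0\}$ for all $m$. * $(M,P,\Phi)$ is a Hamiltonian quasi-Poisson $G$-manifold if $P$ is an invariant bivector field with Schouten bracket $[P,P]=\phi_M$ and $P^\sharp(d(\Phi^*f))=\frac12\Phi^*((e^L_a+e^R_a)f)\,(e_a)_M$ for all $f\in C^\infty(G)$; it is non-degenerate if $\operatorname{im}P^\sharp_m+T_m(G.m)=T_mM$ for all $m$. * $\omega$ and $P$ correspond to each other (with respect to the action and $\Phi$) if $(M,\omega,\Phi)$ is a quasi-Hamiltonian $G$-space, $(M,P,\Phi)$ is a non-degenerate Hamiltonian quasi-Poisson $G$-manifold, and $P^\sharp\circ\omega^\flat=\mathrm{Id}_{TM}-\frac14(e_a)_M\otimes\Phi^*(\theta^L_a-\theta^R_a)$. The same definitions apply to the group $G\times G$, with the direct sum inner product and the orthonormal basis $(e_a,0),(0,e_a)$; for a $G\times G$-manifold write $(e_a)^1_M$ and $(e_a)^2_M$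 for the generating vector fields of these basis elements. **Proposition.** Let $M$ be a $G\times G$-manifold and $(\Phi_1,\Phi_2):M\to G\times G$ a smooth equivariant map, and let $\omega$ and $P$ correspond to each other with respect to the $G\times G$-action and $(\Phi_1,\Phi_2)$. Put $$P_{fus}=P-\tfrac12(e_a)^1_M\wedge(e_a)^2_M,\qquad \omega_{fus}=\omega-\tfrac12\,\Phi_1^*\theta^L_a\wedge\Phi_2^*\theta^R_a .$$ Then $$P_{fus}^\sharp\circ\omega_{fus}^\flat=\mathrm{Id}_{TM}-\tfrac14\,(e_a)_M\otimes(\Phi_1\Phi_2)^*(\theta^L_a-\theta^R_a),\qquad (e_a)_M=(e_a)^1_M+(e_a)^2_M .$$ Moreover $\omega_{fus}$ and $P_{fus}$ correspond to each other with respect to the diagonal $G$-action and the pointwise product $\Phi_1\Phi_2$; that is, fusion commutes with the correspondence between quasi-Hamiltonian spaces and non-degenerate Hamiltonian quasi-Poisson manifolds. -/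

import Mathlib

open scoped Manifold ContDiff

noncomputable section

namespace QuasiPoisson

/-! ### Linear algebra on a (finite-dimensional) tangent space

A 2-form `om` on a vector space `V` is stored as its flat map `ω♭ : V → V*`, `ω♭ v = ι(v) ω = ω(v, ·)`;
a bivector `P` is stored as its sharp map `P♯ : V* → V`, determined by `β (P♯ α) = P(α, β)`.
Skew-symmetry is imposed separately. -/

section LinearAlgebra

variable {V : Type*} [AddCommGroup V] [Module ℝ V]

/-- The 2-form `α ∧ β`, that is, `(α ∧ β)(v, w) = α v * β w - β v * α w`. -/
def covWedge (α β : Module.Dual ℝ V) : V →ₗ[ℝ] Module.Dual ℝ V :=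
  α.smulRight β - β.smulRight α

/-- The bivector `X ∧ Y`, that is, `(X ∧ Y)(α, β) = α X * β Y - α Y * β X`. -/
def vecWedge (X Y : V) : Module.Dual ℝ V →ₗ[ℝ] V :=
  (Module.Dual.eval ℝ V X).smulRight Y - (Module.Dual.eval ℝ V Y).smulRight X

/-- The pairing of `α ∧ β ∧ γ` with `x ∧ y ∧ z`, that is, the determinant of the matrix of
pairings. It is used to evaluate a decomposable 3-form on three vectors, and a decomposable
trivector on three covectors. -/
def wedgeThree (α β γ : Module.Dual ℝ V) (x y z : V) : ℝ :=
  Matrix.det !![α x, α y, α z; β x, β y, β z; γ x, γ y, γ z]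

end LinearAlgebra

/-! ### Lie groups: adjoint action, invariant fields, Maurer-Cartan forms -/

section Group

variable {E : Type*} [NormedAddCommGroup E] [NormedSpace ℝ E]
  {H : Type*} [TopologicalSpace H] {J : ModelWithCorners ℝ E H}
  {K : Type*} [TopologicalSpace K] [ChartedSpace H K] [Group K]

/-- The adjoint action `Ad g` on the Lie algebra: the differential at `1` of `h ↦ g h g⁻¹`. -/
def Ad (g : K) : GroupLieAlgebra J K →ₗ[ℝ] GroupLieAlgebra J K :=
  (mfderiv J J (fun h : K => g * h * g⁻¹) 1).toLinearMap

/-- The value at `g` of the left-invariant vector field `ξ^L`. -/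
def leftField (ξ : GroupLieAlgebra J K) (g : K) : TangentSpace J g :=
  mulInvariantVectorField ξ g

/-- The value at `g` of the right-invariant vector field `ξ^R`. -/
def rightField (ξ : GroupLieAlgebra J K) (g : K) : TangentSpace J g :=
  (mfderiv J J (fun h : K => h * g) 1).toLinearMap ξ

/-- The left-invariant Maurer-Cartan form `θ^L` at `g`. -/
def thetaL (g : K) : TangentSpace J g →ₗ[ℝ] GroupLieAlgebra J K :=
  (mfderiv J J (fun h : K => g⁻¹ * h) g).toLinearMap

/-- The right-invariant Maurer-Cartan form `θ^R` at `g`. -/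
def thetaR (g : K) : TangentSpace J g →ₗ[ℝ] GroupLieAlgebra J K :=
  (mfderiv J J (fun h : K => h * g⁻¹) g).toLinearMap

variable (J K) in
/-- An `Ad`-invariant inner product on the Lie algebra. -/
structure InvariantInnerProduct where
  form : GroupLieAlgebra J K →ₗ[ℝ] GroupLieAlgebra J K →ₗ[ℝ] ℝ
  symm : ∀ ξ η, form ξ η = form η ξ
  pos : ∀ ξ, ξ ≠ 0 → 0 < form ξ ξ
  invariant : ∀ (g : K) (ξ η), form (Ad g ξ) (Ad g η) = form ξ η

variable {ι : Type*}

/-- The basis `e` is orthonormal for the inner product `B`. -/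
def InvariantInnerProduct.IsOrthonormal (B : InvariantInnerProduct J K)
    (e : Module.Basis ι ℝ (GroupLieAlgebra J K)) : Prop :=
  (∀ a, B.form (e a) (e a) = 1) ∧ ∀ a b, a ≠ b → B.form (e a) (e b) = 0

/-! In everything below, `e` stands for an orthonormal basis of the Lie algebra with respect to a
chosen invariant inner product, so that the inner product of `e a` with `ξ` is the coordinate
`e.coord a ξ`. -/

/-- The structure constants `f_abc = e_a · [e_b, e_c]`. -/
def structureConst (e : Module.Basis ι ℝ (GroupLieAlgebra J K)) (a b c : ι) : ℝ :=
  e.coord a ⁅e b, e c⁆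

/-- The component `θ^L_a` at `g`. -/
def thetaLComp (e : Module.Basis ι ℝ (GroupLieAlgebra J K)) (a : ι) (g : K) :
    Module.Dual ℝ (TangentSpace J g) :=
  e.coord a ∘ₗ thetaL g

/-- The component `θ^R_a` at `g`. -/
def thetaRComp (e : Module.Basis ι ℝ (GroupLieAlgebra J K)) (a : ι) (g : K) :
    Module.Dual ℝ (TangentSpace J g) :=
  e.coord a ∘ₗ thetaR g

/-- The 3-form `η = (1/12) f_abc θ^R_a ∧ θ^R_b ∧ θ^R_c` on the group. -/
def eta [Fintype ι] (e : Module.Basis ι ℝ (GroupLieAlgebra J K)) (g : K)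
    (x y z : TangentSpace J g) : ℝ :=
  (1 / 12) * ∑ a, ∑ b, ∑ c, structureConst e a b c *
    wedgeThree (thetaRComp e a g) (thetaRComp e b g) (thetaRComp e c g) x y z

end Group

/-! ### Forms and bivector fields on a manifold -/

section Manifold

variable {EM : Type*} [NormedAddCommGroup EM] [NormedSpace ℝ EM]
  {HM : Type*} [TopologicalSpace HM] (IM : ModelWithCorners ℝ EM HM)
  (M : Type*) [TopologicalSpace M] [ChartedSpace HM M]

/-- A (not necessarily smooth or skew) field of bilinear forms, as a field of maps `T_m → T_m*`. -/
abbrev FlatField : Type _ :=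
  ∀ m : M, TangentSpace IM m →ₗ[ℝ] Module.Dual ℝ (TangentSpace IM m)

/-- A (not necessarily smooth or skew) field of contravariant 2-tensors, as a field of maps
`T_m* → T_m`. -/
abbrev SharpField : Type _ :=
  ∀ m : M, Module.Dual ℝ (TangentSpace IM m) →ₗ[ℝ] TangentSpace IM m

variable {M}

/-- Smoothness of a vector field. -/
def SmoothVectorField [IsManifold IM ∞ M] (X : ∀ m : M, TangentSpace IM m) : Prop :=
  ContMDiff IM IM.tangent ∞ (fun m => (⟨m, X m⟩ : TangentBundle IM M))

/-- Smoothness of a real-valued function. -/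
def SmoothFunction (f : M → ℝ) : Prop := ContMDiff IM 𝓘(ℝ, ℝ) ∞ f

variable {IM}

/-- The differential `df` at `m`. -/
def differential (f : M → ℝ) (m : M) : Module.Dual ℝ (TangentSpace IM m) :=
  (mvfderiv IM f m).toLinearMap

/-- The function `ω(X, Y)`. -/
def FlatField.eval (om : FlatField IM M) (X Y : ∀ m : M, TangentSpace IM m) (m : M) : ℝ :=
  om m (X m) (Y m)

/-- `om` is a smooth differential 2-form. -/
structure IsTwoForm [IsManifold IM ∞ M] (om : FlatField IM M) : Prop where
  skew : ∀ (m : M) (v w : TangentSpace IM m), om m v w = -om m w v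
  smooth : ∀ X Y : ∀ m : M, TangentSpace IM m,
    SmoothVectorField IM X → SmoothVectorField IM Y → SmoothFunction IM (om.eval X Y)

/-- The exterior derivative of a 2-form, evaluated on three smooth vector fields:
`dω(X,Y,Z) = X ω(Y,Z) - Y ω(X,Z) + Z ω(X,Y) - ω([X,Y],Z) + ω([X,Z],Y) - ω([Y,Z],X)`. -/
def extDerivTwo (om : FlatField IM M) (X Y Z : ∀ m : M, TangentSpace IM m) (m : M) : ℝ :=
  differential (om.eval Y Z) m (X m) - differential (om.eval X Z) m (Y m)
    + differential (om.eval X Y) m (Z m)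
    - om m (VectorField.mlieBracket IM X Y m) (Z m)
    + om m (VectorField.mlieBracket IM X Z m) (Y m)
    - om m (VectorField.mlieBracket IM Y Z m) (X m)

/-- The bracket `{f, g} = P(df, dg)`. -/
def bracket (P : SharpField IM M) (f g : M → ℝ) (m : M) : ℝ :=
  differential (IM := IM) g m (P m (differential f m))

/-- `P` is a smooth bivector field. -/
structure IsBivectorField (P : SharpField IM M) : Prop where
  skew : ∀ (m : M) (α β : Module.Dual ℝ (TangentSpace IM m)), β (P m α) = -α (P m β)
  smooth : ∀ f g : M → ℝ, SmoothFunction IM f → SmoothFunction IM g →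
    SmoothFunction IM (bracket P f g)

/-- The Schouten bracket `[P, Q]` of two bivector fields, as a trivector field evaluated on
`df, dg, dh`. Multivector fields are viewed as skew multiderivations of the algebra of smooth
functions, `(X ∧ Y)(df, dg) = Xf Yg - Yf Xg`. The sign and normalization are those of the
graded bracket for which `[X, ·]` is the Lie derivative and which is a graded derivation of
the wedge product,
so that `[X ∧ Y, Z ∧ W] = [X,Z] ∧ Y ∧ W - [X,W] ∧ Y ∧ Z - [Y,Z] ∧ X ∧ W + [Y,W] ∧ X ∧ Z`. -/
def schouten (P Q : SharpField IM M) (f g h : M → ℝ) (m : M) : ℝ :=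
  -(bracket Q (bracket P f g) h m + bracket Q (bracket P g h) f m + bracket Q (bracket P h f) g m
    + bracket P (bracket Q f g) h m + bracket P (bracket Q g h) f m
    + bracket P (bracket Q h f) g m)

end Manifold

/-! ### Group actions -/

section Action

variable {E : Type*} [NormedAddCommGroup E] [NormedSpace ℝ E]
  {H : Type*} [TopologicalSpace H] (J : ModelWithCorners ℝ E H)
  (K : Type*) [TopologicalSpace K] [ChartedSpace H K] [Group K]
  {EM : Type*} [NormedAddCommGroup EM] [NormedSpace ℝ EM]
  {HM : Type*} [TopologicalSpace HM] (IM : ModelWithCorners ℝ EM HM)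
  (M : Type*) [TopologicalSpace M] [ChartedSpace HM M]

/-- A smooth left action of `K` on `M`. -/
structure SmoothAction where
  act : K → M → M
  one_act : ∀ m, act 1 m = m
  mul_act : ∀ k l m, act (k * l) m = act k (act l m)
  smooth : ContMDiff (J.prod IM) IM ∞ (fun p : K × M => act p.1 p.2)

variable {J K IM M}

/-- The diagonal action of `K` defined by an action of `K × K`. -/
def SmoothAction.diag (A : SmoothAction (J.prod J) (K × K) IM M) : SmoothAction J K IM M where
  act k m := A.act (k, k) m
  one_act m := A.one_act m
  mul_act k l m := A.mul_act (k, k) (l, l) m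
  smooth := A.smooth.comp
    ((contMDiff_fst.prodMk contMDiff_fst).prodMk contMDiff_snd)

namespace SmoothAction

variable (A : SmoothAction J K IM M)

/-- The generating vector field `ξ_M(m) = d/dt|_{t=0} exp(-tξ).m`, linear in `ξ`. -/
def gen (m : M) : GroupLieAlgebra J K →ₗ[ℝ] TangentSpace IM m :=
  -(mfderiv J IM (fun k : K => A.act k m) 1).toLinearMap

/-- The differential at `m` of the diffeomorphism `m ↦ k.m`. -/
def push (k : K) (m : M) : TangentSpace IM m →ₗ[ℝ] TangentSpace IM (A.act k m) :=
  (mfderiv IM IM (A.act k) m).toLinearMap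

/-- `om` is an invariant 2-tensor. -/
def InvariantForm (om : FlatField IM M) : Prop :=
  ∀ (k : K) (m : M) (v w : TangentSpace IM m),
    om (A.act k m) (A.push k m v) (A.push k m w) = om m v w

/-- `P` is an invariant contravariant 2-tensor. -/
def InvariantBivector (P : SharpField IM M) : Prop :=
  ∀ (k : K) (m : M) (α : Module.Dual ℝ (TangentSpace IM (A.act k m))),
    P (A.act k m) α = A.push k m (P m (α ∘ₗ A.push k m))

/-- `Φ : M → K` is smooth, and equivariant for conjugation on `K`. -/
def EquivariantMap (Φ : M → K) : Prop :=
  ContMDiff IM J ∞ Φ ∧ ∀ k m, Φ (A.act k m) = k * Φ m * k⁻¹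

end SmoothAction

/-- The pull-back `Φ^* θ^L_a` at `m`. -/
def pullL {ι : Type*} (e : Module.Basis ι ℝ (GroupLieAlgebra J K)) (Φ : M → K) (a : ι) (m : M) :
    Module.Dual ℝ (TangentSpace IM m) :=
  thetaLComp e a (Φ m) ∘ₗ (mfderiv IM J Φ m).toLinearMap

/-- The pull-back `Φ^* θ^R_a` at `m`. -/
def pullR {ι : Type*} (e : Module.Basis ι ℝ (GroupLieAlgebra J K)) (Φ : M → K) (a : ι) (m : M) :
    Module.Dual ℝ (TangentSpace IM m) :=
  thetaRComp e a (Φ m) ∘ₗ (mfderiv IM J Φ m).toLinearMap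

variable {ι : Type*} [Fintype ι] (e : Module.Basis ι ℝ (GroupLieAlgebra J K))
  (A : SmoothAction J K IM M) (Φ : M → K)

/-- The value on `df, dg, dh` at `m` of the trivector field `φ_M` generated by the Cartan 3-tensor
`φ = (1/12) f_abc e_a ∧ e_b ∧ e_c`. -/
def cartanField (f g h : M → ℝ) (m : M) : ℝ :=
  (1 / 12) * ∑ a, ∑ b, ∑ c, structureConst e a b c *
    wedgeThree (differential f m) (differential g m) (differential h m)
      (A.gen m (e a)) (A.gen m (e b)) (A.gen m (e c))

/-- `(M, P)` is a quasi-Poisson `K`-manifold: `P` is an invariant bivector field with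
`[P, P] = φ_M`. -/
structure IsQuasiPoisson (P : SharpField IM M) : Prop where
  bivector : IsBivectorField P
  invariant : A.InvariantBivector P
  schouten_eq : ∀ f g h : M → ℝ, SmoothFunction IM f → SmoothFunction IM g →
    SmoothFunction IM h → ∀ m, schouten P P f g h m = cartanField e A f g h m

/-- `(M, P, Φ)` is a Hamiltonian quasi-Poisson `K`-manifold: `Φ` is equivariant and
`P♯ (d(Φ^* f)) = (1/2) Φ^*((e_a^L + e_a^R) f) (e_a)_M` for all smooth functions `f` on `K`. -/
structure IsHamiltonianQuasiPoisson (P : SharpField IM M) : Prop where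
  quasiPoisson : IsQuasiPoisson e A P
  equivariant : A.EquivariantMap Φ
  moment : ∀ f : K → ℝ, SmoothFunction J f → ∀ m : M,
    P m (differential (f ∘ Φ) m) = ∑ a,
      ((1 / 2 : ℝ) * (differential (IM := J) f (Φ m) (leftField (e a) (Φ m))
        + differential (IM := J) f (Φ m) (rightField (e a) (Φ m)))) • A.gen m (e a)

/-- Non-degeneracy: `im P♯_m + T_m(K.m) = T_m M` for all `m`. -/
def NonDegenerate (P : SharpField IM M) : Prop :=
  ∀ m : M, LinearMap.range (P m) ⊔ LinearMap.range (A.gen m) = ⊤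

/-- `(M, ω, Φ)` is a quasi-Hamiltonian `K`-space. -/
structure IsQuasiHamiltonian [IsManifold IM ∞ M] (om : FlatField IM M) : Prop where
  twoForm : IsTwoForm om
  invariant : A.InvariantForm om
  equivariant : A.EquivariantMap Φ
  /-- `dω = Φ^* η` -/
  extDeriv_eq : ∀ X Y Z : ∀ m : M, TangentSpace IM m, SmoothVectorField IM X →
    SmoothVectorField IM Y → SmoothVectorField IM Z → ∀ m, extDerivTwo om X Y Z m =
      eta e (Φ m) (mfderiv IM J Φ m (X m)) (mfderiv IM J Φ m (Y m)) (mfderiv IM J Φ m (Z m))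
  /-- `ι((e_a)_M) ω = (1/2) Φ^*(θ^L_a + θ^R_a)` -/
  moment : ∀ a (m : M), om m (A.gen m (e a)) = (1 / 2 : ℝ) • (pullL e Φ a m + pullR e Φ a m)
  /-- `ker ω_m` consists of all `ξ_M(m)` with `ξ` in the kernel of `1 + Ad_{Φ(m)}` -/
  ker_eq : ∀ (m : M) (v : TangentSpace IM m),
    om m v = 0 ↔ ∃ ξ : GroupLieAlgebra J K, ξ + Ad (Φ m) ξ = 0 ∧ A.gen m ξ = v

/-- The relation `P♯ ∘ ω♭ = Id - (1/4) (e_a)_M ⊗ Φ^*(θ^L_a - θ^R_a)`. -/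
def Related (P : SharpField IM M) (om : FlatField IM M) : Prop :=
  ∀ (m : M) (v : TangentSpace IM m), P m (om m v) =
    v - (1 / 4 : ℝ) • ∑ a, (pullL e Φ a m v - pullR e Φ a m v) • A.gen m (e a)

/-- The quasi-Hamiltonian space `(M, ω, Φ)` and the non-degenerate Hamiltonian quasi-Poisson
manifold `(M, P, Φ)` correspond to each other. -/
structure Corresponds [IsManifold IM ∞ M] (P : SharpField IM M) (om : FlatField IM M) : Prop where
  quasiHamiltonian : IsQuasiHamiltonian e A Φ om
  hamiltonian : IsHamiltonianQuasiPoisson e A Φ P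
  nonDegenerate : NonDegenerate A P
  related : Related e A Φ P om

end Action

/-! ### Fusion -/

section Fusion

variable {E : Type*} [NormedAddCommGroup E] [NormedSpace ℝ E]
  {H : Type*} [TopologicalSpace H] {I : ModelWithCorners ℝ E H}
  {G : Type*} [TopologicalSpace G] [ChartedSpace H G] [Group G]
  {EM : Type*} [NormedAddCommGroup EM] [NormedSpace ℝ EM]
  {HM : Type*} [TopologicalSpace HM] {IM : ModelWithCorners ℝ EM HM}
  {M : Type*} [TopologicalSpace M] [ChartedSpace HM M]
  {ι : Type*}

/-- The basis `(e_a, 0), (0, e_a)` of the Lie algebra of `G × G`; it is orthonormal for the direct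
sum inner product if `e` is orthonormal. -/
def doubleBasis (e : Module.Basis ι ℝ (GroupLieAlgebra I G)) :
    Module.Basis (ι ⊕ ι) ℝ (GroupLieAlgebra (I.prod I) (G × G)) :=
  e.prod e

/-- The inclusion `ξ ↦ (ξ, 0)` of the first summand of the Lie algebra of `G × G`. -/
def inlAlgebra : GroupLieAlgebra I G →ₗ[ℝ] GroupLieAlgebra (I.prod I) (G × G) :=
  LinearMap.inl ℝ (GroupLieAlgebra I G) (GroupLieAlgebra I G)

/-- The inclusion `ξ ↦ (0, ξ)` of the second summand of the Lie algebra of `G × G`. -/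
def inrAlgebra : GroupLieAlgebra I G →ₗ[ℝ] GroupLieAlgebra (I.prod I) (G × G) :=
  LinearMap.inr ℝ (GroupLieAlgebra I G) (GroupLieAlgebra I G)

/-- The generating vector field of `ξ` for the action of the first `G`-factor. -/
def gen₁ (A : SmoothAction (I.prod I) (G × G) IM M) (m : M) :
    GroupLieAlgebra I G →ₗ[ℝ] TangentSpace IM m :=
  A.gen m ∘ₗ inlAlgebra

/-- The generating vector field of `ξ` for the action of the second `G`-factor. -/
def gen₂ (A : SmoothAction (I.prod I) (G × G) IM M) (m : M) :
    GroupLieAlgebra I G →ₗ[ℝ] TangentSpace IM m :=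
  A.gen m ∘ₗ inrAlgebra

variable [Fintype ι]

/-- The bivector field `ψ_M = (1/2) (e_a)^1_M ∧ (e_a)^2_M`. -/
def psiField (e : Module.Basis ι ℝ (GroupLieAlgebra I G))
    (A : SmoothAction (I.prod I) (G × G) IM M) : SharpField IM M :=
  fun m => (1 / 2 : ℝ) • ∑ a, vecWedge (gen₁ A m (e a)) (gen₂ A m (e a))

/-- The fused bivector field `P_fus = P - ψ_M`. -/
def fusedBivector (e : Module.Basis ι ℝ (GroupLieAlgebra I G))
    (A : SmoothAction (I.prod I) (G × G) IM M) (P : SharpField IM M) : SharpField IM M :=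
  fun m => P m - psiField e A m

/-- The fused 2-form `ω_fus = ω - (1/2) Φ₁^* θ^L_a ∧ Φ₂^* θ^R_a`. -/
def fusedForm (e : Module.Basis ι ℝ (GroupLieAlgebra I G)) (Φ₁ Φ₂ : M → G)
    (om : FlatField IM M) : FlatField IM M :=
  fun m => om m - (1 / 2 : ℝ) • ∑ a, covWedge (pullL e Φ₁ a m) (pullR e Φ₂ a m)

end Fusion

end QuasiPoisson

end

noncomputable section

namespace QuasiPoisson

section Calculus

variable {EM : Type*} [NormedAddCommGroup EM] [NormedSpace ℝ EM]
  {HM : Type*} [TopologicalSpace HM] {IM : ModelWithCorners ℝ EM HM}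
  {M : Type*} [TopologicalSpace M] [ChartedSpace HM M]
  {EN : Type*} [NormedAddCommGroup EN] [NormedSpace ℝ EN]
  {HN : Type*} [TopologicalSpace HN] {IN : ModelWithCorners ℝ EN HN}
  {N : Type*} [TopologicalSpace N] [ChartedSpace HN N]

lemma SmoothFunction.mdiff {f : M → ℝ} (hf : SmoothFunction IM f) (m : M) :
    MDifferentiableAt IM 𝓘(ℝ, ℝ) f m :=
  ContMDiff.mdifferentiable hf (by simp) m

lemma differential_eq_mfderiv (f : M → ℝ) (m : M) (v : TangentSpace IM m) :
    differential f m v = (mfderiv IM 𝓘(ℝ, ℝ) f m v : ℝ) := rfl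

lemma differential_comp {f : N → ℝ} {g : M → N} {m : M}
    (hf : MDifferentiableAt IN 𝓘(ℝ, ℝ) f (g m)) (hg : MDifferentiableAt IM IN g m)
    (v : TangentSpace IM m) :
    differential (IM := IM) (fun x => f (g x)) m v =
      differential (IM := IN) f (g m) (mfderiv IM IN g m v) :=
  mvfderiv_comp_apply m hf hg v

lemma differential_add {f g : M → ℝ} {m : M} (hf : MDifferentiableAt IM 𝓘(ℝ, ℝ) f m)
    (hg : MDifferentiableAt IM 𝓘(ℝ, ℝ) g m) :
    differential (IM := IM) (fun x => f x + g x) m = differential f m + differential g m := by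
  ext v
  have := mvfderiv_add hf hg
  exact congrArg (fun L => L v) this

lemma differential_sub {f g : M → ℝ} {m : M} (hf : MDifferentiableAt IM 𝓘(ℝ, ℝ) f m)
    (hg : MDifferentiableAt IM 𝓘(ℝ, ℝ) g m) :
    differential (IM := IM) (fun x => f x - g x) m = differential f m - differential g m := by
  ext v
  have := mvfderiv_sub hf hg
  exact congrArg (fun L => L v) this

lemma differential_neg {f : M → ℝ} {m : M} :
    differential (IM := IM) (fun x => -f x) m = -differential f m := by
  ext v
  have := mvfderiv_neg (I := IM) (g := f) (x := m)
  exact congrArg (fun L => L v) this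

lemma differential_const (c : ℝ) (m : M) : differential (IM := IM) (fun _ => c) m = 0 := by
  ext v
  have := mvfderiv_const (I := IM) (M := M) c (x := m)
  exact congrArg (fun L => L v) this

lemma differential_mul {f g : M → ℝ} {m : M} (hf : MDifferentiableAt IM 𝓘(ℝ, ℝ) f m)
    (hg : MDifferentiableAt IM 𝓘(ℝ, ℝ) g m) :
    differential (IM := IM) (fun x => f x * g x) m =
      f m • differential g m + g m • differential f m := by
  ext v
  have := mvfderiv_mul hf hg
  exact congrArg (fun L => L v) this

lemma differential_const_mul {f : M → ℝ} {m : M} (c : ℝ)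
    (hf : MDifferentiableAt IM 𝓘(ℝ, ℝ) f m) :
    differential (IM := IM) (fun x => c * f x) m = c • differential f m := by
  rw [differential_mul (mdifferentiableAt_const) hf, differential_const]; simp

lemma differential_sum {κ : Type*} (s : Finset κ) {f : κ → M → ℝ} {m : M}
    (hf : ∀ i, MDifferentiableAt IM 𝓘(ℝ, ℝ) (f i) m) :
    MDifferentiableAt IM 𝓘(ℝ, ℝ) (fun x => ∑ i ∈ s, f i x) m ∧
    differential (IM := IM) (fun x => ∑ i ∈ s, f i x) m = ∑ i ∈ s, differential (f i) m := by
  classical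
  induction s using Finset.induction_on with
  | empty => simpa using ⟨mdifferentiableAt_const, differential_const 0 m⟩
  | insert a s ha ih =>
    simp only [Finset.sum_insert ha]
    refine ⟨(hf a).add ih.1, ?_⟩
    rw [differential_add (hf a) ih.1, ih.2]

lemma SmoothFunction.sub {f g : M → ℝ} (hf : SmoothFunction IM f) (hg : SmoothFunction IM g) :
    SmoothFunction IM (fun x => f x - g x) := ContMDiff.sub hf hg

lemma SmoothFunction.mul {f g : M → ℝ} (hf : SmoothFunction IM f) (hg : SmoothFunction IM g) :
    SmoothFunction IM (fun x => f x * g x) := by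
  have := ContMDiff.smul hf hg
  exact this

lemma SmoothFunction.neg {f : M → ℝ} (hf : SmoothFunction IM f) :
    SmoothFunction IM (fun x => -f x) := ContMDiff.neg hf

lemma SmoothFunction.const (c : ℝ) : SmoothFunction IM (fun _ : M => c) := contMDiff_const

lemma SmoothFunction.sum {κ : Type*} (s : Finset κ) {f : κ → M → ℝ}
    (hf : ∀ i, SmoothFunction IM (f i)) : SmoothFunction IM (fun x => ∑ i ∈ s, f i x) :=
  contMDiff_finsetSum (fun i _ => hf i)

lemma SmoothFunction.comp {f : N → ℝ} {g : M → N} (hf : SmoothFunction IN f)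
    (hg : ContMDiff IM IN ∞ g) : SmoothFunction IM (fun x => f (g x)) :=
  ContMDiff.comp hf hg

/-- The total differential of a function of two variables is the sum of the partial ones. -/
lemma differential_prod {F : M × N → ℝ} {p : M × N}
    (hF : MDifferentiableAt (IM.prod IN) 𝓘(ℝ, ℝ) F p) (v : TangentSpace IM p.1)
    (w : TangentSpace IN p.2) :
    differential (IM := IM.prod IN) F p (v, w) =
      differential (IM := IM) (fun x => F (x, p.2)) p.1 v
        + differential (IM := IN) (fun y => F (p.1, y)) p.2 w :=
  mfderiv_prod_eq_add_apply (I := IM) (I' := IN) (I'' := 𝓘(ℝ, ℝ)) (f := F) (p := p) (v := (v, w)) hF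

/-- Partial differentials of smooth functions along smooth fields are smooth. -/
lemma smoothFunction_partial [IsManifold IM ∞ M] [IsManifold IN ∞ N] {F : M × N → ℝ}
    (hF : SmoothFunction (IM.prod IN) F) {s : M → TangentBundle IN N}
    (hs : ContMDiff IM IN.tangent ∞ s) :
    SmoothFunction IM
      (fun m => differential (IM := IN) (fun n => F (m, n)) (s m).1 (s m).2) := by
  have : IsManifold IM 1 M := IsManifold.of_le (n := ∞) (by simp)
  have : IsManifold IN 1 N := IsManifold.of_le (n := ∞) (by simp)
  have h1 : ContMDiff IM (IM.prod IN).tangent ∞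
      (fun m => (⟨(m, (s m).1), ((0 : EM), (s m).2)⟩ : TangentBundle (IM.prod IN) (M × N))) :=
    (contMDiff_equivTangentBundleProd_symm (I := IM) (I' := IN) (M := M) (M' := N)).comp
      ((Bundle.contMDiff_zeroSection ℝ (TangentSpace IM)).prodMk hs)
  have h2 := (ContMDiff.contMDiff_tangentMap (m := ∞) hF le_rfl).comp h1
  have h3 := (contMDiff_snd_tangentBundle_modelSpace ℝ 𝓘(ℝ, ℝ)).comp h2
  refine ContMDiff.congr h3 fun m => ?_
  have := differential_prod (p := (m, (s m).1)) (hF.mdiff _) (0 : TangentSpace IM m) (s m).2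
  simp only [map_zero, zero_add] at this
  exact this.symm

lemma smoothFunction_partial_const [IsManifold IM ∞ M] [IsManifold IN ∞ N] {F : M × N → ℝ}
    (hF : SmoothFunction (IM.prod IN) F) (n : N) (w : TangentSpace IN n) :
    SmoothFunction IM (fun m => differential (IM := IN) (fun n => F (m, n)) n w) :=
  smoothFunction_partial hF (s := fun _ => ⟨n, w⟩) contMDiff_const

lemma SmoothVectorField.apply [IsManifold IM ∞ M] {X : ∀ m : M, TangentSpace IM m}
    (hX : SmoothVectorField IM X) {f : M → ℝ} (hf : SmoothFunction IM f) :
    SmoothFunction IM (fun m => differential f m (X m)) :=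
  smoothFunction_partial (F := fun p : M × M => f p.2) (hf.comp contMDiff_snd) hX

/-- The chain rule for a function of two variables. -/
lemma differential_comp₂ {E₁ : Type*} [NormedAddCommGroup E₁] [NormedSpace ℝ E₁]
    {H₁ : Type*} [TopologicalSpace H₁] {I₁ : ModelWithCorners ℝ E₁ H₁}
    {N₁ : Type*} [TopologicalSpace N₁] [ChartedSpace H₁ N₁]
    {F : N × N₁ → ℝ} {f : M → N} {g : M → N₁} {m : M}
    (hF : MDifferentiableAt (IN.prod I₁) 𝓘(ℝ, ℝ) F (f m, g m))
    (hf : MDifferentiableAt IM IN f m) (hg : MDifferentiableAt IM I₁ g m)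
    (v : TangentSpace IM m) :
    differential (IM := IM) (fun x => F (f x, g x)) m v =
      differential (IM := IM) (fun x => F (f x, g m)) m v
        + differential (IM := IM) (fun x => F (f m, g x)) m v := by
  have hF1 : MDifferentiableAt IN 𝓘(ℝ, ℝ) (fun x => F (x, g m)) (f m) :=
    MDifferentiableAt.comp (I' := IN.prod I₁) (f m) hF
      (mdifferentiableAt_id.prodMk mdifferentiableAt_const)
  have hF2 : MDifferentiableAt I₁ 𝓘(ℝ, ℝ) (fun x => F (f m, x)) (g m) :=
    MDifferentiableAt.comp (I' := IN.prod I₁) (g m) hF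
      (mdifferentiableAt_const.prodMk mdifferentiableAt_id)
  rw [differential_comp hF1 hf, differential_comp hF2 hg]
  have h1 := differential_comp (f := F) (g := fun x => (f x, g x)) hF (hf.prodMk hg) v
  rw [h1, hf.mfderiv_prod hg]
  exact differential_prod (p := (f m, g m)) hF _ _

lemma differential_congr_point {f : M → ℝ} {p q : M} (h : p = q) (v : EM) :
    differential (IM := IM) f p v = differential (IM := IM) f q v := by
  subst h; rfl

/-- Every covector is the differential of a globally defined smooth function. -/
lemma exists_differential_eq [FiniteDimensional ℝ EM] [T2Space M] [IsManifold IM ∞ M]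
    (m : M) (α : Module.Dual ℝ (TangentSpace IM m)) :
    ∃ f : M → ℝ, SmoothFunction IM f ∧ differential f m = α := by
  have : IsManifold IM 1 M := IsManifold.of_le (n := ∞) (by simp)
  have : FiniteDimensional ℝ (TangentSpace IM m) := inferInstanceAs (FiniteDimensional ℝ EM)
  obtain ⟨b⟩ : Nonempty (SmoothBumpFunction IM m) := inferInstance
  obtain ⟨D, hD⟩ := isInvertible_mfderiv_extChartAt (I := IM) (mem_extChartAt_source (I := IM) m)
  let L₀ : EM →ₗ[ℝ] ℝ := α ∘ₗ D.symm.toLinearEquiv.toLinearMap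
  let L : EM →L[ℝ] ℝ := LinearMap.toContinuousLinearMap L₀
  have hg : ContMDiffOn IM 𝓘(ℝ, ℝ) ∞ (fun x => L (extChartAt IM m x)) (chartAt HM m).source :=
    L.contMDiff.comp_contMDiffOn contMDiffOn_extChartAt
  have hg' : MDifferentiableAt IM 𝓘(ℝ, ℝ) (fun x => L (extChartAt IM m x)) m :=
    ((hg m (mem_chart_source HM m)).contMDiffAt
      ((chartAt HM m).open_source.mem_nhds (mem_chart_source HM m))).mdifferentiableAt (by simp)
  refine ⟨fun x => b x * L (extChartAt IM m x), b.contMDiff_smul hg, ?_⟩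
  have hev : (fun x => b x * L (extChartAt IM m x)) =ᶠ[nhds m] fun x => L (extChartAt IM m x) := by
    filter_upwards [b.eventuallyEq_one] with x hx
    simp [hx]
  ext v
  rw [differential_eq_mfderiv, hev.mfderiv_eq]
  have h2 := differential_comp (IM := IM) (IN := 𝓘(ℝ, EM)) (f := L) (g := extChartAt IM m) (m := m)
    L.mdifferentiableAt (mdifferentiableAt_extChartAt (mem_chart_source HM m)) v
  have h3 : differential (IM := 𝓘(ℝ, EM)) L (extChartAt IM m m)
    (mfderiv IM 𝓘(ℝ, EM) (extChartAt IM m) m v) = L (D v) := by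
      rw [← hD, differential_eq_mfderiv, mfderiv_eq_fderiv, L.fderiv]; rfl
  exact h2.trans (h3.trans (congrArg α (D.symm_apply_apply v)))

/-- Tangent vectors are separated by differentials of smooth functions. -/
lemma tangent_ext [FiniteDimensional ℝ EM] [T2Space M] [IsManifold IM ∞ M]
    {m : M} {v w : TangentSpace IM m}
    (h : ∀ f : M → ℝ, SmoothFunction IM f → differential f m v = differential f m w) : v = w := by
  have : FiniteDimensional ℝ (TangentSpace IM m) := inferInstanceAs (FiniteDimensional ℝ EM)
  rw [← sub_eq_zero, ← Module.forall_dual_apply_eq_zero_iff ℝ]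
  intro α
  obtain ⟨f, hf, rfl⟩ := exists_differential_eq m α
  rw [map_sub, h f hf, sub_self]

end Calculus

section SecondDerivatives

lemma two_le_smooth : (2 : WithTop ℕ∞) ≤ ∞ := by
  exact WithTop.coe_le_coe.2 (le_top : (2 : ℕ∞) ≤ ⊤)

/-- The mixed second derivative of a function of two variables. -/
lemma fderiv_fderiv_partial {E₁ E₂ : Type*} [NormedAddCommGroup E₁] [NormedSpace ℝ E₁]
    [NormedAddCommGroup E₂] [NormedSpace ℝ E₂] {G : E₁ × E₂ → ℝ} {p : E₁ × E₂}
    (hG : ContDiffAt ℝ 2 G p) (v : E₁) (w : E₂) :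
    fderiv ℝ (fun x => fderiv ℝ (fun y => G (x, y)) p.2 w) p.1 v =
      fderiv ℝ (fderiv ℝ G) p (v, 0) (0, w) := by
  have hev : ∀ᶠ q in nhds p, DifferentiableAt ℝ G q :=
    (hG.eventually (by simp)).mono fun q hq => hq.differentiableAt (by simp)
  have hc : Filter.Tendsto (fun x : E₁ => (x, p.2)) (nhds p.1) (nhds p) := by
    have : Continuous (fun x : E₁ => (x, p.2)) := by fun_prop
    exact this.tendsto' _ _ rfl
  have h1 : (fun x => fderiv ℝ (fun y => G (x, y)) p.2 w) =ᶠ[nhds p.1]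
      fun x => fderiv ℝ G (x, p.2) (0, w) := by
    filter_upwards [hc.eventually hev] with x hx
    have h2 : HasFDerivAt (fun y : E₂ => (x, y)) (ContinuousLinearMap.inr ℝ E₁ E₂) p.2 :=
      hasFDerivAt_prodMk_right x p.2
    have h6 := HasFDerivAt.comp p.2 (f := fun y : E₂ => (x, y)) (g := G) hx.hasFDerivAt h2
    rw [HasFDerivAt.fderiv (f := fun y => G (x, y)) h6]
    simp
  rw [h1.fderiv_eq]
  have hd : DifferentiableAt ℝ (fderiv ℝ G) p :=
    (hG.fderiv_right (m := 1) (by norm_num)).differentiableAt (by simp)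
  have h3 : HasFDerivAt (fun x : E₁ => (x, p.2)) (ContinuousLinearMap.inl ℝ E₁ E₂) p.1 :=
    hasFDerivAt_prodMk_left p.1 p.2
  have h4 := (HasFDerivAt.comp p.1 (f := fun x : E₁ => (x, p.2)) (g := fderiv ℝ G)
    (g' := fderiv ℝ (fderiv ℝ G) p) hd.hasFDerivAt h3)
  have h5 := h4.clm_apply (hasFDerivAt_const ((0, w) : E₁ × E₂) p.1)
  rw [HasFDerivAt.fderiv (f := fun x => fderiv ℝ G (x, p.2) (0, w)) h5]
  simp

variable {EM : Type*} [NormedAddCommGroup EM] [NormedSpace ℝ EM]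
  {HM : Type*} [TopologicalSpace HM] {IM : ModelWithCorners ℝ EM HM} [IM.Boundaryless]
  {M : Type*} [TopologicalSpace M] [ChartedSpace HM M]
  {EN : Type*} [NormedAddCommGroup EN] [NormedSpace ℝ EN]
  {HN : Type*} [TopologicalSpace HN] {IN : ModelWithCorners ℝ EN HN} [IN.Boundaryless]
  {N : Type*} [TopologicalSpace N] [ChartedSpace HN N]

lemma differential_eq_fderiv {f : M → ℝ} {m : M} (hf : MDifferentiableAt IM 𝓘(ℝ, ℝ) f m)
    (v : TangentSpace IM m) :
    differential f m v =
      (fderiv ℝ (fun x => f ((extChartAt IM m).symm x)) (extChartAt IM m m) : EM →L[ℝ] ℝ) v := by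
  have h := hf.mvfderiv
  rw [ModelWithCorners.range_eq_univ, fderivWithin_univ] at h
  exact congrArg (fun L => L v) h

/-- Mixed partial differentials of a smooth function commute. -/
lemma differential_partial_comm [IsManifold IM ∞ M] [IsManifold IN ∞ N] {F : M × N → ℝ}
    (hF : SmoothFunction (IM.prod IN) F) (m : M) (v : TangentSpace IM m) (n : N)
    (w : TangentSpace IN n) :
    differential (IM := IM) (fun x => differential (IM := IN) (fun y => F (x, y)) n w) m v =
      differential (IM := IN) (fun y => differential (IM := IM) (fun x => F (x, y)) m v) n w := by
  have hF' : SmoothFunction (IN.prod IM) (fun p : N × M => F (p.2, p.1)) :=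
    hF.comp (contMDiff_snd.prodMk contMDiff_fst)
  have hp1 : ∀ x, SmoothFunction IN (fun y => F (x, y)) := fun x =>
    hF.comp (contMDiff_const.prodMk contMDiff_id)
  have hp2 : ∀ y, SmoothFunction IM (fun x => F (x, y)) := fun y =>
    hF.comp (contMDiff_id.prodMk contMDiff_const)
  let G : EM × EN → ℝ := fun q => F ((extChartAt IM m).symm q.1, (extChartAt IN n).symm q.2)
  have hG : ContDiffAt ℝ 2 G (extChartAt IM m m, extChartAt IN n n) := by
    refine ContDiffAt.of_le ?_ two_le_smooth
    rw [← contMDiffAt_iff_contDiffAt]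
    have h1 : ContMDiffAt 𝓘(ℝ, EM) IM ∞ (extChartAt IM m).symm (extChartAt IM m m) :=
      (contMDiffOn_extChartAt_symm m).contMDiffAt (extChartAt_target_mem_nhds m)
    have h2 : ContMDiffAt 𝓘(ℝ, EN) IN ∞ (extChartAt IN n).symm (extChartAt IN n n) :=
      (contMDiffOn_extChartAt_symm n).contMDiffAt (extChartAt_target_mem_nhds n)
    refine ContMDiffAt.comp (I' := IM.prod IN) _ (hF _) (ContMDiffAt.prodMk ?_ ?_)
    · exact ContMDiffAt.comp (I' := 𝓘(ℝ, EM)) (f := Prod.fst)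
        (x := (extChartAt IM m m, extChartAt IN n n)) h1 contDiff_fst.contMDiff.contMDiffAt
    · exact ContMDiffAt.comp (I' := 𝓘(ℝ, EN)) (f := Prod.snd)
        (x := (extChartAt IM m m, extChartAt IN n n)) h2 contDiff_snd.contMDiff.contMDiffAt
  have hG' : ContDiffAt ℝ 2 (fun q : EN × EM => G (q.2, q.1))
      (extChartAt IN n n, extChartAt IM m m) :=
    ContDiffAt.comp (g := G) (f := fun q : EN × EM => (q.2, q.1))
      (extChartAt IN n n, extChartAt IM m m) hG (contDiff_snd.prodMk contDiff_fst).contDiffAt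
  rw [differential_eq_fderiv ((smoothFunction_partial_const hF n w).mdiff m),
    differential_eq_fderiv ((smoothFunction_partial_const hF' m v).mdiff n)]
  simp_rw [fun x => differential_eq_fderiv ((hp1 x).mdiff n) w,
    fun y => differential_eq_fderiv ((hp2 y).mdiff m) v]
  have h1 := fderiv_fderiv_partial hG v w
  have h2 := fderiv_fderiv_partial hG' w v
  refine h1.trans (Eq.trans ?_ h2.symm)
  have hsymm := hG.isSymmSndFDerivAt (by simp)
  let sw : EN × EM →L[ℝ] EM × EN :=
    (ContinuousLinearMap.snd ℝ EN EM).prod (ContinuousLinearMap.fst ℝ EN EM)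
  have hev : ∀ᶠ q in nhds (extChartAt IM m m, extChartAt IN n n), DifferentiableAt ℝ G q :=
    (hG.eventually (by simp)).mono fun q hq => hq.differentiableAt (by simp)
  have hd : DifferentiableAt ℝ (fderiv ℝ G) (extChartAt IM m m, extChartAt IN n n) :=
    (hG.fderiv_right (m := 1) (by norm_num)).differentiableAt (by simp)
  have h3 : fderiv ℝ (fun q : EN × EM => G (q.2, q.1))
      =ᶠ[nhds (extChartAt IN n n, extChartAt IM m m)]
      fun q => (fderiv ℝ G (sw q)).comp sw := by
    have := sw.continuous.continuousAt (x := (extChartAt IN n n, extChartAt IM m m))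
    filter_upwards [this.eventually hev] with q hq
    exact (hq.hasFDerivAt.comp q sw.hasFDerivAt).fderiv
  rw [h3.fderiv_eq]
  have h4 := HasFDerivAt.comp (extChartAt IN n n, extChartAt IM m m) (f := sw) (g := fderiv ℝ G)
    hd.hasFDerivAt sw.hasFDerivAt
  have h5 := h4.clm_comp (hasFDerivAt_const sw _)
  rw [HasFDerivAt.fderiv (f := fun q => (fderiv ℝ G (sw q)).comp sw) h5]
  simp [sw]
  exact hsymm.eq _ _

/-- The Lie bracket of vector fields is the commutator of derivations. -/
lemma differential_mlieBracket [FiniteDimensional ℝ EM] [IsManifold IM ∞ M]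
    {X Y : ∀ m : M, TangentSpace IM m} {m : M}
    (hX : MDifferentiableAt IM IM.tangent (fun x => (⟨x, X x⟩ : TangentBundle IM M)) m)
    (hY : MDifferentiableAt IM IM.tangent (fun x => (⟨x, Y x⟩ : TangentBundle IM M)) m)
    {f : M → ℝ} (hf : SmoothFunction IM f)
    (hXf : MDifferentiableAt IM 𝓘(ℝ, ℝ) (fun x => differential f x (X x)) m)
    (hYf : MDifferentiableAt IM 𝓘(ℝ, ℝ) (fun x => differential f x (Y x)) m) :
    differential f m (VectorField.mlieBracket IM X Y m) =
      differential (fun x => differential f x (Y x)) m (X m)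
        - differential (fun x => differential f x (X x)) m (Y m) := by
  have : IsManifold IM 1 M := IsManifold.of_le (n := ∞) (by simp)
  have : IsManifold IM 2 M := IsManifold.of_le (n := ∞) two_le_smooth
  have : CompleteSpace EM := FiniteDimensional.complete ℝ EM
  have hφm : (extChartAt IM m).symm (extChartAt IM m m) = m := extChartAt_to_inv m
  have hft : ContDiffAt ℝ 2 (fun x => f ((extChartAt IM m).symm x)) (extChartAt IM m m) := by
    refine ContDiffAt.of_le ?_ two_le_smooth
    rw [← contMDiffAt_iff_contDiffAt]
    exact ContMDiffAt.comp (I' := IM) _ (hf _)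
      ((contMDiffOn_extChartAt_symm m).contMDiffAt (extChartAt_target_mem_nhds m))
  set fh : EM → ℝ := fun x => f ((extChartAt IM m).symm x) with hfh
  have key : ∀ (Z : ∀ m : M, TangentSpace IM m) (g : M → ℝ) (x : EM),
      x ∈ (extChartAt IM m).target →
      MDifferentiableAt IM 𝓘(ℝ, ℝ) g ((extChartAt IM m).symm x) →
      fderiv ℝ (fun x => g ((extChartAt IM m).symm x)) x
        (VectorField.mpullbackWithin 𝓘(ℝ, EM) IM (extChartAt IM m).symm Z (Set.range IM) x) =
      differential g ((extChartAt IM m).symm x) (Z ((extChartAt IM m).symm x)) := by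
    intro Z g x hx hg
    have hinv := isInvertible_mfderivWithin_extChartAt_symm (I := IM) hx
    have hs : MDifferentiableAt 𝓘(ℝ, EM) IM (extChartAt IM m).symm x :=
      ((contMDiffOn_extChartAt_symm (n := ∞) m).contMDiffAt
        (extChartAt_target_mem_nhds' hx)).mdifferentiableAt (by simp)
    have h1 := differential_comp hg hs
      (VectorField.mpullbackWithin 𝓘(ℝ, EM) IM (extChartAt IM m).symm Z (Set.range IM) x)
    rw [differential_eq_mfderiv, mfderiv_eq_fderiv] at h1
    refine h1.trans (congrArg _ ?_)
    rw [VectorField.mpullbackWithin_apply]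
    rw [ModelWithCorners.range_eq_univ, mfderivWithin_univ] at hinv ⊢
    exact hinv.self_apply_inverse _
  have keym : ∀ (Z : ∀ m : M, TangentSpace IM m) (g : M → ℝ), MDifferentiableAt IM 𝓘(ℝ, ℝ) g m →
      differential g m (Z m) = fderiv ℝ (fun x => g ((extChartAt IM m).symm x)) (extChartAt IM m m)
        (VectorField.mpullbackWithin 𝓘(ℝ, EM) IM (extChartAt IM m).symm Z (Set.range IM)
          (extChartAt IM m m)) := by
    intro Z g hg
    rw [key Z g _ (mem_extChartAt_target m) (by rwa [hφm])]
    exact (congrArg (fun q => differential g q (Z q)) hφm).symm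
  have bracket_eq : ∀ u : EM, differential f m
      ((mfderiv IM 𝓘(ℝ, EM) (extChartAt IM m) m).inverse u) =
        fderiv ℝ fh (extChartAt IM m m) u := by
    intro u
    have hinv := isInvertible_mfderiv_extChartAt (I := IM) (mem_extChartAt_source (I := IM) m)
    have hev : f =ᶠ[nhds m] fun x => fh (extChartAt IM m x) := by
      filter_upwards [extChartAt_source_mem_nhds (I := IM) m] with x hx
      rw [hfh]
      simp only [(extChartAt IM m).left_inv hx]
    have h1 := differential_comp (IM := IM) (IN := 𝓘(ℝ, EM)) (f := fh) (g := extChartAt IM m)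
      (m := m) (hft.differentiableAt (by simp)).mdifferentiableAt
      (mdifferentiableAt_extChartAt (mem_chart_source HM m))
      ((mfderiv IM 𝓘(ℝ, EM) (extChartAt IM m) m).inverse u)
    rw [differential_eq_mfderiv, differential_eq_mfderiv, ← hev.mfderiv_eq,
      mfderiv_eq_fderiv] at h1
    exact h1.trans (congrArg (fderiv ℝ fh (extChartAt IM m m)) (hinv.self_apply_inverse u))
  have hdiff : ∀ {Z : ∀ m : M, TangentSpace IM m},
      MDifferentiableAt IM IM.tangent (fun x => (⟨x, Z x⟩ : TangentBundle IM M)) m →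
      DifferentiableAt ℝ (VectorField.mpullbackWithin 𝓘(ℝ, EM) IM (extChartAt IM m).symm Z
        (Set.range IM)) (extChartAt IM m m) := by
    intro Z hZ
    have h := MDifferentiableWithinAt.differentiableWithinAt_mpullbackWithin_vectorField
      (V := Z) (s := Set.univ) hZ.mdifferentiableWithinAt
    rw [ModelWithCorners.range_eq_univ, Set.preimage_univ, Set.univ_inter] at h
    rw [ModelWithCorners.range_eq_univ]
    exact differentiableWithinAt_univ.1 h
  have hev : ∀ (Z : ∀ m : M, TangentSpace IM m),
      (fun x => differential f ((extChartAt IM m).symm x) (Z ((extChartAt IM m).symm x)))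
        =ᶠ[nhds (extChartAt IM m m)] fun x => fderiv ℝ fh x
        (VectorField.mpullbackWithin 𝓘(ℝ, EM) IM (extChartAt IM m).symm Z (Set.range IM) x) := by
    intro Z
    filter_upwards [extChartAt_target_mem_nhds (I := IM) m] with x hx
    exact (key Z f x hx (hf.mdiff _)).symm
  have hd : DifferentiableAt ℝ (fderiv ℝ fh) (extChartAt IM m m) :=
    (hft.fderiv_right (m := 1) (by norm_num)).differentiableAt (by simp)
  have hsymm := hft.isSymmSndFDerivAt (by simp)
  rw [keym X _ hYf, keym Y _ hXf, (hev X).fderiv_eq, (hev Y).fderiv_eq]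
  have hXd := hdiff hX
  have hYd := hdiff hY
  set Xh : EM → EM :=
    VectorField.mpullbackWithin 𝓘(ℝ, EM) IM (extChartAt IM m).symm X (Set.range IM) with hXh
  set Yh : EM → EM :=
    VectorField.mpullbackWithin 𝓘(ℝ, EM) IM (extChartAt IM m).symm Y (Set.range IM) with hYh
  have h1 : VectorField.mlieBracket IM X Y m = (mfderiv IM 𝓘(ℝ, EM) (extChartAt IM m) m).inverse
      (VectorField.lieBracket (E := EM) ℝ Xh Yh (extChartAt IM m m)) := by
    rw [← VectorField.mlieBracketWithin_univ, VectorField.mlieBracketWithin_apply,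
      Set.preimage_univ, Set.univ_inter]
    refine congrArg (fun u : EM → EM =>
      (mfderiv IM 𝓘(ℝ, EM) (extChartAt IM m) m).inverse (u (extChartAt IM m m))) ?_
    refine Eq.trans ?_ (VectorField.lieBracketWithin_univ (𝕜 := ℝ) (V := Xh) (W := Yh))
    exact congrArg (VectorField.lieBracketWithin (E := EM) ℝ Xh Yh)
      (ModelWithCorners.range_eq_univ IM)
  rw [h1, bracket_eq]
  rw [HasFDerivAt.fderiv (hd.hasFDerivAt.clm_apply hXd.hasFDerivAt),
    HasFDerivAt.fderiv (hd.hasFDerivAt.clm_apply hYd.hasFDerivAt)]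
  have h2 := hsymm.eq (Xh (extChartAt IM m m)) (Yh (extChartAt IM m m))
  simp only [VectorField.lieBracket, map_sub, add_apply,
    ContinuousLinearMap.comp_apply, ContinuousLinearMap.flip_apply]
  rw [h2]
  ring

omit [IM.Boundaryless] in
lemma SmoothVectorField.mdifferentiableAt [IsManifold IM ∞ M] {X : ∀ m : M, TangentSpace IM m}
    (hX : SmoothVectorField IM X) (m : M) :
    MDifferentiableAt IM IM.tangent (fun x => (⟨x, X x⟩ : TangentBundle IM M)) m :=
  ContMDiff.mdifferentiable hX (by simp) m

lemma SmoothVectorField.mlieBracket_apply [FiniteDimensional ℝ EM] [IsManifold IM ∞ M]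
    {X Y : ∀ m : M, TangentSpace IM m} (hX : SmoothVectorField IM X)
    (hY : SmoothVectorField IM Y) {f : M → ℝ} (hf : SmoothFunction IM f) (m : M) :
    differential f m (VectorField.mlieBracket IM X Y m) =
      differential (fun x => differential f x (Y x)) m (X m)
        - differential (fun x => differential f x (X x)) m (Y m) :=
  differential_mlieBracket (hX.mdifferentiableAt m) (hY.mdifferentiableAt m) hf
    ((hX.apply hf).mdiff m) ((hY.apply hf).mdiff m)

end SecondDerivatives

section LieGroup

variable {E : Type*} [NormedAddCommGroup E] [NormedSpace ℝ E]
  {H : Type*} [TopologicalSpace H] {J : ModelWithCorners ℝ E H}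
  {K : Type*} [TopologicalSpace K] [ChartedSpace H K] [Group K]
  {EM : Type*} [NormedAddCommGroup EM] [NormedSpace ℝ EM]
  {HM : Type*} [TopologicalSpace HM] {IM : ModelWithCorners ℝ EM HM}
  {M : Type*} [TopologicalSpace M] [ChartedSpace HM M]

/-- The pull-back of the left-invariant Maurer-Cartan form. -/
def mcL (Φ : M → K) (m : M) : TangentSpace IM m →ₗ[ℝ] GroupLieAlgebra J K :=
  thetaL (Φ m) ∘ₗ (mfderiv IM J Φ m).toLinearMap

/-- The pull-back of the right-invariant Maurer-Cartan form. -/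
def mcR (Φ : M → K) (m : M) : TangentSpace IM m →ₗ[ℝ] GroupLieAlgebra J K :=
  thetaR (Φ m) ∘ₗ (mfderiv IM J Φ m).toLinearMap

variable [LieGroup J ∞ K]

section Smooth

lemma contMDiff_translateL (g : K) : ContMDiff J J ∞ (fun h : K => g * h) :=
  contMDiff_const.mul contMDiff_id

lemma contMDiff_translateR (g : K) : ContMDiff J J ∞ (fun h : K => h * g) :=
  contMDiff_id.mul contMDiff_const

lemma contMDiff_conj (g : K) : ContMDiff J J ∞ (fun h : K => g * h * g⁻¹) :=
  (contMDiff_const.mul contMDiff_id).mul contMDiff_const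

end Smooth

lemma _root_.ContMDiff.mdiff {E₁ : Type*} [NormedAddCommGroup E₁] [NormedSpace ℝ E₁]
    {H₁ : Type*} [TopologicalSpace H₁] {I₁ : ModelWithCorners ℝ E₁ H₁}
    {N₁ : Type*} [TopologicalSpace N₁] [ChartedSpace H₁ N₁] {Φ : M → N₁}
    (hΦ : ContMDiff IM I₁ ∞ Φ) (m : M) : MDifferentiableAt IM I₁ Φ m :=
  hΦ.mdifferentiable (by simp) m

lemma differential_thetaL {u : K → ℝ} (hu : SmoothFunction J u) (g : K) (w : TangentSpace J g) :
    differential (IM := J) u 1 (thetaL g w) = differential (fun h => u (g⁻¹ * h)) g w := by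
  rw [differential_comp (hu.mdiff _) ((contMDiff_translateL g⁻¹).mdiff g)]
  exact (differential_congr_point (inv_mul_cancel g) _).symm

lemma differential_thetaR {u : K → ℝ} (hu : SmoothFunction J u) (g : K) (w : TangentSpace J g) :
    differential (IM := J) u 1 (thetaR g w) = differential (fun h => u (h * g⁻¹)) g w := by
  rw [differential_comp (hu.mdiff _) ((contMDiff_translateR g⁻¹).mdiff g)]
  exact (differential_congr_point (mul_inv_cancel g) _).symm

lemma differential_mcL {Φ : M → K} (hΦ : ContMDiff IM J ∞ Φ) {u : K → ℝ}
    (hu : SmoothFunction J u) (m : M) (v : TangentSpace IM m) :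
    differential (IM := J) u 1 (mcL Φ m v) =
      differential (fun n => u ((Φ m)⁻¹ * Φ n)) m v :=
  (differential_thetaL hu _ _).trans
    (differential_comp (f := fun h => u ((Φ m)⁻¹ * h))
      ((hu.comp (contMDiff_translateL _)).mdiff _) (hΦ.mdiff m) v).symm

lemma differential_mcR {Φ : M → K} (hΦ : ContMDiff IM J ∞ Φ) {u : K → ℝ}
    (hu : SmoothFunction J u) (m : M) (v : TangentSpace IM m) :
    differential (IM := J) u 1 (mcR Φ m v) =
      differential (fun n => u (Φ n * (Φ m)⁻¹)) m v :=
  (differential_thetaR hu _ _).trans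
    (differential_comp (f := fun h => u (h * (Φ m)⁻¹))
      ((hu.comp (contMDiff_translateR _)).mdiff _) (hΦ.mdiff m) v).symm

/-- The differential of a function along `Φ`, in terms of `Φ^* θ^L`. -/
lemma differential_comp_eq_mcL {Φ : M → K} (hΦ : ContMDiff IM J ∞ Φ) {w : K → ℝ}
    (hw : SmoothFunction J w) (m : M) (v : TangentSpace IM m) :
    differential (fun n => w (Φ n)) m v =
      differential (IM := J) (fun h => w (Φ m * h)) 1 (mcL Φ m v) := by
  rw [differential_mcL hΦ (hw.comp (contMDiff_translateL (Φ m)))]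
  simp

lemma differential_Ad {u : K → ℝ} (hu : SmoothFunction J u) (g : K) (ξ : GroupLieAlgebra J K) :
    differential (IM := J) u 1 (Ad g ξ) = differential (fun h => u (g * h * g⁻¹)) 1 ξ := by
  rw [differential_comp (hu.mdiff _) ((contMDiff_conj g).mdiff 1)]
  exact (differential_congr_point (by simp) _).symm

lemma differential_leftField {u : K → ℝ} (hu : SmoothFunction J u) (g : K)
    (ξ : GroupLieAlgebra J K) :
    differential (IM := J) u g (leftField ξ g) = differential (fun h => u (g * h)) 1 ξ := by
  rw [differential_comp (hu.mdiff _) ((contMDiff_translateL g).mdiff 1)]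
  exact (differential_congr_point (mul_one g) _).symm

lemma differential_rightField {u : K → ℝ} (hu : SmoothFunction J u) (g : K)
    (ξ : GroupLieAlgebra J K) :
    differential (IM := J) u g (rightField ξ g) = differential (fun h => u (h * g)) 1 ξ := by
  rw [differential_comp (hu.mdiff _) ((contMDiff_translateR g).mdiff 1)]
  exact (differential_congr_point (one_mul g) _).symm

lemma differential_inv {f : M → K} (hf : ContMDiff IM J ∞ f) {u : K → ℝ}
    (hu : SmoothFunction J u) {m : M} (hm : f m = 1) (v : TangentSpace IM m) :
    differential (fun n => u (f n)⁻¹) m v = -differential (fun n => u (f n)) m v := by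
  have hF : SmoothFunction (J.prod J) (fun p : K × K => u (p.1 * p.2⁻¹)) :=
    hu.comp (contMDiff_fst.mul contMDiff_snd.inv)
  have h := differential_comp₂ (F := fun p : K × K => u (p.1 * p.2⁻¹)) (hF.mdiff (f m, f m))
    (hf.mdiff m) (hf.mdiff m) v
  simp only [mul_inv_cancel, differential_const, hm, inv_one, mul_one, one_mul,
    LinearMap.zero_apply] at h
  linarith

/-- The second derivative at the unit of `u (g * h)`, first in `h` and then in `g`. -/
def secondDifferential (u : K → ℝ) (ξ η : GroupLieAlgebra J K) : ℝ :=
  differential (IM := J) (fun g => differential (IM := J) (fun h => u (g * h)) 1 η) 1 ξ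

lemma smoothFunction_leftDerivative {u : K → ℝ} (hu : SmoothFunction J u)
    (ξ : GroupLieAlgebra J K) :
    SmoothFunction J (fun g => differential (IM := J) (fun h => u (g * h)) 1 ξ) :=
  smoothFunction_partial_const (F := fun p : K × K => u (p.1 * p.2))
    (hu.comp (contMDiff_fst.mul contMDiff_snd)) 1 ξ

lemma secondDifferential_eq_swap [J.Boundaryless] {u : K → ℝ} (hu : SmoothFunction J u)
    (ξ η : GroupLieAlgebra J K) :
    secondDifferential u ξ η =
      differential (IM := J) (fun h => differential (IM := J) (fun g => u (g * h)) 1 ξ) 1 η :=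
  differential_partial_comm (F := fun p : K × K => u (p.1 * p.2))
    (hu.comp (contMDiff_fst.mul contMDiff_snd)) 1 ξ 1 η

variable [FiniteDimensional ℝ E] [J.Boundaryless]

lemma differential_bracket {u : K → ℝ} (hu : SmoothFunction J u) (ξ η : GroupLieAlgebra J K) :
    differential (IM := J) u 1 ⁅ξ, η⁆ = secondDifferential u ξ η - secondDifferential u η ξ := by
  have : LieGroup J (minSmoothness ℝ 3) K := by
    rw [minSmoothness_of_isRCLikeNormedField]
    exact LieGroup.of_le (n := ∞) (WithTop.coe_le_coe.2 (le_top : (3 : ℕ∞) ≤ ⊤))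
  have hfun : ∀ ζ : GroupLieAlgebra J K,
      (fun g => differential (IM := J) u g (mulInvariantVectorField ζ g)) =
        fun g => differential (IM := J) (fun h => u (g * h)) 1 ζ :=
    fun ζ => funext fun g => differential_leftField hu g ζ
  have h := differential_mlieBracket (IM := J) (f := u) (m := (1 : K))
    (mdifferentiableAt_mulInvariantVectorField ξ) (mdifferentiableAt_mulInvariantVectorField η) hu
    (by rw [hfun]; exact (smoothFunction_leftDerivative hu ξ).mdiff 1)
    (by rw [hfun]; exact (smoothFunction_leftDerivative hu η).mdiff 1)
  rw [hfun, hfun] at h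
  have h1 : ∀ ζ : GroupLieAlgebra J K, mulInvariantVectorField ζ (1 : K) = ζ := by
    intro ζ
    have : (fun h : K => 1 * h) = id := by ext; simp
    simp only [mulInvariantVectorField]
    rw [this, mfderiv_id]
    rfl
  rw [h1, h1] at h
  exact h

variable {E' : Type*} [NormedAddCommGroup E'] [NormedSpace ℝ E'] [FiniteDimensional ℝ E']
  {H' : Type*} [TopologicalSpace H'] {J' : ModelWithCorners ℝ E' H'} [J'.Boundaryless]
  {L : Type*} [TopologicalSpace L] [ChartedSpace H' L] [Group L] [LieGroup J' ∞ L] [T2Space L]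

/-- The differential of a homomorphism of Lie groups is a homomorphism of Lie algebras. -/
lemma bracket_map {ρ : K → L} (hρ : ContMDiff J J' ∞ ρ) (hmul : ∀ g h, ρ (g * h) = ρ g * ρ h)
    {r : GroupLieAlgebra J K → GroupLieAlgebra J' L}
    (hr : ∀ u : L → ℝ, SmoothFunction J' u → ∀ ξ,
      differential (IM := J') u 1 (r ξ) = differential (fun g => u (ρ g)) 1 ξ)
    (ξ η : GroupLieAlgebra J K) : r ⁅ξ, η⁆ = ⁅r ξ, r η⁆ := by
  refine tangent_ext fun u hu => ?_
  have key : ∀ ξ η : GroupLieAlgebra J K, secondDifferential u (r ξ) (r η) =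
      secondDifferential (fun g => u (ρ g)) ξ η := by
    intro ξ η
    unfold secondDifferential
    rw [hr _ (smoothFunction_leftDerivative hu (r η))]
    congr 2
    ext g
    rw [hr (fun h => u (ρ g * h)) (hu.comp (contMDiff_translateL _))]
    simp only [hmul]
  rw [hr u hu, differential_bracket (hu.comp hρ), differential_bracket hu, key, key]

variable [T2Space K]

lemma Ad_bracket (g : K) (ξ η : GroupLieAlgebra J K) : Ad g ⁅ξ, η⁆ = ⁅Ad g ξ, Ad g η⁆ :=
  bracket_map (contMDiff_conj g) (fun h k => by group) (fun _ hu => differential_Ad hu g) ξ η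

omit [J.Boundaryless] in
lemma Ad_mul (g h : K) (ξ : GroupLieAlgebra J K) : Ad (g * h) ξ = Ad g (Ad h ξ) := by
  refine tangent_ext fun u hu => ?_
  rw [differential_Ad hu, differential_Ad hu, differential_Ad (hu.comp (contMDiff_conj g))]
  simp only [mul_inv_rev, mul_assoc]

omit [J.Boundaryless] in
lemma Ad_one (ξ : GroupLieAlgebra J K) : Ad (1 : K) ξ = ξ := by
  refine tangent_ext fun u hu => ?_
  rw [differential_Ad hu]
  simp

omit [J.Boundaryless] in
lemma Ad_inv_Ad (g : K) (ξ : GroupLieAlgebra J K) : Ad g⁻¹ (Ad g ξ) = ξ := by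
  rw [← Ad_mul, inv_mul_cancel, Ad_one]

omit [J.Boundaryless] in
lemma Ad_Ad_inv (g : K) (ξ : GroupLieAlgebra J K) : Ad g (Ad g⁻¹ ξ) = ξ := by
  rw [← Ad_mul, mul_inv_cancel, Ad_one]

omit [T2Space K] in
/-- The derivative of the adjoint action is the bracket. -/
lemma differential_Ad_apply {u : K → ℝ} (hu : SmoothFunction J u) (ξ η : GroupLieAlgebra J K) :
    SmoothFunction J (fun g : K => differential (IM := J) u 1 (Ad g η)) ∧
    differential (IM := J) (fun g : K => differential (IM := J) u 1 (Ad g η)) 1 ξ =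
      differential (IM := J) u 1 ⁅ξ, η⁆ := by
  let F : K × K → ℝ := fun p => differential (IM := J) (fun h => u (p.1 * h * p.2)) 1 η
  have hG : SmoothFunction ((J.prod J).prod J) (fun q : (K × K) × K => u (q.1.1 * q.2 * q.1.2)) :=
    hu.comp (((contMDiff_fst.comp contMDiff_fst).mul contMDiff_snd).mul
        (contMDiff_snd.comp contMDiff_fst))
  have hF : SmoothFunction (J.prod J) F := smoothFunction_partial_const hG 1 η
  have hfun : (fun g : K => differential (IM := J) u 1 (Ad g η)) =
      fun g => differential (IM := J) (fun h => u (g * h * g⁻¹)) 1 η :=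
    funext fun g => differential_Ad hu g η
  rw [hfun]
  have hinv : ContMDiff J J ∞ (fun g : K => g⁻¹) := contMDiff_id.inv
  refine ⟨hF.comp (g := fun g : K => (g, g⁻¹)) (contMDiff_id.prodMk hinv), ?_⟩
  have h := differential_comp₂ (F := F)
    (f := fun g : K => g) (g := fun g : K => g⁻¹) (m := 1) (hF.mdiff _)
    (contMDiff_id.mdiff (1 : K)) (hinv.mdiff (1 : K)) ξ
  have hF1 : SmoothFunction J (fun b : K => F (1, b)) :=
    hF.comp (g := fun b : K => ((1 : K), b)) (contMDiff_const.prodMk contMDiff_id)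
  rw [differential_inv (f := fun g : K => g) contMDiff_id hF1 rfl] at h
  refine h.trans ?_
  simp only [F]
  simp only [inv_one, mul_one, one_mul]
  rw [differential_bracket hu, secondDifferential_eq_swap hu η ξ]
  unfold secondDifferential
  ring

omit [J.Boundaryless] in
lemma mcR_eq_Ad_mcL {Φ : M → K} (hΦ : ContMDiff IM J ∞ Φ) (m : M) (v : TangentSpace IM m) :
    (mcR Φ m v : GroupLieAlgebra J K) = Ad (Φ m) (mcL Φ m v) := by
  refine tangent_ext fun u hu => ?_
  rw [differential_Ad hu, differential_mcL hΦ (hu.comp (contMDiff_conj _)), differential_mcR hΦ hu]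
  simp

omit [J.Boundaryless] in
lemma mcL_eq_Ad_mcR {Φ : M → K} (hΦ : ContMDiff IM J ∞ Φ) (m : M) (v : TangentSpace IM m) :
    (mcL Φ m v : GroupLieAlgebra J K) = Ad (Φ m)⁻¹ (mcR Φ m v) := by
  rw [mcR_eq_Ad_mcL hΦ, Ad_inv_Ad]

omit [J.Boundaryless] in
lemma mcR_eq_neg_mcL_inv {Φ : M → K} (hΦ : ContMDiff IM J ∞ Φ) (m : M) (v : TangentSpace IM m) :
    (mcR Φ m v : GroupLieAlgebra J K) = -mcL (fun n => (Φ n)⁻¹) m v := by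
  refine tangent_ext fun u hu => ?_
  rw [map_neg, differential_mcL hΦ.inv hu, differential_mcR hΦ hu]
  have h := differential_inv (f := fun n => Φ n * (Φ m)⁻¹) (m := m)
    (hΦ.mul contMDiff_const) hu (by simp) v
  simp only [mul_inv_rev, inv_inv] at h ⊢
  rw [h, neg_neg]

omit [J.Boundaryless] in
lemma mcL_mul {Φ₁ Φ₂ : M → K} (h₁ : ContMDiff IM J ∞ Φ₁) (h₂ : ContMDiff IM J ∞ Φ₂) (m : M)
    (v : TangentSpace IM m) :
    (mcL (fun n => Φ₁ n * Φ₂ n) m v : GroupLieAlgebra J K) =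
      mcL Φ₂ m v + Ad (Φ₂ m)⁻¹ (mcL Φ₁ m v) := by
  refine tangent_ext fun u hu => ?_
  have h₁₂ : ContMDiff IM J ∞ (fun n => Φ₁ n * Φ₂ n) := h₁.mul h₂
  rw [map_add, differential_Ad hu, differential_mcL h₂ hu, differential_mcL h₁₂ hu,
    differential_mcL h₁ (hu.comp (contMDiff_conj _))]
  have hF : SmoothFunction (J.prod J)
      (fun p : K × K => u ((Φ₁ m * Φ₂ m)⁻¹ * (p.1 * p.2))) :=
    hu.comp (contMDiff_const.mul (contMDiff_fst.mul contMDiff_snd))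
  have h := differential_comp₂ (F := fun p : K × K => u ((Φ₁ m * Φ₂ m)⁻¹ * (p.1 * p.2)))
    (hF.mdiff (Φ₁ m, Φ₂ m)) (h₁.mdiff m) (h₂.mdiff m) v
  simp only at h
  rw [h, add_comm]
  simp [mul_assoc]

omit [J.Boundaryless] in
lemma mcR_mul {Φ₁ Φ₂ : M → K} (h₁ : ContMDiff IM J ∞ Φ₁) (h₂ : ContMDiff IM J ∞ Φ₂) (m : M)
    (v : TangentSpace IM m) :
    (mcR (fun n => Φ₁ n * Φ₂ n) m v : GroupLieAlgebra J K) =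
      mcR Φ₁ m v + Ad (Φ₁ m) (mcR Φ₂ m v) := by
  have h₁₂ : ContMDiff IM J ∞ (fun n => Φ₁ n * Φ₂ n) := h₁.mul h₂
  rw [mcR_eq_Ad_mcL h₁₂, mcL_mul h₁ h₂, map_add, Ad_mul, Ad_mul, Ad_Ad_inv,
    ← mcR_eq_Ad_mcL h₁, ← mcR_eq_Ad_mcL h₂, add_comm]

omit [J.Boundaryless] in
/-- A smooth function on the group whose differential at the unit is a given covector. -/
lemma exists_differential_one_eq (α : Module.Dual ℝ (GroupLieAlgebra J K)) :
    ∃ u : K → ℝ, SmoothFunction J u ∧ differential (IM := J) u 1 = α :=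
  exists_differential_eq (1 : K) α

section MaurerCartan

variable [IsManifold IM ∞ M]

omit [J.Boundaryless] in
lemma smoothFunction_mcL {Φ : M → K} (hΦ : ContMDiff IM J ∞ Φ)
    (α : Module.Dual ℝ (GroupLieAlgebra J K)) {X : ∀ m : M, TangentSpace IM m}
    (hX : SmoothVectorField IM X) : SmoothFunction IM (fun m => α (mcL Φ m (X m))) := by
  obtain ⟨u, hu, hα⟩ := exists_differential_one_eq α
  have h₁ : ContMDiff (IM.prod IM) J ∞ (fun p : M × M => (Φ p.1)⁻¹) :=
    ContMDiff.inv (hΦ.comp contMDiff_fst)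
  have h₂ : ContMDiff (IM.prod IM) J ∞ (fun p : M × M => Φ p.2) := hΦ.comp contMDiff_snd
  have hG : SmoothFunction (IM.prod IM) (fun p : M × M => u ((Φ p.1)⁻¹ * Φ p.2)) :=
    hu.comp (g := fun p : M × M => (Φ p.1)⁻¹ * Φ p.2) (h₁.mul h₂)
  have hs := smoothFunction_partial hG (s := fun m => ⟨m, X m⟩) hX
  have heq : (fun m => α (mcL Φ m (X m))) =
      fun m => differential (IM := IM) (fun n => u ((Φ m)⁻¹ * Φ n)) m (X m) := by
    ext m
    rw [← hα, differential_mcL hΦ hu]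
  rw [heq]
  exact hs

omit [J.Boundaryless] in
lemma smoothFunction_mcR {Φ : M → K} (hΦ : ContMDiff IM J ∞ Φ)
    (α : Module.Dual ℝ (GroupLieAlgebra J K)) {X : ∀ m : M, TangentSpace IM m}
    (hX : SmoothVectorField IM X) : SmoothFunction IM (fun m => α (mcR Φ m (X m))) := by
  simp_rw [mcR_eq_neg_mcL_inv hΦ, map_neg]
  exact (smoothFunction_mcL hΦ.inv α hX).neg

variable [IM.Boundaryless] [FiniteDimensional ℝ EM]

/-- The Maurer-Cartan equation for `Φ^* θ^L`. -/
lemma maurerCartan_left {Φ : M → K} (hΦ : ContMDiff IM J ∞ Φ)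
    (α : Module.Dual ℝ (GroupLieAlgebra J K)) {X Y : ∀ m : M, TangentSpace IM m}
    (hX : SmoothVectorField IM X) (hY : SmoothVectorField IM Y) (m : M) :
    differential (fun n => α (mcL Φ n (Y n))) m (X m)
      - differential (fun n => α (mcL Φ n (X n))) m (Y m)
      - α (mcL Φ m (VectorField.mlieBracket IM X Y m)) =
        -α ⁅(mcL Φ m (X m) : GroupLieAlgebra J K), mcL Φ m (Y m)⁆ := by
  have : FiniteDimensional ℝ (GroupLieAlgebra J K) := inferInstanceAs (FiniteDimensional ℝ E)
  obtain ⟨u, hu, rfl⟩ := exists_differential_one_eq α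
  let e : Module.Basis _ ℝ (GroupLieAlgebra J K) := Module.finBasis ℝ (GroupLieAlgebra J K)
  have hw : SmoothFunction J (fun k => u ((Φ m)⁻¹ * k)) := hu.comp (contMDiff_translateL _)
  let D : GroupLieAlgebra J K → M → ℝ := fun ξ n =>
    differential (IM := J) (fun h => u ((Φ m)⁻¹ * (Φ n * h))) 1 ξ
  have hD : ∀ ξ, SmoothFunction IM (D ξ) := fun ξ =>
    (smoothFunction_leftDerivative hw ξ).comp hΦ
  have hDm : ∀ ξ, D ξ m = differential (IM := J) u 1 ξ := by
    intro ξ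
    simp [D]
  have hdD : ∀ ξ (v : TangentSpace IM m), differential (D ξ) m v =
      secondDifferential u (mcL Φ m v) ξ := by
    intro ξ v
    have := differential_comp_eq_mcL hΦ (smoothFunction_leftDerivative hw ξ) m v
    simp only [mul_assoc, inv_mul_cancel_left] at this
    exact this
  have hexp : ∀ {Z : ∀ m : M, TangentSpace IM m} (_ : SmoothVectorField IM Z),
      (fun n => differential (fun x => u ((Φ m)⁻¹ * Φ x)) n (Z n)) =
        fun n => ∑ a, D (e a) n * e.coord a (mcL Φ n (Z n)) := by
    intro Z hZ
    ext n
    rw [differential_comp_eq_mcL hΦ hw n]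
    conv_lhs => rw [← e.sum_repr (mcL Φ n (Z n)), map_sum]
    refine Finset.sum_congr rfl fun a _ => ?_
    rw [map_smul, smul_eq_mul, mul_comm]
    rfl
  have hsecond : ∀ ξ η, secondDifferential (J := J) u ξ η =
      ∑ a, secondDifferential u ξ (e a) * e.coord a η := by
    intro ξ η
    unfold secondDifferential
    have h1 : (fun g : K => differential (IM := J) (fun h => u (g * h)) 1 η) =
        fun g => ∑ a, e.coord a η * differential (IM := J) (fun h => u (g * h)) 1 (e a) := by
      ext g
      conv_lhs => rw [← e.sum_repr η, map_sum]
      refine Finset.sum_congr rfl fun a _ => ?_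
      rw [map_smul, smul_eq_mul]
      rfl
    have hs := fun a => (smoothFunction_leftDerivative hu (e a)).mdiff (1 : K)
    rw [h1, (differential_sum _ fun a => ((SmoothFunction.const (e.coord a η)).mul
      (smoothFunction_leftDerivative hu (e a))).mdiff 1).2, LinearMap.sum_apply]
    refine Finset.sum_congr rfl fun a _ => ?_
    rw [differential_const_mul _ (hs a), LinearMap.smul_apply, smul_eq_mul, mul_comm]
  have hder : ∀ {Z : ∀ m : M, TangentSpace IM m} (_ : SmoothVectorField IM Z)
      (v : TangentSpace IM m),
      differential (fun n => differential (fun x => u ((Φ m)⁻¹ * Φ x)) n (Z n)) m v =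
        secondDifferential (J := J) u (mcL Φ m v) (mcL Φ m (Z m))
        + differential (fun n => differential (IM := J) u 1 (mcL Φ n (Z n))) m v := by
    intro Z hZ v
    have hs := fun a => smoothFunction_mcL hΦ (e.coord a) hZ
    have hrw : (fun n => differential (IM := J) u 1 (mcL Φ n (Z n))) =
        fun n => ∑ a, differential (IM := J) u 1 (e a) * e.coord a (mcL Φ n (Z n)) := by
      ext n
      conv_lhs => rw [← e.sum_repr (mcL Φ n (Z n)), map_sum]
      refine Finset.sum_congr rfl fun a _ => ?_
      rw [map_smul, smul_eq_mul, mul_comm]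
      rfl
    rw [hexp hZ, hrw, hsecond, (differential_sum _ fun a => ((hD (e a)).mul (hs a)).mdiff m).2,
      (differential_sum _ fun a => ((SmoothFunction.const _).mul (hs a)).mdiff m).2,
      LinearMap.sum_apply, LinearMap.sum_apply, ← Finset.sum_add_distrib]
    refine Finset.sum_congr rfl fun a _ => ?_
    rw [differential_mul ((hD (e a)).mdiff m) ((hs a).mdiff m),
      differential_const_mul _ ((hs a).mdiff m), LinearMap.add_apply, LinearMap.smul_apply,
      LinearMap.smul_apply, LinearMap.smul_apply, hDm, hdD]
    simp only [smul_eq_mul]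
    ring
  have h := hX.mlieBracket_apply hY (hw.comp hΦ) m
  rw [hder hX, hder hY] at h
  rw [differential_mcL hΦ hu m (VectorField.mlieBracket IM X Y m), h, differential_bracket hu]
  ring

/-- The Maurer-Cartan equation for `Φ^* θ^R`. -/
lemma maurerCartan_right {Φ : M → K} (hΦ : ContMDiff IM J ∞ Φ)
    (α : Module.Dual ℝ (GroupLieAlgebra J K)) {X Y : ∀ m : M, TangentSpace IM m}
    (hX : SmoothVectorField IM X) (hY : SmoothVectorField IM Y) (m : M) :
    differential (fun n => α (mcR Φ n (Y n))) m (X m)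
      - differential (fun n => α (mcR Φ n (X n))) m (Y m)
      - α (mcR Φ m (VectorField.mlieBracket IM X Y m)) =
        α ⁅(mcR Φ m (X m) : GroupLieAlgebra J K), mcR Φ m (Y m)⁆ := by
  have h := maurerCartan_left hΦ.inv α hX hY m
  simp_rw [mcR_eq_neg_mcL_inv hΦ, map_neg]
  rw [differential_neg, differential_neg]
  have hb : ∀ x y : GroupLieAlgebra J K, ⁅-x, -y⁆ = ⁅x, y⁆ := by
    have : LieGroup J (minSmoothness ℝ 3) K := by
      rw [minSmoothness_of_isRCLikeNormedField]
      exact LieGroup.of_le (n := ∞) (WithTop.coe_le_coe.2 (le_top : (3 : ℕ∞) ≤ ⊤))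
    have : CompleteSpace E := FiniteDimensional.complete ℝ E
    intro x y
    rw [neg_lie, lie_neg, neg_neg]
  rw [hb, LinearMap.neg_apply, LinearMap.neg_apply]
  linarith

end MaurerCartan

end LieGroup

section Action

variable {E : Type*} [NormedAddCommGroup E] [NormedSpace ℝ E]
  {H : Type*} [TopologicalSpace H] {J : ModelWithCorners ℝ E H}
  {K : Type*} [TopologicalSpace K] [ChartedSpace H K] [Group K]
  {EM : Type*} [NormedAddCommGroup EM] [NormedSpace ℝ EM]
  {HM : Type*} [TopologicalSpace HM] {IM : ModelWithCorners ℝ EM HM}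
  {M : Type*} [TopologicalSpace M] [ChartedSpace HM M]

namespace SmoothAction

variable (A : SmoothAction J K IM M)

lemma contMDiff_orbit (m : M) : ContMDiff J IM ∞ (fun k : K => A.act k m) :=
  A.smooth.comp (contMDiff_id.prodMk contMDiff_const)

lemma contMDiff_act (k : K) : ContMDiff IM IM ∞ (A.act k) :=
  A.smooth.comp (contMDiff_const.prodMk contMDiff_id)

lemma differential_gen {f : M → ℝ} (hf : SmoothFunction IM f) (m : M)
    (ξ : GroupLieAlgebra J K) :
    differential f m (A.gen m ξ) = -differential (IM := J) (fun k => f (A.act k m)) 1 ξ := by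
  rw [differential_comp (hf.mdiff _) ((A.contMDiff_orbit m).mdiff 1), ← map_neg]
  exact (differential_congr_point (A.one_act m) _).symm

lemma differential_push {f : M → ℝ} (hf : SmoothFunction IM f) (k : K) (m : M)
    (v : TangentSpace IM m) :
    differential f (A.act k m) (A.push k m v) = differential (fun x => f (A.act k x)) m v :=
  (differential_comp (hf.mdiff _) ((A.contMDiff_act k).mdiff m) v).symm

/-- The derivative of `f` along the generating vector field of `ξ`. -/
def genDeriv (ξ : GroupLieAlgebra J K) (f : M → ℝ) (m : M) : ℝ := differential f m (A.gen m ξ)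

variable [LieGroup J ∞ K] [IsManifold IM ∞ M]

lemma smoothFunction_genDeriv {f : M → ℝ} (hf : SmoothFunction IM f) (ξ : GroupLieAlgebra J K) :
    SmoothFunction IM (A.genDeriv ξ f) := by
  have hF : SmoothFunction (IM.prod J) (fun p : M × K => f (A.act p.2 p.1)) :=
    hf.comp (A.smooth.comp (contMDiff_snd.prodMk contMDiff_fst))
  have heq : A.genDeriv ξ f = fun m => -differential (IM := J) (fun k => f (A.act k m)) 1 ξ :=
    funext fun m => A.differential_gen hf m ξ
  rw [heq]
  exact (smoothFunction_partial_const hF 1 ξ).neg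

/-- `ξ ↦ ξ_M` is a homomorphism of Lie algebras. -/
lemma genDeriv_comm [FiniteDimensional ℝ E] [J.Boundaryless] {f : M → ℝ}
    (hf : SmoothFunction IM f) (ξ η : GroupLieAlgebra J K) (m : M) :
    A.genDeriv ξ (A.genDeriv η f) m - A.genDeriv η (A.genDeriv ξ f) m = A.genDeriv ⁅ξ, η⁆ f m := by
  have hu : SmoothFunction J (fun k : K => f (A.act k m)) := hf.comp (A.contMDiff_orbit m)
  have key : ∀ ξ η : GroupLieAlgebra J K, A.genDeriv ξ (A.genDeriv η f) m =
      secondDifferential (fun k : K => f (A.act k m)) η ξ := by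
    intro ξ η
    have h1 : ∀ k : K, A.genDeriv η f (A.act k m) =
        -differential (IM := J) (fun h : K => f (A.act (h * k) m)) 1 η := by
      intro k
      simp only [A.mul_act]
      exact A.differential_gen hf _ η
    rw [secondDifferential_eq_swap hu]
    have h2 := A.differential_gen (A.smoothFunction_genDeriv hf η) m ξ
    simp_rw [h1] at h2
    rw [differential_neg, LinearMap.neg_apply, neg_neg] at h2
    exact h2
  rw [key, key]
  have h3 := A.differential_gen hf m ⁅ξ, η⁆
  rw [differential_bracket hu] at h3
  rw [genDeriv, h3]
  ring

variable [FiniteDimensional ℝ EM] [T2Space M]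

lemma push_gen (k : K) (m : M) (ξ : GroupLieAlgebra J K) :
    A.push k m (A.gen m ξ) = A.gen (A.act k m) (Ad k ξ) := by
  refine tangent_ext fun f hf => ?_
  rw [A.differential_push hf, A.differential_gen (hf.comp (A.contMDiff_act k)),
    A.differential_gen hf, differential_Ad (hf.comp (A.contMDiff_orbit _))]
  simp only [← A.mul_act, inv_mul_cancel_right]

variable [FiniteDimensional ℝ E] [T2Space K]

omit [FiniteDimensional ℝ EM] [T2Space M] [IsManifold IM ∞ M] in
variable {A} in
lemma EquivariantMap.mcL_gen {Φ : M → K} (hΦ : A.EquivariantMap Φ) (m : M)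
    (ξ : GroupLieAlgebra J K) : mcL Φ m (A.gen m ξ) = ξ - Ad (Φ m)⁻¹ ξ := by
  refine tangent_ext fun u hu => ?_
  have hw : SmoothFunction IM (fun n => u ((Φ m)⁻¹ * Φ n)) :=
    (hu.comp (contMDiff_translateL _)).comp hΦ.1
  rw [differential_mcL hΦ.1 hu, A.differential_gen hw, map_sub, differential_Ad hu]
  simp only [hΦ.2]
  let F : K × K → ℝ := fun p => u ((Φ m)⁻¹ * (p.1 * Φ m * p.2))
  have hF : SmoothFunction (J.prod J) F :=
    hu.comp (contMDiff_const.mul ((contMDiff_fst.mul contMDiff_const).mul contMDiff_snd))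
  have hinv : ContMDiff J J ∞ (fun g : K => g⁻¹) := contMDiff_id.inv
  have h := differential_comp₂ (F := F) (f := fun g : K => g) (g := fun g : K => g⁻¹) (m := 1)
    (hF.mdiff _) (contMDiff_id.mdiff (1 : K)) (hinv.mdiff (1 : K)) ξ
  have h' := differential_inv (f := fun g : K => g) contMDiff_id hu rfl ξ
  simp only [F, inv_one, mul_one, one_mul, inv_mul_cancel_left] at h
  rw [h, h']
  simp only [inv_inv, mul_assoc]
  ring

omit [FiniteDimensional ℝ EM] [T2Space M] [IsManifold IM ∞ M] in
variable {A} in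
lemma EquivariantMap.mcR_gen {Φ : M → K} (hΦ : A.EquivariantMap Φ) (m : M)
    (ξ : GroupLieAlgebra J K) : mcR Φ m (A.gen m ξ) = Ad (Φ m) ξ - ξ := by
  rw [mcR_eq_Ad_mcL hΦ.1, hΦ.mcL_gen, map_sub, Ad_Ad_inv]

omit [FiniteDimensional ℝ EM] [T2Space M] [IsManifold IM ∞ M] in
variable {A} in
lemma EquivariantMap.mcL_push {Φ : M → K} (hΦ : A.EquivariantMap Φ) (k : K) (m : M)
    (v : TangentSpace IM m) :
    (mcL Φ (A.act k m) (A.push k m v) : GroupLieAlgebra J K) = Ad k (mcL Φ m v) := by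
  refine tangent_ext fun u hu => ?_
  have hw : SmoothFunction IM (fun n => u ((Φ (A.act k m))⁻¹ * Φ n)) :=
    (hu.comp (contMDiff_translateL _)).comp hΦ.1
  rw [differential_mcL hΦ.1 hu, A.differential_push hw, differential_Ad hu,
    differential_mcL hΦ.1 (hu.comp (contMDiff_conj k))]
  simp only [hΦ.2]
  simp [mul_assoc]

omit [FiniteDimensional ℝ EM] [T2Space M] [IsManifold IM ∞ M] in
variable {A} in
lemma EquivariantMap.mcR_push {Φ : M → K} (hΦ : A.EquivariantMap Φ) (k : K) (m : M)
    (v : TangentSpace IM m) :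
    (mcR Φ (A.act k m) (A.push k m v) : GroupLieAlgebra J K) = Ad k (mcR Φ m v) := by
  rw [mcR_eq_Ad_mcL hΦ.1, hΦ.mcL_push, mcR_eq_Ad_mcL hΦ.1, hΦ.2, ← Ad_mul, ← Ad_mul]
  simp

end SmoothAction

omit [Group K] in
/-- The product rule for a bilinear form evaluated on families of covectors. -/
lemma differential_bilin {V : Type*} [AddCommGroup V] [Module ℝ V] [FiniteDimensional ℝ V]
    (β : Module.Dual ℝ V →ₗ[ℝ] Module.Dual ℝ V →ₗ[ℝ] ℝ) {C D : K → Module.Dual ℝ V}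
    (hC : ∀ v, SmoothFunction J (fun k => C k v)) (hD : ∀ v, SmoothFunction J (fun k => D k v))
    {k : K} {ξ : TangentSpace J k} {C' D' : Module.Dual ℝ V}
    (hC' : ∀ v, differential (fun k => C k v) k ξ = C' v)
    (hD' : ∀ v, differential (fun k => D k v) k ξ = D' v) :
    differential (fun k => β (C k) (D k)) k ξ = β C' (D k) + β (C k) D' := by
  let b := Module.finBasis ℝ V
  have hexp : ∀ α : Module.Dual ℝ V, α = ∑ i, α (b i) • b.dualBasis i := by
    intro α
    refine b.ext fun j => ?_
    simp
  have hβ : ∀ α γ : Module.Dual ℝ V,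
      β α γ = ∑ i, ∑ j, β (b.dualBasis i) (b.dualBasis j) * (α (b i) * γ (b j)) := by
    intro α γ
    conv_lhs => rw [hexp α, hexp γ]
    simp only [map_sum, map_smul, LinearMap.sum_apply, LinearMap.smul_apply, smul_eq_mul,
      Finset.mul_sum]
    rw [Finset.sum_comm]
    refine Finset.sum_congr rfl fun i _ => Finset.sum_congr rfl fun j _ => ?_
    ring
  have hs := fun i j => (hC (b i)).mul (hD (b j))
  have hs' := fun i j => (SmoothFunction.const (M := K) (β (b.dualBasis i) (b.dualBasis j))).mul
    (hs i j)
  simp_rw [fun k => hβ (C k) (D k)]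
  rw [(differential_sum _ fun i => (SmoothFunction.sum _ fun j => hs' i j).mdiff k).2, hβ, hβ,
    LinearMap.sum_apply, ← Finset.sum_add_distrib]
  refine Finset.sum_congr rfl fun i _ => ?_
  rw [(differential_sum _ fun j => (hs' i j).mdiff k).2, LinearMap.sum_apply,
    ← Finset.sum_add_distrib]
  refine Finset.sum_congr rfl fun j _ => ?_
  rw [differential_const_mul _ ((hs i j).mdiff k),
    differential_mul ((hC (b i)).mdiff k) ((hD (b j)).mdiff k)]
  simp only [LinearMap.smul_apply, LinearMap.add_apply, hC', hD', smul_eq_mul]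
  ring

/-- Infinitesimal invariance of an invariant bivector field. -/
lemma SmoothAction.InvariantBivector.genDeriv_bracket [LieGroup J ∞ K] [J.Boundaryless]
    [IsManifold IM ∞ M] [IM.Boundaryless] [FiniteDimensional ℝ EM]
    {A : SmoothAction J K IM M} {P : SharpField IM M} (hP : A.InvariantBivector P)
    (hPs : IsBivectorField P) {f g : M → ℝ} (hf : SmoothFunction IM f) (hg : SmoothFunction IM g)
    (ξ : GroupLieAlgebra J K) (m : M) :
    A.genDeriv ξ (bracket P f g) m =
      bracket P (A.genDeriv ξ f) g m + bracket P f (A.genDeriv ξ g) m := by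
  have : FiniteDimensional ℝ (TangentSpace IM m) := inferInstanceAs (FiniteDimensional ℝ EM)
  let β : Module.Dual ℝ (TangentSpace IM m) →ₗ[ℝ] Module.Dual ℝ (TangentSpace IM m) →ₗ[ℝ] ℝ :=
    (Module.Dual.eval ℝ (TangentSpace IM m)) ∘ₗ P m
  let C : (M → ℝ) → K → Module.Dual ℝ (TangentSpace IM m) := fun f k =>
    differential (fun x => f (A.act k x)) m
  have hCs : ∀ {f : M → ℝ}, SmoothFunction IM f → ∀ v, SmoothFunction J (fun k => C f k v) := by
    intro f hf v
    exact smoothFunction_partial_const (F := fun p : K × M => f (A.act p.1 p.2))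
      (hf.comp A.smooth) m v
  have hC1 : ∀ f : M → ℝ, C f 1 = differential f m := by
    intro f
    simp only [C, A.one_act]
  have hC' : ∀ {f : M → ℝ}, SmoothFunction IM f → ∀ v,
      differential (IM := J) (fun k => C f k v) 1 ξ =
      (-differential (A.genDeriv ξ f) m) v := by
    intro f hf v
    have h1 := differential_partial_comm (F := fun p : K × M => f (A.act p.1 p.2))
      (hf.comp A.smooth) 1 ξ m v
    refine h1.trans ?_
    have h2 : A.genDeriv ξ f = fun x => -differential (IM := J) (fun k => f (A.act k x)) 1 ξ :=
      funext fun x => A.differential_gen hf x ξ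
    rw [h2, differential_neg, neg_neg]
  have h1 := A.differential_gen (hPs.smooth f g hf hg) m ξ
  have h2 : ∀ k : K, bracket P f g (A.act k m) = β (C f k) (C g k) := by
    intro k
    have hpull : ∀ {f : M → ℝ}, SmoothFunction IM f →
        differential f (A.act k m) ∘ₗ A.push k m = C f k := by
      intro f hf
      ext v
      exact A.differential_push hf k m v
    simp only [bracket]
    rw [hP, hpull hf]
    exact congrArg (fun α => α (P m (C f k))) (hpull hg)
  simp_rw [h2] at h1
  rw [differential_bilin β (hCs hf) (hCs hg) (hC' hf) (hC' hg), hC1, hC1] at h1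
  rw [SmoothAction.genDeriv, h1]
  simp only [β, bracket, LinearMap.comp_apply, Module.Dual.eval_apply, map_neg,
    LinearMap.neg_apply]
  ring

end Action

section CoordDot

variable {V : Type*} [AddCommGroup V] [Module ℝ V] {ι : Type*} [Fintype ι]

/-- The inner product for which the basis `e` is orthonormal. -/
def coordDot (e : Module.Basis ι ℝ V) : V →ₗ[ℝ] Module.Dual ℝ V :=
  ∑ a, (e.coord a).smulRight (e.coord a)

lemma coordDot_apply (e : Module.Basis ι ℝ V) (x y : V) :
    coordDot e x y = ∑ a, e.coord a x * e.coord a y := by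
  simp [coordDot, LinearMap.sum_apply]

lemma coordDot_symm (e : Module.Basis ι ℝ V) (x y : V) : coordDot e x y = coordDot e y x := by
  simp only [coordDot_apply, mul_comm]

lemma coordDot_basis (e : Module.Basis ι ℝ V) (a : ι) (y : V) :
    coordDot e (e a) y = e.coord a y := by
  classical
  rw [coordDot_apply]
  simp [Finsupp.single_apply]

lemma coordDot_basis_right (e : Module.Basis ι ℝ V) (a : ι) (y : V) :
    coordDot e y (e a) = e.coord a y := by
  rw [coordDot_symm, coordDot_basis]

lemma coordDot_ext (e : Module.Basis ι ℝ V) {x y : V} (h : ∀ z, coordDot e x z = coordDot e y z) :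
    x = y := by
  refine e.ext_elem fun a => ?_
  have := h (e a)
  rwa [coordDot_basis_right, coordDot_basis_right] at this

lemma sum_coord_smul {W : Type*} [AddCommGroup W] [Module ℝ W] (e : Module.Basis ι ℝ V)
    (T : V →ₗ[ℝ] W) (x : V) : ∑ a, e.coord a x • T (e a) = T x := by
  conv_rhs => rw [← e.sum_repr x, map_sum]
  simp

lemma exists_coordDot_eq (e : Module.Basis ι ℝ V) (α : Module.Dual ℝ V) :
    ∃ ζ, ∀ x, α x = coordDot e ζ x := by
  refine ⟨∑ a, α (e a) • e a, fun x => ?_⟩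
  rw [map_sum, LinearMap.sum_apply]
  simp_rw [map_smul, LinearMap.smul_apply, coordDot_basis]
  rw [← sum_coord_smul e α x]
  refine Finset.sum_congr rfl fun a _ => ?_
  simp [mul_comm]

end CoordDot

section Invariance

variable {E : Type*} [NormedAddCommGroup E] [NormedSpace ℝ E]
  {H : Type*} [TopologicalSpace H] {J : ModelWithCorners ℝ E H}
  {K : Type*} [TopologicalSpace K] [ChartedSpace H K] [Group K]
  {ι : Type*} [Fintype ι] {e : Module.Basis ι ℝ (GroupLieAlgebra J K)}

/-- The inner product defined by the basis `e` is `Ad`-invariant. -/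
def AdInvariant (e : Module.Basis ι ℝ (GroupLieAlgebra J K)) : Prop :=
  ∀ (g : K) (x y : GroupLieAlgebra J K), coordDot e (Ad g x) (Ad g y) = coordDot e x y

lemma InvariantInnerProduct.IsOrthonormal.form_eq {B : InvariantInnerProduct J K}
    (he : B.IsOrthonormal e) (x y : GroupLieAlgebra J K) : B.form x y = coordDot e x y := by
  classical
  have : B.form = coordDot e := by
    refine e.ext fun a => e.ext fun b => ?_
    rw [coordDot_basis]
    by_cases h : a = b
    · subst h
      simp [he.1 a]
    · rw [he.2 a b h]
      simp [Ne.symm h]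
  rw [this]

lemma InvariantInnerProduct.IsOrthonormal.adInvariant {B : InvariantInnerProduct J K}
    (he : B.IsOrthonormal e) : AdInvariant e := by
  intro g x y
  rw [← he.form_eq, ← he.form_eq, B.invariant]

variable [LieGroup J ∞ K] [FiniteDimensional ℝ E] [T2Space K]

lemma AdInvariant.left (he : AdInvariant e) (g : K) (x y : GroupLieAlgebra J K) :
    coordDot e (Ad g x) y = coordDot e x (Ad g⁻¹ y) := by
  rw [← he g x, Ad_Ad_inv]

lemma AdInvariant.right (he : AdInvariant e) (g : K) (x y : GroupLieAlgebra J K) :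
    coordDot e x (Ad g y) = coordDot e (Ad g⁻¹ x) y := by
  rw [← he g (Ad g⁻¹ x), Ad_Ad_inv]

lemma AdInvariant.bracket_left [J.Boundaryless] (he : AdInvariant e)
    (x y z : GroupLieAlgebra J K) :
    coordDot e ⁅x, y⁆ z + coordDot e y ⁅x, z⁆ = 0 := by
  choose u hu hue using fun a => exists_differential_one_eq (K := K) (J := J) (e.coord a)
  have hs : ∀ (a : ι) (w : GroupLieAlgebra J K),
      SmoothFunction J (fun g : K => e.coord a (Ad g w)) ∧
      differential (IM := J) (fun g : K => e.coord a (Ad g w)) 1 x = e.coord a ⁅x, w⁆ := by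
    intro a w
    have := differential_Ad_apply (hu a) x w
    rwa [hue a] at this
  have hconst : (fun g : K => ∑ a, e.coord a (Ad g y) * e.coord a (Ad g z)) =
      fun _ => coordDot e y z := by
    ext g
    rw [← coordDot_apply, he g]
  have h := congrArg (fun f => differential (IM := J) f 1 x) hconst
  simp only [differential_const, LinearMap.zero_apply] at h
  rw [(differential_sum _ fun a => (((hs a y).1.mul (hs a z).1).mdiff 1)).2,
    LinearMap.sum_apply] at h
  rw [coordDot_apply, coordDot_apply, ← Finset.sum_add_distrib, ← h]
  refine Finset.sum_congr rfl fun a _ => ?_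
  rw [differential_mul ((hs a y).1.mdiff 1) ((hs a z).1.mdiff 1), LinearMap.add_apply,
    LinearMap.smul_apply, LinearMap.smul_apply, (hs a y).2, (hs a z).2, Ad_one, Ad_one]
  simp only [smul_eq_mul]
  ring

omit [T2Space K] in
lemma bracket_swap [J.Boundaryless] (x y : GroupLieAlgebra J K) : ⁅x, y⁆ = -⁅y, x⁆ := by
  have : LieGroup J (minSmoothness ℝ 3) K := by
    rw [minSmoothness_of_isRCLikeNormedField]
    exact LieGroup.of_le (n := ∞) (WithTop.coe_le_coe.2 (le_top : (3 : ℕ∞) ≤ ⊤))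
  have : CompleteSpace E := FiniteDimensional.complete ℝ E
  exact (lie_skew x y).symm

/-- The bracket as a bilinear map. -/
def bracketMap [J.Boundaryless] :
    GroupLieAlgebra J K →ₗ[ℝ] GroupLieAlgebra J K →ₗ[ℝ] GroupLieAlgebra J K :=
  have : LieGroup J (minSmoothness ℝ 3) K := by
    rw [minSmoothness_of_isRCLikeNormedField]
    exact LieGroup.of_le (n := ∞) (WithTop.coe_le_coe.2 (le_top : (3 : ℕ∞) ≤ ⊤))
  have : CompleteSpace E := FiniteDimensional.complete ℝ E
  LinearMap.mk₂ ℝ (fun x y => ⁅x, y⁆) add_lie (fun c x y => smul_lie c x y) lie_add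
    (fun c x y => lie_smul c x y)

omit [T2Space K] in
lemma bracketMap_apply [J.Boundaryless] (x y : GroupLieAlgebra J K) :
    bracketMap x y = ⁅x, y⁆ := rfl

end Invariance

section Intrinsic

variable {E : Type*} [NormedAddCommGroup E] [NormedSpace ℝ E] [FiniteDimensional ℝ E]
  {H : Type*} [TopologicalSpace H] {J : ModelWithCorners ℝ E H}
  {K : Type*} [TopologicalSpace K] [ChartedSpace H K] [Group K] [LieGroup J ∞ K] [T2Space K]
  {EM : Type*} [NormedAddCommGroup EM] [NormedSpace ℝ EM]
  {HM : Type*} [TopologicalSpace HM] {IM : ModelWithCorners ℝ EM HM}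
  {M : Type*} [TopologicalSpace M] [ChartedSpace HM M]
  {ι : Type*} [Fintype ι] {e : Module.Basis ι ℝ (GroupLieAlgebra J K)}
  {A : SmoothAction J K IM M} {Φ : M → K}

omit [FiniteDimensional ℝ E] [LieGroup J ∞ K] [T2Space K] in
/-- The moment map condition for a 2-form, without a basis. -/
lemma momentForm_iff {om : FlatField IM M} :
    (∀ a (m : M), om m (A.gen m (e a)) = (1 / 2 : ℝ) • (pullL e Φ a m + pullR e Φ a m)) ↔
      ∀ m ξ v, om m (A.gen m ξ) v = (1 / 2 : ℝ) * coordDot e ξ (mcL Φ m v + mcR Φ m v) := by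
  constructor
  · intro h m ξ v
    have : ((om m).flip v) ∘ₗ A.gen m =
        (1 / 2 : ℝ) • (coordDot e).flip (mcL Φ m v + mcR Φ m v) := by
      refine e.ext fun a => ?_
      have := congrArg (fun α => α v) (h a m)
      simp only [LinearMap.comp_apply, LinearMap.flip_apply, LinearMap.smul_apply, smul_eq_mul]
      rw [coordDot_basis, map_add]
      exact this
    exact congrArg (fun α => α ξ) this
  · intro h a m
    ext v
    rw [h, coordDot_basis, map_add]
    rfl

omit [FiniteDimensional ℝ E] [LieGroup J ∞ K] [T2Space K] in
/-- The relation between a 2-form and a bivector, without a basis. -/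
lemma related_iff {P : SharpField IM M} {om : FlatField IM M} :
    Related e A Φ P om ↔
      ∀ m v, P m (om m v) = v - (1 / 4 : ℝ) • A.gen m (mcL Φ m v - mcR Φ m v) := by
  have : ∀ (m : M) (v : TangentSpace IM m),
      ∑ a, (pullL e Φ a m v - pullR e Φ a m v) • A.gen m (e a) =
      A.gen m (mcL Φ m v - mcR Φ m v) := by
    intro m v
    rw [← sum_coord_smul e (A.gen m)]
    refine Finset.sum_congr rfl fun a _ => ?_
    rw [map_sub]
    rfl
  unfold Related
  simp_rw [this]

omit [FiniteDimensional ℝ E] [T2Space K] in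
lemma differential_comp_eq_coordDot (hΦ : ContMDiff IM J ∞ Φ) {f : K → ℝ} (hf : SmoothFunction J f)
    {m : M} {ζ : GroupLieAlgebra J K}
    (hζ : ∀ x, differential (IM := J) (fun h => f (Φ m * h)) 1 x = coordDot e ζ x) :
    differential (IM := IM) (f ∘ Φ) m = coordDot e ζ ∘ₗ mcL Φ m := by
  ext v
  exact (differential_comp_eq_mcL hΦ hf m v).trans (hζ _)

lemma sum_leftField_add_rightField (he : AdInvariant e) {f : K → ℝ} (hf : SmoothFunction J f)
    {k : K} {ζ : GroupLieAlgebra J K}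
    (hζ : ∀ x, differential (IM := J) (fun h => f (k * h)) 1 x = coordDot e ζ x)
    {W : Type*} [AddCommGroup W] [Module ℝ W] (T : GroupLieAlgebra J K →ₗ[ℝ] W) :
    ∑ a, ((1 / 2 : ℝ) * (differential (IM := J) f k (leftField (e a) k)
        + differential (IM := J) f k (rightField (e a) k))) • T (e a) =
      (1 / 2 : ℝ) • T (ζ + Ad k ζ) := by
  rw [← sum_coord_smul e T, Finset.smul_sum]
  refine Finset.sum_congr rfl fun a _ => ?_
  have hw : SmoothFunction J (fun h => f (k * h)) := hf.comp (contMDiff_translateL k)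
  have h1 : differential (IM := J) f k (rightField (e a) k) = coordDot e ζ (Ad k⁻¹ (e a)) := by
    rw [differential_rightField hf, ← hζ, differential_Ad hw]
    simp only [inv_inv, mul_assoc, mul_inv_cancel_left]
  rw [differential_leftField hf, hζ, h1, coordDot_basis_right, ← he.left, coordDot_basis_right,
    smul_smul, map_add]

/-- The moment map condition for a bivector, without a basis. -/
lemma momentBivector_iff (he : AdInvariant e) (hΦ : ContMDiff IM J ∞ Φ) {P : SharpField IM M} :
    (∀ f : K → ℝ, SmoothFunction J f → ∀ m : M,
      P m (differential (f ∘ Φ) m) = ∑ a,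
        ((1 / 2 : ℝ) * (differential (IM := J) f (Φ m) (leftField (e a) (Φ m))
          + differential (IM := J) f (Φ m) (rightField (e a) (Φ m)))) • A.gen m (e a)) ↔
      ∀ m ζ, P m (coordDot e ζ ∘ₗ mcL Φ m) = (1 / 2 : ℝ) • A.gen m (ζ + Ad (Φ m) ζ) := by
  constructor
  · intro h m ζ
    obtain ⟨u, hu, hζ⟩ := exists_differential_one_eq (K := K) (coordDot e ζ)
    have hf : SmoothFunction J (fun k => u ((Φ m)⁻¹ * k)) := hu.comp (contMDiff_translateL _)
    have hfζ : ∀ x, differential (IM := J) (fun h => u ((Φ m)⁻¹ * (Φ m * h))) 1 x =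
        coordDot e ζ x := by
      intro x
      simp only [inv_mul_cancel_left, hζ]
    rw [← differential_comp_eq_coordDot hΦ hf hfζ, h _ hf m,
      sum_leftField_add_rightField he hf hfζ]
  · intro h f hf m
    obtain ⟨ζ, hζ⟩ := exists_coordDot_eq e (differential (IM := J) (fun h => f (Φ m * h)) 1)
    rw [differential_comp_eq_coordDot hΦ hf hζ, h, sum_leftField_add_rightField he hf hζ]

end Intrinsic

section Product

variable {E : Type*} [NormedAddCommGroup E] [NormedSpace ℝ E]
  {H : Type*} [TopologicalSpace H] {I : ModelWithCorners ℝ E H}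
  {G : Type*} [TopologicalSpace G] [ChartedSpace H G] [Group G]
  {EM : Type*} [NormedAddCommGroup EM] [NormedSpace ℝ EM]
  {HM : Type*} [TopologicalSpace HM] {IM : ModelWithCorners ℝ EM HM}
  {M : Type*} [TopologicalSpace M] [ChartedSpace HM M]
  {ι : Type*}

/-- The projection of the Lie algebra of `G × G` to the first summand. -/
def fstAlgebra : GroupLieAlgebra (I.prod I) (G × G) →ₗ[ℝ] GroupLieAlgebra I G :=
  LinearMap.fst ℝ (GroupLieAlgebra I G) (GroupLieAlgebra I G)

/-- The projection of the Lie algebra of `G × G` to the second summand. -/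
def sndAlgebra : GroupLieAlgebra (I.prod I) (G × G) →ₗ[ℝ] GroupLieAlgebra I G :=
  LinearMap.snd ℝ (GroupLieAlgebra I G) (GroupLieAlgebra I G)

@[simp] lemma fstAlgebra_inl (ξ : GroupLieAlgebra I G) : fstAlgebra (inlAlgebra ξ) = ξ := rfl
@[simp] lemma fstAlgebra_inr (ξ : GroupLieAlgebra I G) : fstAlgebra (inrAlgebra ξ) = 0 := rfl
@[simp] lemma sndAlgebra_inl (ξ : GroupLieAlgebra I G) : sndAlgebra (inlAlgebra ξ) = 0 := rfl
@[simp] lemma sndAlgebra_inr (ξ : GroupLieAlgebra I G) : sndAlgebra (inrAlgebra ξ) = ξ := rfl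

lemma prodAlgebra_ext {x y : GroupLieAlgebra (I.prod I) (G × G)}
    (h₁ : fstAlgebra x = fstAlgebra y) (h₂ : sndAlgebra x = sndAlgebra y) : x = y :=
  Prod.ext h₁ h₂

lemma inl_fst_add_inr_snd (x : GroupLieAlgebra (I.prod I) (G × G)) :
    inlAlgebra (fstAlgebra x) + inrAlgebra (sndAlgebra x) = x :=
  prodAlgebra_ext (by simp) (by simp)

lemma doubleBasis_coord_inl (e : Module.Basis ι ℝ (GroupLieAlgebra I G)) (a : ι)
    (x : GroupLieAlgebra (I.prod I) (G × G)) :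
    (doubleBasis e).coord (Sum.inl a) x = e.coord a (fstAlgebra x) :=
  Module.Basis.prod_repr_inl e e x a

lemma doubleBasis_coord_inr (e : Module.Basis ι ℝ (GroupLieAlgebra I G)) (a : ι)
    (x : GroupLieAlgebra (I.prod I) (G × G)) :
    (doubleBasis e).coord (Sum.inr a) x = e.coord a (sndAlgebra x) :=
  Module.Basis.prod_repr_inr e e x a

lemma coordDot_doubleBasis [Fintype ι] (e : Module.Basis ι ℝ (GroupLieAlgebra I G))
    (x y : GroupLieAlgebra (I.prod I) (G × G)) :
    coordDot (doubleBasis e) x y = coordDot e (fstAlgebra x) (fstAlgebra y)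
      + coordDot e (sndAlgebra x) (sndAlgebra y) := by
  rw [coordDot_apply, coordDot_apply, coordDot_apply, Fintype.sum_sum_type]
  simp only [doubleBasis_coord_inl, doubleBasis_coord_inr]

lemma differential_fstAlgebra {u : G → ℝ} (hu : SmoothFunction I u)
    (x : GroupLieAlgebra (I.prod I) (G × G)) :
    differential (IM := I) u 1 (fstAlgebra x) =
      differential (IM := I.prod I) (fun p : G × G => u p.1) 1 x := by
  rw [differential_comp (IN := I) (g := Prod.fst) (m := (1 : G × G)) (hu.mdiff _)
    (contMDiff_fst.mdiff (1 : G × G)), mfderiv_fst]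
  rfl

lemma differential_sndAlgebra {u : G → ℝ} (hu : SmoothFunction I u)
    (x : GroupLieAlgebra (I.prod I) (G × G)) :
    differential (IM := I) u 1 (sndAlgebra x) =
      differential (IM := I.prod I) (fun p : G × G => u p.2) 1 x := by
  rw [differential_comp (IN := I) (g := Prod.snd) (m := (1 : G × G)) (hu.mdiff _)
    (contMDiff_snd.mdiff (1 : G × G)), mfderiv_snd]
  rfl

variable [LieGroup I ∞ G] [FiniteDimensional ℝ E] [T2Space G]

lemma fstAlgebra_Ad (k : G × G) (x : GroupLieAlgebra (I.prod I) (G × G)) :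
    fstAlgebra (Ad k x) = Ad k.1 (fstAlgebra x) := by
  refine tangent_ext fun u hu => ?_
  have hu' : SmoothFunction (I.prod I) (fun p : G × G => u p.1) := hu.comp contMDiff_fst
  rw [differential_fstAlgebra hu, differential_Ad hu', differential_Ad hu,
    differential_fstAlgebra (hu.comp (contMDiff_conj k.1))]
  rfl

lemma sndAlgebra_Ad (k : G × G) (x : GroupLieAlgebra (I.prod I) (G × G)) :
    sndAlgebra (Ad k x) = Ad k.2 (sndAlgebra x) := by
  refine tangent_ext fun u hu => ?_
  have hu' : SmoothFunction (I.prod I) (fun p : G × G => u p.2) := hu.comp contMDiff_snd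
  rw [differential_sndAlgebra hu, differential_Ad hu', differential_Ad hu,
    differential_sndAlgebra (hu.comp (contMDiff_conj k.2))]
  rfl

lemma fstAlgebra_bracket [I.Boundaryless] (x y : GroupLieAlgebra (I.prod I) (G × G)) :
    fstAlgebra ⁅x, y⁆ = ⁅fstAlgebra x, fstAlgebra y⁆ :=
  bracket_map contMDiff_fst (fun _ _ => rfl) (fun _ hu => differential_fstAlgebra hu) x y

lemma sndAlgebra_bracket [I.Boundaryless] (x y : GroupLieAlgebra (I.prod I) (G × G)) :
    sndAlgebra ⁅x, y⁆ = ⁅sndAlgebra x, sndAlgebra y⁆ :=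
  bracket_map contMDiff_snd (fun _ _ => rfl) (fun _ hu => differential_sndAlgebra hu) x y

lemma AdInvariant.doubleBasis [Fintype ι] {e : Module.Basis ι ℝ (GroupLieAlgebra I G)}
    (he : AdInvariant e) : AdInvariant (doubleBasis e) := by
  intro k x y
  rw [coordDot_doubleBasis, coordDot_doubleBasis, fstAlgebra_Ad, fstAlgebra_Ad, sndAlgebra_Ad,
    sndAlgebra_Ad, he, he]

variable {Φ₁ Φ₂ : M → G} (h₁ : ContMDiff IM I ∞ Φ₁) (h₂ : ContMDiff IM I ∞ Φ₂)
include h₁ h₂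

lemma fstAlgebra_mcL (m : M) (v : TangentSpace IM m) :
    fstAlgebra (mcL (fun n => (Φ₁ n, Φ₂ n)) m v) = (mcL Φ₁ m v : GroupLieAlgebra I G) := by
  refine tangent_ext fun u hu => ?_
  have hu' : SmoothFunction (I.prod I) (fun p : G × G => u p.1) := hu.comp contMDiff_fst
  rw [differential_fstAlgebra hu, differential_mcL (h₁.prodMk h₂) hu', differential_mcL h₁ hu]
  rfl

lemma sndAlgebra_mcL (m : M) (v : TangentSpace IM m) :
    sndAlgebra (mcL (fun n => (Φ₁ n, Φ₂ n)) m v) = (mcL Φ₂ m v : GroupLieAlgebra I G) := by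
  refine tangent_ext fun u hu => ?_
  have hu' : SmoothFunction (I.prod I) (fun p : G × G => u p.2) := hu.comp contMDiff_snd
  rw [differential_sndAlgebra hu, differential_mcL (h₁.prodMk h₂) hu', differential_mcL h₂ hu]
  rfl

lemma fstAlgebra_mcR (m : M) (v : TangentSpace IM m) :
    fstAlgebra (mcR (fun n => (Φ₁ n, Φ₂ n)) m v) = (mcR Φ₁ m v : GroupLieAlgebra I G) := by
  rw [mcR_eq_Ad_mcL (h₁.prodMk h₂), fstAlgebra_Ad, fstAlgebra_mcL h₁ h₂, mcR_eq_Ad_mcL h₁]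

lemma sndAlgebra_mcR (m : M) (v : TangentSpace IM m) :
    sndAlgebra (mcR (fun n => (Φ₁ n, Φ₂ n)) m v) = (mcR Φ₂ m v : GroupLieAlgebra I G) := by
  rw [mcR_eq_Ad_mcL (h₁.prodMk h₂), sndAlgebra_Ad, sndAlgebra_mcL h₁ h₂, mcR_eq_Ad_mcL h₂]

end Product

section Fusion

variable {E : Type*} [NormedAddCommGroup E] [NormedSpace ℝ E]
  {H : Type*} [TopologicalSpace H] {I : ModelWithCorners ℝ E H}
  {G : Type*} [TopologicalSpace G] [ChartedSpace H G] [Group G]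
  {EM : Type*} [NormedAddCommGroup EM] [NormedSpace ℝ EM]
  {HM : Type*} [TopologicalSpace HM] {IM : ModelWithCorners ℝ EM HM}
  {M : Type*} [TopologicalSpace M] [ChartedSpace HM M]
  {ι : Type*} {e : Module.Basis ι ℝ (GroupLieAlgebra I G)}
  {A : SmoothAction (I.prod I) (G × G) IM M} {Φ₁ Φ₂ : M → G}

lemma gen_eq_gen₁_add_gen₂ (m : M) (x : GroupLieAlgebra (I.prod I) (G × G)) :
    A.gen m x = gen₁ A m (fstAlgebra x) + gen₂ A m (sndAlgebra x) := by
  conv_lhs => rw [← inl_fst_add_inr_snd x, map_add]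
  rfl

namespace SmoothAction

lemma EquivariantMap.fst (hΦ : A.EquivariantMap (fun m => (Φ₁ m, Φ₂ m))) :
    ContMDiff IM I ∞ Φ₁ := contMDiff_fst.comp hΦ.1

lemma EquivariantMap.snd (hΦ : A.EquivariantMap (fun m => (Φ₁ m, Φ₂ m))) :
    ContMDiff IM I ∞ Φ₂ := contMDiff_snd.comp hΦ.1

lemma EquivariantMap.fst_act (hΦ : A.EquivariantMap (fun m => (Φ₁ m, Φ₂ m))) (k : G × G) (m : M) :
    Φ₁ (A.act k m) = k.1 * Φ₁ m * k.1⁻¹ := congrArg Prod.fst (hΦ.2 k m)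

lemma EquivariantMap.snd_act (hΦ : A.EquivariantMap (fun m => (Φ₁ m, Φ₂ m))) (k : G × G) (m : M) :
    Φ₂ (A.act k m) = k.2 * Φ₂ m * k.2⁻¹ := congrArg Prod.snd (hΦ.2 k m)

variable [LieGroup I ∞ G]

lemma EquivariantMap.diag (hΦ : A.EquivariantMap (fun m => (Φ₁ m, Φ₂ m))) :
    A.diag.EquivariantMap (fun m => Φ₁ m * Φ₂ m) := by
  refine ⟨hΦ.fst.mul hΦ.snd, fun k m => ?_⟩
  have h1 : Φ₁ (A.diag.act k m) = k * Φ₁ m * k⁻¹ := hΦ.fst_act (k, k) m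
  have h2 : Φ₂ (A.diag.act k m) = k * Φ₂ m * k⁻¹ := hΦ.snd_act (k, k) m
  simp only [h1, h2]
  group

omit [LieGroup I ∞ G] in
lemma diag_gen [FiniteDimensional ℝ EM] [T2Space M] [IsManifold IM ∞ M] (m : M)
    (ξ : GroupLieAlgebra I G) : A.diag.gen m ξ = gen₁ A m ξ + gen₂ A m ξ := by
  refine tangent_ext fun f hf => ?_
  have hF : SmoothFunction (I.prod I) (fun p : G × G => f (A.act p m)) :=
    hf.comp (A.contMDiff_orbit m)
  have h1 : gen₁ A m ξ + gen₂ A m ξ = A.gen m (inlAlgebra ξ + inrAlgebra ξ) := by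
    rw [map_add]
    rfl
  have h2 := differential_comp (IM := I) (IN := I.prod I) (g := fun k : G => (k, k)) (m := 1)
    (f := fun p : G × G => f (A.act p m)) (hF.mdiff _)
    ((contMDiff_id.prodMk contMDiff_id).mdiff (1 : G)) ξ
  rw [h1, A.diag.differential_gen hf, A.differential_gen hf]
  refine congrArg Neg.neg (h2.trans (congrArg _ ?_))
  have hid : ContMDiff I I ∞ (fun k : G => k) := contMDiff_id
  rw [(hid.mdiff (1 : G)).mfderiv_prod (hid.mdiff (1 : G))]
  have h3 : mfderiv I I (fun k : G => k) 1 = ContinuousLinearMap.id ℝ _ := mfderiv_id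
  rw [h3]
  exact prodAlgebra_ext (by simp; rfl) (by simp; rfl)

variable [FiniteDimensional ℝ E] [T2Space G]

lemma EquivariantMap.mcL_fst_gen (hΦ : A.EquivariantMap (fun m => (Φ₁ m, Φ₂ m))) (m : M)
    (x : GroupLieAlgebra (I.prod I) (G × G)) :
    mcL Φ₁ m (A.gen m x) = fstAlgebra x - Ad (Φ₁ m)⁻¹ (fstAlgebra x) := by
  rw [← fstAlgebra_mcL hΦ.fst hΦ.snd, hΦ.mcL_gen, map_sub, fstAlgebra_Ad]
  rfl

lemma EquivariantMap.mcR_snd_gen (hΦ : A.EquivariantMap (fun m => (Φ₁ m, Φ₂ m))) (m : M)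
    (x : GroupLieAlgebra (I.prod I) (G × G)) :
    mcR Φ₂ m (A.gen m x) = Ad (Φ₂ m) (sndAlgebra x) - sndAlgebra x := by
  rw [← sndAlgebra_mcR hΦ.fst hΦ.snd, hΦ.mcR_gen, map_sub, sndAlgebra_Ad]

lemma EquivariantMap.mcL_fst_push (hΦ : A.EquivariantMap (fun m => (Φ₁ m, Φ₂ m))) (k : G × G)
    (m : M) (v : TangentSpace IM m) :
    (mcL Φ₁ (A.act k m) (A.push k m v) : GroupLieAlgebra I G) = Ad k.1 (mcL Φ₁ m v) := by
  rw [← fstAlgebra_mcL hΦ.fst hΦ.snd, hΦ.mcL_push, fstAlgebra_Ad, fstAlgebra_mcL hΦ.fst hΦ.snd]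

lemma EquivariantMap.mcR_snd_push (hΦ : A.EquivariantMap (fun m => (Φ₁ m, Φ₂ m))) (k : G × G)
    (m : M) (v : TangentSpace IM m) :
    (mcR Φ₂ (A.act k m) (A.push k m v) : GroupLieAlgebra I G) = Ad k.2 (mcR Φ₂ m v) := by
  rw [← sndAlgebra_mcR hΦ.fst hΦ.snd, hΦ.mcR_push, sndAlgebra_Ad, sndAlgebra_mcR hΦ.fst hΦ.snd]

end SmoothAction

variable [Fintype ι]

lemma psiField_apply {m : M} {α : Module.Dual ℝ (TangentSpace IM m)} {p q : GroupLieAlgebra I G}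
    (hp : ∀ ξ, α (gen₁ A m ξ) = coordDot e p ξ) (hq : ∀ ξ, α (gen₂ A m ξ) = coordDot e q ξ) :
    psiField e A m α = (1 / 2 : ℝ) • (gen₂ A m p - gen₁ A m q) := by
  rw [← sum_coord_smul e (gen₂ A m) p, ← sum_coord_smul e (gen₁ A m) q, ← Finset.sum_sub_distrib]
  unfold psiField
  rw [LinearMap.smul_apply, LinearMap.sum_apply]
  refine congrArg _ (Finset.sum_congr rfl fun a _ => ?_)
  rw [← coordDot_basis_right e a p, ← coordDot_basis_right e a q, ← hp, ← hq]
  rfl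

lemma fusedForm_eq {om : FlatField IM M} (m : M) (v : TangentSpace IM m) :
    fusedForm e Φ₁ Φ₂ om m v = om m v - (1 / 2 : ℝ) • (coordDot e (mcL Φ₁ m v) ∘ₗ mcR Φ₂ m
      - coordDot e (mcR Φ₂ m v) ∘ₗ mcL Φ₁ m) := by
  ext w
  simp only [fusedForm, LinearMap.sub_apply, LinearMap.smul_apply, LinearMap.sum_apply,
    LinearMap.comp_apply, coordDot_apply, ← Finset.sum_sub_distrib]
  rfl

lemma fusedForm_apply {om : FlatField IM M} (m : M) (v w : TangentSpace IM m) :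
    fusedForm e Φ₁ Φ₂ om m v w = om m v w - (1 / 2 : ℝ) * (coordDot e (mcL Φ₁ m v) (mcR Φ₂ m w)
      - coordDot e (mcL Φ₁ m w) (mcR Φ₂ m v)) := by
  rw [fusedForm_eq, coordDot_symm e (mcL Φ₁ m w)]
  rfl

variable [LieGroup I ∞ G] [FiniteDimensional ℝ E] [T2Space G]

section Pointwise

variable (he : AdInvariant e) (hΦ : A.EquivariantMap (fun m => (Φ₁ m, Φ₂ m)))
  {om : FlatField IM M} {P : SharpField IM M}

include hΦ

lemma moment₁
    (hom : ∀ m ξ v, om m (A.gen m ξ) v = (1 / 2 : ℝ) * coordDot (doubleBasis e) ξ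
      (mcL (fun m => (Φ₁ m, Φ₂ m)) m v + mcR (fun m => (Φ₁ m, Φ₂ m)) m v))
    (m : M) (ξ : GroupLieAlgebra I G) (v : TangentSpace IM m) :
    om m (gen₁ A m ξ) v = (1 / 2 : ℝ) * coordDot e ξ (mcL Φ₁ m v + mcR Φ₁ m v) := by
  refine (hom m (inlAlgebra ξ) v).trans ?_
  rw [coordDot_doubleBasis, map_add, fstAlgebra_mcL hΦ.fst hΦ.snd, fstAlgebra_mcR hΦ.fst hΦ.snd]
  simp

lemma moment₂
    (hom : ∀ m ξ v, om m (A.gen m ξ) v = (1 / 2 : ℝ) * coordDot (doubleBasis e) ξ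
      (mcL (fun m => (Φ₁ m, Φ₂ m)) m v + mcR (fun m => (Φ₁ m, Φ₂ m)) m v))
    (m : M) (ξ : GroupLieAlgebra I G) (v : TangentSpace IM m) :
    om m (gen₂ A m ξ) v = (1 / 2 : ℝ) * coordDot e ξ (mcL Φ₂ m v + mcR Φ₂ m v) := by
  refine (hom m (inrAlgebra ξ) v).trans ?_
  rw [coordDot_doubleBasis, map_add sndAlgebra, sndAlgebra_mcL hΦ.fst hΦ.snd,
    sndAlgebra_mcR hΦ.fst hΦ.snd]
  simp

lemma bivector_mcL_fst
    (hP : ∀ m ζ, P m (coordDot (doubleBasis e) ζ ∘ₗ mcL (fun m => (Φ₁ m, Φ₂ m)) m) =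
      (1 / 2 : ℝ) • A.gen m (ζ + Ad (Φ₁ m, Φ₂ m) ζ)) (m : M) (ζ : GroupLieAlgebra I G) :
    P m (coordDot e ζ ∘ₗ mcL Φ₁ m) = (1 / 2 : ℝ) • gen₁ A m (ζ + Ad (Φ₁ m) ζ) := by
  have h := hP m (inlAlgebra ζ)
  rw [gen_eq_gen₁_add_gen₂] at h
  simp only [map_add fstAlgebra, map_add sndAlgebra, fstAlgebra_Ad, sndAlgebra_Ad, fstAlgebra_inl,
    sndAlgebra_inl, map_zero, add_zero] at h
  rw [← h]
  congr 1
  ext v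
  simp only [LinearMap.comp_apply]
  rw [coordDot_doubleBasis, fstAlgebra_mcL hΦ.fst hΦ.snd]
  simp

lemma bivector_mcL_snd
    (hP : ∀ m ζ, P m (coordDot (doubleBasis e) ζ ∘ₗ mcL (fun m => (Φ₁ m, Φ₂ m)) m) =
      (1 / 2 : ℝ) • A.gen m (ζ + Ad (Φ₁ m, Φ₂ m) ζ)) (m : M) (ζ : GroupLieAlgebra I G) :
    P m (coordDot e ζ ∘ₗ mcL Φ₂ m) = (1 / 2 : ℝ) • gen₂ A m (ζ + Ad (Φ₂ m) ζ) := by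
  have h := hP m (inrAlgebra ζ)
  rw [gen_eq_gen₁_add_gen₂] at h
  simp only [map_add fstAlgebra, map_add sndAlgebra, fstAlgebra_Ad, sndAlgebra_Ad, fstAlgebra_inr,
    sndAlgebra_inr, map_zero, add_zero, zero_add] at h
  rw [← h]
  congr 1
  ext v
  simp only [LinearMap.comp_apply]
  rw [coordDot_doubleBasis, sndAlgebra_mcL hΦ.fst hΦ.snd]
  simp

omit [Fintype ι] in
lemma mcL_fst_gen₁ (m : M) (ξ : GroupLieAlgebra I G) :
    mcL Φ₁ m (gen₁ A m ξ) = ξ - Ad (Φ₁ m)⁻¹ ξ := hΦ.mcL_fst_gen m (inlAlgebra ξ)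

omit [Fintype ι] in
lemma mcL_fst_gen₂ (m : M) (ξ : GroupLieAlgebra I G) :
    mcL Φ₁ m (gen₂ A m ξ) = (0 : GroupLieAlgebra I G) := by
  refine (hΦ.mcL_fst_gen m (inrAlgebra ξ)).trans ?_
  simp

omit [Fintype ι] in
lemma mcR_snd_gen₁ (m : M) (ξ : GroupLieAlgebra I G) :
    mcR Φ₂ m (gen₁ A m ξ) = (0 : GroupLieAlgebra I G) := by
  refine (hΦ.mcR_snd_gen m (inlAlgebra ξ)).trans ?_
  simp

omit [Fintype ι] in
lemma mcR_snd_gen₂ (m : M) (ξ : GroupLieAlgebra I G) :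
    mcR Φ₂ m (gen₂ A m ξ) = Ad (Φ₂ m) ξ - ξ := hΦ.mcR_snd_gen m (inrAlgebra ξ)

include he

lemma coordDot_mcR_snd (m : M) (ζ : GroupLieAlgebra I G) :
    coordDot e ζ ∘ₗ mcR (IM := IM) Φ₂ m = coordDot e (Ad (Φ₂ m)⁻¹ ζ) ∘ₗ mcL Φ₂ m := by
  ext v
  simp only [LinearMap.comp_apply]
  rw [mcR_eq_Ad_mcL hΦ.snd, he.right]

/-- The bivector `ψ_M` on the pull-backs of invariant forms. -/
lemma psiField_mcL_mcR (m : M) (ζ ζ' : GroupLieAlgebra I G) :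
    psiField e A m (coordDot e ζ ∘ₗ mcL Φ₁ m + coordDot e ζ' ∘ₗ mcR Φ₂ m) =
      (1 / 2 : ℝ) • (gen₂ A m (ζ - Ad (Φ₁ m) ζ) - gen₁ A m (Ad (Φ₂ m)⁻¹ ζ' - ζ')) := by
  refine psiField_apply (fun ξ => ?_) (fun ξ => ?_)
  · rw [LinearMap.add_apply, LinearMap.comp_apply, LinearMap.comp_apply, mcL_fst_gen₁ hΦ,
      mcR_snd_gen₁ hΦ, map_zero, add_zero, map_sub, map_sub, LinearMap.sub_apply, he.left]
  · rw [LinearMap.add_apply, LinearMap.comp_apply, LinearMap.comp_apply, mcL_fst_gen₂ hΦ,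
      mcR_snd_gen₂ hΦ, map_zero, zero_add, map_sub, map_sub, LinearMap.sub_apply, he.right]

omit he in
lemma psiField_form
    (hom : ∀ m ξ v, om m (A.gen m ξ) v = (1 / 2 : ℝ) * coordDot (doubleBasis e) ξ
      (mcL (fun m => (Φ₁ m, Φ₂ m)) m v + mcR (fun m => (Φ₁ m, Φ₂ m)) m v))
    (hskew : ∀ (m : M) (v w : TangentSpace IM m), om m v w = -om m w v)
    (m : M) (v : TangentSpace IM m) :
    psiField e A m (om m v) = (1 / 2 : ℝ) •
      (gen₂ A m (-(1 / 2 : ℝ) • (mcL Φ₁ m v + mcR Φ₁ m v))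
        - gen₁ A m (-(1 / 2 : ℝ) • (mcL Φ₂ m v + mcR Φ₂ m v))) := by
  refine psiField_apply (fun ξ => ?_) (fun ξ => ?_)
  · rw [hskew, moment₁ hΦ hom, coordDot_symm, map_smul, LinearMap.smul_apply, smul_eq_mul]
    ring
  · rw [hskew, moment₂ hΦ hom, coordDot_symm, map_smul, LinearMap.smul_apply, smul_eq_mul]
    ring

/-- The relation between the fused bivector and the fused 2-form. -/
lemma fused_related [FiniteDimensional ℝ EM] [T2Space M] [IsManifold IM ∞ M]
    (hom : ∀ m ξ v, om m (A.gen m ξ) v = (1 / 2 : ℝ) * coordDot (doubleBasis e) ξ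
      (mcL (fun m => (Φ₁ m, Φ₂ m)) m v + mcR (fun m => (Φ₁ m, Φ₂ m)) m v))
    (hskew : ∀ (m : M) (v w : TangentSpace IM m), om m v w = -om m w v)
    (hP : ∀ m ζ, P m (coordDot (doubleBasis e) ζ ∘ₗ mcL (fun m => (Φ₁ m, Φ₂ m)) m) =
      (1 / 2 : ℝ) • A.gen m (ζ + Ad (Φ₁ m, Φ₂ m) ζ))
    (hrel : ∀ m v, P m (om m v) = v - (1 / 4 : ℝ) • A.gen m
      (mcL (fun m => (Φ₁ m, Φ₂ m)) m v - mcR (fun m => (Φ₁ m, Φ₂ m)) m v))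
    (m : M) (v : TangentSpace IM m) :
    fusedBivector e A P m (fusedForm e Φ₁ Φ₂ om m v) = v - (1 / 4 : ℝ) • A.diag.gen m
      (mcL (fun m => Φ₁ m * Φ₂ m) m v - mcR (fun m => Φ₁ m * Φ₂ m) m v) := by
  have hform : fusedForm e Φ₁ Φ₂ om m v = om m v + (1 / 2 : ℝ) •
      (coordDot e (mcR Φ₂ m v) ∘ₗ mcL Φ₁ m + coordDot e (-mcL Φ₁ m v) ∘ₗ mcR Φ₂ m) := by
    rw [fusedForm_eq, map_neg, LinearMap.neg_comp]
    module
  have hPform : P m (fusedForm e Φ₁ Φ₂ om m v) = P m (om m v) + (1 / 2 : ℝ) •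
      ((1 / 2 : ℝ) • gen₁ A m (mcR Φ₂ m v + Ad (Φ₁ m) (mcR Φ₂ m v)) -
        (1 / 2 : ℝ) • gen₂ A m (Ad (Φ₂ m)⁻¹ (mcL Φ₁ m v) + mcL Φ₁ m v)) := by
    rw [hform, coordDot_mcR_snd he hΦ, map_add, map_smul, map_add, bivector_mcL_fst hΦ hP,
      bivector_mcL_snd hΦ hP, Ad_Ad_inv, map_neg (Ad (Φ₂ m)⁻¹)]
    simp only [map_add, map_neg]
    module
  have hψ : psiField e A m (fusedForm e Φ₁ Φ₂ om m v) = psiField e A m (om m v) + (1 / 2 : ℝ) •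
      ((1 / 2 : ℝ) • (gen₂ A m (mcR Φ₂ m v - Ad (Φ₁ m) (mcR Φ₂ m v)) -
        gen₁ A m (Ad (Φ₂ m)⁻¹ (-mcL Φ₁ m v) - -mcL Φ₁ m v))) := by
    rw [hform, map_add, map_smul, psiField_mcL_mcR he hΦ]
  have h1 : fusedBivector e A P m (fusedForm e Φ₁ Φ₂ om m v) =
    P m (fusedForm e Φ₁ Φ₂ om m v) - psiField e A m (fusedForm e Φ₁ Φ₂ om m v) := rfl
  rw [h1, hPform, hψ, hrel, psiField_form hΦ hom hskew, SmoothAction.diag_gen,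
    mcL_mul hΦ.fst hΦ.snd, mcR_mul hΦ.fst hΦ.snd, gen_eq_gen₁_add_gen₂]
  rw [map_sub fstAlgebra, map_sub sndAlgebra, fstAlgebra_mcL hΦ.fst hΦ.snd,
    fstAlgebra_mcR hΦ.fst hΦ.snd, sndAlgebra_mcL hΦ.fst hΦ.snd, sndAlgebra_mcR hΦ.fst hΦ.snd]
  simp only [map_add, map_sub, map_neg, map_smul]
  module

/-- The moment map condition for the fused 2-form. -/
lemma fused_momentForm [FiniteDimensional ℝ EM] [T2Space M] [IsManifold IM ∞ M]
    (hom : ∀ m ξ v, om m (A.gen m ξ) v = (1 / 2 : ℝ) * coordDot (doubleBasis e) ξ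
      (mcL (fun m => (Φ₁ m, Φ₂ m)) m v + mcR (fun m => (Φ₁ m, Φ₂ m)) m v))
    (m : M) (ξ : GroupLieAlgebra I G) (v : TangentSpace IM m) :
    fusedForm e Φ₁ Φ₂ om m (A.diag.gen m ξ) v = (1 / 2 : ℝ) * coordDot e ξ
      (mcL (fun m => Φ₁ m * Φ₂ m) m v + mcR (fun m => Φ₁ m * Φ₂ m) m v) := by
  rw [fusedForm_apply, SmoothAction.diag_gen, map_add (om m), LinearMap.add_apply,
    moment₁ hΦ hom, moment₂ hΦ hom, map_add (mcL Φ₁ m), map_add (mcR Φ₂ m), mcL_fst_gen₁ hΦ,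
    mcL_fst_gen₂ hΦ, mcR_snd_gen₁ hΦ, mcR_snd_gen₂ hΦ, mcL_mul hΦ.fst hΦ.snd,
    mcR_mul hΦ.fst hΦ.snd, add_zero, zero_add]
  simp only [map_add, map_sub, LinearMap.sub_apply]
  rw [he.left, inv_inv, coordDot_symm e (mcL Φ₁ m v) (Ad (Φ₂ m) ξ), he.left,
    coordDot_symm e (mcL Φ₁ m v) ξ]
  ring

/-- The moment map condition for the fused bivector. -/
lemma fused_momentBivector [FiniteDimensional ℝ EM] [T2Space M] [IsManifold IM ∞ M]
    (hP : ∀ m ζ, P m (coordDot (doubleBasis e) ζ ∘ₗ mcL (fun m => (Φ₁ m, Φ₂ m)) m) =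
      (1 / 2 : ℝ) • A.gen m (ζ + Ad (Φ₁ m, Φ₂ m) ζ)) (m : M) (ζ : GroupLieAlgebra I G) :
    fusedBivector e A P m (coordDot e ζ ∘ₗ mcL (fun m => Φ₁ m * Φ₂ m) m) =
      (1 / 2 : ℝ) • A.diag.gen m (ζ + Ad (Φ₁ m * Φ₂ m) ζ) := by
  have hα : coordDot e ζ ∘ₗ mcL (fun m => Φ₁ m * Φ₂ m) m =
      coordDot e (Ad (Φ₂ m) ζ) ∘ₗ mcL (IM := IM) Φ₁ m + coordDot e ζ ∘ₗ mcL Φ₂ m := by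
    ext v
    simp only [LinearMap.comp_apply, LinearMap.add_apply]
    rw [mcL_mul hΦ.fst hΦ.snd, map_add, he.left, add_comm]
  have hα' : coordDot e ζ ∘ₗ mcL (fun m => Φ₁ m * Φ₂ m) m =
      coordDot e (Ad (Φ₂ m) ζ) ∘ₗ mcL (IM := IM) Φ₁ m
        + coordDot e (Ad (Φ₂ m) ζ) ∘ₗ mcR Φ₂ m := by
    rw [hα, coordDot_mcR_snd he hΦ, Ad_inv_Ad]
  have h1 : fusedBivector e A P m (coordDot e ζ ∘ₗ mcL (fun m => Φ₁ m * Φ₂ m) m) =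
    P m (coordDot e ζ ∘ₗ mcL (fun m => Φ₁ m * Φ₂ m) m)
      - psiField e A m (coordDot e ζ ∘ₗ mcL (fun m => Φ₁ m * Φ₂ m) m) := rfl
  rw [h1, hα', psiField_mcL_mcR he hΦ, ← hα', hα, map_add, bivector_mcL_fst hΦ hP,
    bivector_mcL_snd hΦ hP, SmoothAction.diag_gen, Ad_inv_Ad, Ad_mul]
  simp only [map_add, map_sub]
  module

end Pointwise

/-- The kernel of a 2-form which is related to some bivector field. -/
lemma ker_eq_of_related {K : Type*} [TopologicalSpace K] [ChartedSpace H K] [Group K]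
    [LieGroup I ∞ K] [T2Space K] {e : Module.Basis ι ℝ (GroupLieAlgebra I K)}
    {A : SmoothAction I K IM M} {Φ : M → K}
    (he : AdInvariant e) (hΦ : A.EquivariantMap Φ) {om : FlatField IM M} {P : SharpField IM M}
    (hom : ∀ m ξ v, om m (A.gen m ξ) v = (1 / 2 : ℝ) * coordDot e ξ (mcL Φ m v + mcR Φ m v))
    (hrel : ∀ m v, P m (om m v) = v - (1 / 4 : ℝ) • A.gen m (mcL Φ m v - mcR Φ m v))
    (m : M) (v : TangentSpace IM m) :
    om m v = 0 ↔ ∃ ξ : GroupLieAlgebra I K, ξ + Ad (Φ m) ξ = 0 ∧ A.gen m ξ = v := by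
  constructor
  · intro hv
    have h1 := hrel m v
    rw [hv, map_zero, eq_comm, sub_eq_zero] at h1
    set ξ : GroupLieAlgebra I K := (1 / 4 : ℝ) • (mcL Φ m v - mcR Φ m v) with hξ
    have hvξ : A.gen m ξ = v := by rw [hξ, map_smul, ← h1]
    refine ⟨ξ, ?_, hvξ⟩
    have h2 : Ad (Φ m) ξ = Ad (Φ m)⁻¹ ξ := by
      refine coordDot_ext e fun ζ => ?_
      have h3 := hom m ξ (A.gen m ζ)
      rw [hvξ, hv, LinearMap.zero_apply, hΦ.mcL_gen, hΦ.mcR_gen, map_add, map_sub, map_sub,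
        he.right, he.right, inv_inv] at h3
      linarith
    have h4 : (4 : ℝ) • ξ = (2 : ℝ) • ξ - Ad (Φ m) ξ - Ad (Φ m)⁻¹ ξ := by
      conv_lhs => rw [hξ]
      rw [← hvξ, hΦ.mcL_gen, hΦ.mcR_gen]
      module
    rw [← h2] at h4
    have h5 : (2 : ℝ) • (ξ + Ad (Φ m) ξ) = 0 := by
      have : (2 : ℝ) • (ξ + Ad (Φ m) ξ) =
        (4 : ℝ) • ξ - ((2 : ℝ) • ξ - Ad (Φ m) ξ - Ad (Φ m) ξ) := by module
      rw [this, ← h4, sub_self]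
    exact (smul_eq_zero.1 h5).resolve_left two_ne_zero
  · rintro ⟨ξ, hξ, rfl⟩
    ext w
    rw [hom, map_add, mcL_eq_Ad_mcR hΦ.1, he.right, inv_inv, ← LinearMap.add_apply, ← map_add,
      add_comm, hξ]
    simp

omit [LieGroup I ∞ G] [FiniteDimensional ℝ E] [T2Space G] [Fintype ι] in
/-- A bivector field which is related to some 2-form is non-degenerate. -/
lemma nonDegenerate_of_related {K : Type*} [TopologicalSpace K] [ChartedSpace H K] [Group K]
    {A : SmoothAction I K IM M} {Φ : M → K} {om : FlatField IM M} {P : SharpField IM M}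
    (hrel : ∀ m v, P m (om m v) = v - (1 / 4 : ℝ) • A.gen m (mcL Φ m v - mcR Φ m v)) :
    NonDegenerate A P := by
  intro m
  rw [eq_top_iff]
  intro v _
  rw [Submodule.mem_sup]
  refine ⟨P m (om m v), ⟨_, rfl⟩, A.gen m ((1 / 4 : ℝ) • (mcL Φ m v - mcR Φ m v)), ⟨_, rfl⟩, ?_⟩
  rw [hrel, map_smul, sub_add_cancel]

end Fusion

section Tensoriality

variable {E : Type*} [NormedAddCommGroup E] [NormedSpace ℝ E]
  {H : Type*} [TopologicalSpace H] {I : ModelWithCorners ℝ E H}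
  {G : Type*} [TopologicalSpace G] [ChartedSpace H G] [Group G] [LieGroup I ∞ G]
  [FiniteDimensional ℝ E] [T2Space G]
  {EM : Type*} [NormedAddCommGroup EM] [NormedSpace ℝ EM]
  {HM : Type*} [TopologicalSpace HM] {IM : ModelWithCorners ℝ EM HM}
  {M : Type*} [TopologicalSpace M] [ChartedSpace HM M]
  {ι : Type*} [Fintype ι] {e : Module.Basis ι ℝ (GroupLieAlgebra I G)}
  {A : SmoothAction (I.prod I) (G × G) IM M} {Φ₁ Φ₂ : M → G}

lemma fusedForm_invariant (he : AdInvariant e)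
    (hΦ : A.EquivariantMap (fun m => (Φ₁ m, Φ₂ m))) {om : FlatField IM M}
    (hom : A.InvariantForm om) : A.diag.InvariantForm (fusedForm e Φ₁ Φ₂ om) := by
  intro k m v w
  have h1 := fusedForm_apply (e := e) (Φ₁ := Φ₁) (Φ₂ := Φ₂) (om := om) (A.act (k, k) m)
    (A.push (k, k) m v) (A.push (k, k) m w)
  rw [hom, hΦ.mcL_fst_push, hΦ.mcR_snd_push, hΦ.mcL_fst_push, hΦ.mcR_snd_push, he, he] at h1
  exact h1.trans (fusedForm_apply m v w).symm

lemma push_gen₁ [FiniteDimensional ℝ EM] [T2Space M] [IsManifold IM ∞ M] (k : G × G) (m : M)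
    (ξ : GroupLieAlgebra I G) :
    A.push k m (gen₁ A m ξ) = gen₁ A (A.act k m) (Ad k.1 ξ) := by
  have h : Ad k (inlAlgebra ξ) = inlAlgebra (Ad k.1 ξ) :=
    prodAlgebra_ext (by rw [fstAlgebra_Ad]; rfl) (by rw [sndAlgebra_Ad]; simp)
  exact (A.push_gen k m (inlAlgebra ξ)).trans (by rw [h]; rfl)

lemma push_gen₂ [FiniteDimensional ℝ EM] [T2Space M] [IsManifold IM ∞ M] (k : G × G) (m : M)
    (ξ : GroupLieAlgebra I G) :
    A.push k m (gen₂ A m ξ) = gen₂ A (A.act k m) (Ad k.2 ξ) := by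
  have h : Ad k (inrAlgebra ξ) = inrAlgebra (Ad k.2 ξ) :=
    prodAlgebra_ext (by rw [fstAlgebra_Ad]; simp) (by rw [sndAlgebra_Ad]; rfl)
  exact (A.push_gen k m (inrAlgebra ξ)).trans (by rw [h]; rfl)

lemma fusedBivector_invariant [FiniteDimensional ℝ EM] [T2Space M] [IsManifold IM ∞ M]
    (he : AdInvariant e) {P : SharpField IM M} (hP : A.InvariantBivector P) :
    A.diag.InvariantBivector (fusedBivector e A P) := by
  intro k m α
  change Module.Dual ℝ (TangentSpace IM (A.act (k, k) m)) at α
  obtain ⟨p, hp⟩ := exists_coordDot_eq e (α ∘ₗ gen₁ A (A.act (k, k) m))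
  obtain ⟨q, hq⟩ := exists_coordDot_eq e (α ∘ₗ gen₂ A (A.act (k, k) m))
  have h1 : psiField e A (A.act (k, k) m) α = _ := psiField_apply hp hq
  have h2 : psiField e A m (α ∘ₗ A.push (k, k) m) = _ :=
    psiField_apply (p := Ad k⁻¹ p) (q := Ad k⁻¹ q) (fun ξ => by
      rw [LinearMap.comp_apply, push_gen₁, ← he.right]; exact hp _) (fun ξ => by
      rw [LinearMap.comp_apply, push_gen₂, ← he.right]; exact hq _)
  have h3 : A.push (k, k) m (psiField e A m (α ∘ₗ A.push (k, k) m)) =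
      psiField e A (A.act (k, k) m) α := by
    rw [h1, h2, map_smul, map_sub, push_gen₁, push_gen₂, Ad_Ad_inv, Ad_Ad_inv]
  have h4 : P (A.act (k, k) m) α - psiField e A (A.act (k, k) m) α =
      A.push (k, k) m (P m (α ∘ₗ A.push (k, k) m) - psiField e A m (α ∘ₗ A.push (k, k) m)) := by
    rw [hP, map_sub, h3]
  exact h4

omit [LieGroup I ∞ G] [FiniteDimensional ℝ E] [T2Space G] in
lemma fusedForm_eval {om : FlatField IM M} (X Y : ∀ m : M, TangentSpace IM m) :
    (fusedForm e Φ₁ Φ₂ om).eval X Y = fun m => om.eval X Y m - (1 / 2 : ℝ) *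
      ∑ a, (e.coord a (mcL Φ₁ m (X m)) * e.coord a (mcR Φ₂ m (Y m))
        - e.coord a (mcL Φ₁ m (Y m)) * e.coord a (mcR Φ₂ m (X m))) := by
  ext m
  refine (fusedForm_apply m (X m) (Y m)).trans ?_
  rw [coordDot_apply, coordDot_apply, ← Finset.sum_sub_distrib]
  rfl

lemma fusedForm_isTwoForm [IsManifold IM ∞ M] (h₁ : ContMDiff IM I ∞ Φ₁)
    (h₂ : ContMDiff IM I ∞ Φ₂) {om : FlatField IM M} (hom : IsTwoForm om) :
    IsTwoForm (fusedForm e Φ₁ Φ₂ om) where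
  skew m v w := by
    rw [fusedForm_apply, fusedForm_apply, hom.skew]
    ring
  smooth X Y hX hY := by
    rw [fusedForm_eval]
    exact (hom.smooth X Y hX hY).sub ((SmoothFunction.const _).mul (SmoothFunction.sum _ fun a =>
      ((smoothFunction_mcL h₁ _ hX).mul (smoothFunction_mcR h₂ _ hY)).sub
        ((smoothFunction_mcL h₁ _ hY).mul (smoothFunction_mcR h₂ _ hX))))

omit [LieGroup I ∞ G] [FiniteDimensional ℝ E] [T2Space G] in
lemma apply_psiField (m : M) (α β : Module.Dual ℝ (TangentSpace IM m)) :
    β (psiField e A m α) = ∑ a, (1 / 2 : ℝ) * (α (gen₁ A m (e a)) * β (gen₂ A m (e a))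
      - α (gen₂ A m (e a)) * β (gen₁ A m (e a))) := by
  unfold psiField
  rw [LinearMap.smul_apply, LinearMap.sum_apply, map_smul, map_sum, Finset.smul_sum]
  refine Finset.sum_congr rfl fun a _ => ?_
  simp only [vecWedge, LinearMap.sub_apply, LinearMap.smulRight_apply, Module.Dual.eval_apply,
    map_sub, map_smul, smul_eq_mul]

omit [LieGroup I ∞ G] [FiniteDimensional ℝ E] [T2Space G] in
lemma bracket_psiField (f g : M → ℝ) : bracket (psiField e A) f g = fun m =>
    ∑ a, (1 / 2 : ℝ) * (A.genDeriv (inlAlgebra (e a)) f m * A.genDeriv (inrAlgebra (e a)) g m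
      - A.genDeriv (inrAlgebra (e a)) f m * A.genDeriv (inlAlgebra (e a)) g m) :=
  funext fun _ => apply_psiField _ _ _

omit [FiniteDimensional ℝ E] [T2Space G] in
lemma smoothFunction_bracket_psiField [IsManifold IM ∞ M] {f g : M → ℝ}
    (hf : SmoothFunction IM f) (hg : SmoothFunction IM g) :
    SmoothFunction IM (bracket (psiField e A) f g) := by
  rw [bracket_psiField]
  exact SmoothFunction.sum _ fun a => (SmoothFunction.const _).mul
    (((A.smoothFunction_genDeriv hf _).mul (A.smoothFunction_genDeriv hg _)).sub
      ((A.smoothFunction_genDeriv hf _).mul (A.smoothFunction_genDeriv hg _)))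

omit [LieGroup I ∞ G] [FiniteDimensional ℝ E] [T2Space G] in
lemma bracket_fusedBivector {P : SharpField IM M} (f g : M → ℝ) :
    bracket (fusedBivector e A P) f g = fun m => bracket P f g m - bracket (psiField e A) f g m :=
  funext fun m => map_sub (differential g m) _ _

omit [FiniteDimensional ℝ E] [T2Space G] in
lemma fusedBivector_isBivectorField [IsManifold IM ∞ M] {P : SharpField IM M}
    (hP : IsBivectorField P) : IsBivectorField (fusedBivector e A P) where
  skew m α β := by
    change β (P m α - psiField e A m α) = -α (P m β - psiField e A m β)
    rw [map_sub, map_sub, hP.skew, apply_psiField, apply_psiField, neg_sub', sub_neg_eq_add,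
      sub_eq_add_neg, ← Finset.sum_neg_distrib]
    refine congrArg _ (Finset.sum_congr rfl fun a _ => ?_)
    ring
  smooth f g hf hg := by
    rw [bracket_fusedBivector]
    exact (hP.smooth f g hf hg).sub (smoothFunction_bracket_psiField hf hg)

end Tensoriality

section Trilinear

variable {E : Type*} [NormedAddCommGroup E] [NormedSpace ℝ E]
  {H : Type*} [TopologicalSpace H] {J : ModelWithCorners ℝ E H}
  {K : Type*} [TopologicalSpace K] [ChartedSpace H K] [Group K] [LieGroup J ∞ K]
  [FiniteDimensional ℝ E] [J.Boundaryless]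
  {ι : Type*} [Fintype ι] {e : Module.Basis ι ℝ (GroupLieAlgebra J K)}

/-- The trilinear form `x · [y, z]`. -/
def triple (e : Module.Basis ι ℝ (GroupLieAlgebra J K)) (x y z : GroupLieAlgebra J K) : ℝ :=
  coordDot e x (bracketMap y z)

lemma triple_swap_right (x y z : GroupLieAlgebra J K) : triple e x y z = -triple e x z y := by
  unfold triple
  rw [bracketMap_apply, bracket_swap, map_neg]
  rfl

lemma triple_swap_left [T2Space K] (he : AdInvariant e) (x y z : GroupLieAlgebra J K) :
    triple e x y z = -triple e y x z := by
  have h := he.bracket_left z x y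
  unfold triple
  rw [bracketMap_apply, bracketMap_apply, bracket_swap y z, bracket_swap x z, map_neg, map_neg]
  rw [coordDot_symm e y]
  linarith

lemma triple_Ad [T2Space K] (he : AdInvariant e) (g : K) (x y z : GroupLieAlgebra J K) :
    triple e (Ad g x) (Ad g y) (Ad g z) = triple e x y z := by
  unfold triple
  rw [bracketMap_apply, ← Ad_bracket, he]
  rfl

lemma triple_add_left (x x' y z : GroupLieAlgebra J K) :
    triple e (x + x') y z = triple e x y z + triple e x' y z := by
  simp [triple]

lemma triple_add_middle (x y y' z : GroupLieAlgebra J K) :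
    triple e x (y + y') z = triple e x y z + triple e x y' z := by
  simp [triple]

lemma triple_add_right (x y z z' : GroupLieAlgebra J K) :
    triple e x y (z + z') = triple e x y z + triple e x y z' := by
  simp [triple]

lemma sum_sum_coordDot_bracket (x y z : GroupLieAlgebra J K) :
    ∑ a, ∑ b, coordDot e x (bracketMap (e a) (e b)) * (e.coord a y * e.coord b z) =
      triple e x y z := by
  unfold triple
  rw [← sum_coord_smul e (bracketMap (J := J) (K := K)) y, LinearMap.sum_apply, map_sum]
  refine Finset.sum_congr rfl fun a _ => ?_
  rw [LinearMap.smul_apply, ← sum_coord_smul e (bracketMap (e a)) z, map_smul, map_sum,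
    smul_eq_mul, Finset.mul_sum]
  refine Finset.sum_congr rfl fun b _ => ?_
  rw [map_smul, smul_eq_mul]
  ring

lemma sum_structureConst (x y z : GroupLieAlgebra J K) :
    ∑ a, ∑ b, ∑ c, structureConst e a b c * (e.coord a x * e.coord b y * e.coord c z) =
      triple e x y z := by
  have h : ∀ a, ∑ b, ∑ c, structureConst e a b c * (e.coord a x * e.coord b y * e.coord c z) =
      e.coord a x * e.coord a (bracketMap y z) := by
    intro a
    have := sum_sum_coordDot_bracket (e := e) (e a) y z
    rw [triple, coordDot_basis] at this
    rw [← this, Finset.mul_sum]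
    refine Finset.sum_congr rfl fun b _ => ?_
    rw [Finset.mul_sum]
    refine Finset.sum_congr rfl fun c _ => ?_
    rw [coordDot_basis, structureConst, bracketMap_apply]
    ring
  simp_rw [h]
  rw [triple, coordDot_apply]

lemma sum_structureConst_mul_det [T2Space K] (he : AdInvariant e) (x y z : GroupLieAlgebra J K) :
    (1 / 12 : ℝ) * ∑ a, ∑ b, ∑ c, structureConst e a b c *
      Matrix.det !![e.coord a x, e.coord a y, e.coord a z; e.coord b x, e.coord b y, e.coord b z;
        e.coord c x, e.coord c y, e.coord c z] = (1 / 2 : ℝ) * triple e x y z := by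
  have h : ∀ a b c, structureConst e a b c *
      Matrix.det !![e.coord a x, e.coord a y, e.coord a z; e.coord b x, e.coord b y, e.coord b z;
        e.coord c x, e.coord c y, e.coord c z] =
      structureConst e a b c * (e.coord a x * e.coord b y * e.coord c z)
      - structureConst e a b c * (e.coord a x * e.coord b z * e.coord c y)
      - structureConst e a b c * (e.coord a y * e.coord b x * e.coord c z)
      + structureConst e a b c * (e.coord a y * e.coord b z * e.coord c x)
      + structureConst e a b c * (e.coord a z * e.coord b x * e.coord c y)
      - structureConst e a b c * (e.coord a z * e.coord b y * e.coord c x) := by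
    intro a b c
    rw [Matrix.det_fin_three]
    simp
    ring
  simp_rw [h, Finset.sum_sub_distrib, Finset.sum_add_distrib, Finset.sum_sub_distrib,
    sum_structureConst]
  rw [triple_swap_right x z y, triple_swap_left he y x z, triple_swap_right y z x,
    triple_swap_left he y x z, triple_swap_left he z x y, triple_swap_right x z y,
    triple_swap_right z y x, triple_swap_left he z x y, triple_swap_right x z y]
  ring

lemma eta_eq [T2Space K] (he : AdInvariant e) (g : K) (x y z : TangentSpace J g) :
    eta e g x y z = (1 / 2 : ℝ) * triple e (thetaR g x) (thetaR g y) (thetaR g z) :=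
  sum_structureConst_mul_det he _ _ _

lemma cartanField_eq [T2Space K] (he : AdInvariant e)
    {EM : Type*} [NormedAddCommGroup EM] [NormedSpace ℝ EM]
    {HM : Type*} [TopologicalSpace HM] {IM : ModelWithCorners ℝ EM HM}
    {M : Type*} [TopologicalSpace M] [ChartedSpace HM M] {A : SmoothAction J K IM M}
    {f g h : M → ℝ} {m : M} {p q r : GroupLieAlgebra J K}
    (hp : ∀ ξ, A.genDeriv ξ f m = coordDot e p ξ) (hq : ∀ ξ, A.genDeriv ξ g m = coordDot e q ξ)
    (hr : ∀ ξ, A.genDeriv ξ h m = coordDot e r ξ) :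
    cartanField e A f g h m = (1 / 2 : ℝ) * triple e p q r := by
  rw [← sum_structureConst_mul_det he]
  unfold cartanField wedgeThree
  refine congrArg _ (Finset.sum_congr rfl fun a _ => Finset.sum_congr rfl fun b _ =>
    Finset.sum_congr rfl fun c _ => congrArg _ ?_)
  unfold SmoothAction.genDeriv at hp hq hr
  rw [hp, hp, hp, hq, hq, hq, hr, hr, hr]
  simp only [coordDot_basis_right]
  rw [Matrix.det_fin_three, Matrix.det_fin_three]
  simp
  ring

end Trilinear

section ExteriorDerivative

variable {E : Type*} [NormedAddCommGroup E] [NormedSpace ℝ E]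
  {H : Type*} [TopologicalSpace H] {I : ModelWithCorners ℝ E H}
  {G : Type*} [TopologicalSpace G] [ChartedSpace H G] [Group G] [LieGroup I ∞ G]
  [FiniteDimensional ℝ E] [T2Space G]
  {EM : Type*} [NormedAddCommGroup EM] [NormedSpace ℝ EM]
  {HM : Type*} [TopologicalSpace HM] {IM : ModelWithCorners ℝ EM HM}
  {M : Type*} [TopologicalSpace M] [ChartedSpace HM M] [IsManifold IM ∞ M]
  {ι : Type*} [Fintype ι] {e : Module.Basis ι ℝ (GroupLieAlgebra I G)} {Φ₁ Φ₂ : M → G}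

lemma differential_fusedForm_eval (h₁ : ContMDiff IM I ∞ Φ₁) (h₂ : ContMDiff IM I ∞ Φ₂)
    {om : FlatField IM M} (hom : IsTwoForm om) {X Y : ∀ m : M, TangentSpace IM m}
    (hX : SmoothVectorField IM X) (hY : SmoothVectorField IM Y) (m : M) (v : TangentSpace IM m) :
    differential ((fusedForm e Φ₁ Φ₂ om).eval X Y) m v = differential (om.eval X Y) m v
      - (1 / 2 : ℝ) * ∑ a,
        (e.coord a (mcL Φ₁ m (X m)) * differential (fun n => e.coord a (mcR Φ₂ n (Y n))) m v
          + e.coord a (mcR Φ₂ m (Y m)) * differential (fun n => e.coord a (mcL Φ₁ n (X n))) m v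
          - (e.coord a (mcL Φ₁ m (Y m)) * differential (fun n => e.coord a (mcR Φ₂ n (X n))) m v
          + e.coord a (mcR Φ₂ m (X m)) *
            differential (fun n => e.coord a (mcL Φ₁ n (Y n))) m v)) := by
  have hL : ∀ (a : ι) {Z : ∀ m : M, TangentSpace IM m}, SmoothVectorField IM Z →
      SmoothFunction IM (fun n => e.coord a (mcL Φ₁ n (Z n))) :=
    fun a _ hZ => smoothFunction_mcL h₁ _ hZ
  have hR : ∀ (a : ι) {Z : ∀ m : M, TangentSpace IM m}, SmoothVectorField IM Z →
      SmoothFunction IM (fun n => e.coord a (mcR Φ₂ n (Z n))) :=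
    fun a _ hZ => smoothFunction_mcR h₂ _ hZ
  have hs := fun a => ((hL a hX).mul (hR a hY)).sub ((hL a hY).mul (hR a hX))
  have hsum := SmoothFunction.sum Finset.univ hs
  rw [fusedForm_eval, differential_sub ((hom.smooth X Y hX hY).mdiff m)
      (((SmoothFunction.const _).mul hsum).mdiff m),
    differential_const_mul _ (hsum.mdiff m), (differential_sum _ fun a => (hs a).mdiff m).2,
    LinearMap.sub_apply, LinearMap.smul_apply, LinearMap.sum_apply, smul_eq_mul]
  refine congrArg _ (congrArg _ (Finset.sum_congr rfl fun a _ => ?_))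
  rw [differential_sub (((hL a hX).mul (hR a hY)).mdiff m) (((hL a hY).mul (hR a hX)).mdiff m),
    differential_mul ((hL a hX).mdiff m) ((hR a hY).mdiff m),
    differential_mul ((hL a hY).mdiff m) ((hR a hX).mdiff m)]
  rfl

variable [FiniteDimensional ℝ EM] [I.Boundaryless] [IM.Boundaryless]

lemma extDerivTwo_fusedForm (h₁ : ContMDiff IM I ∞ Φ₁) (h₂ : ContMDiff IM I ∞ Φ₂)
    {om : FlatField IM M} (hom : IsTwoForm om) {X Y Z : ∀ m : M, TangentSpace IM m}
    (hX : SmoothVectorField IM X) (hY : SmoothVectorField IM Y) (hZ : SmoothVectorField IM Z)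
    (m : M) :
    extDerivTwo (fusedForm e Φ₁ Φ₂ om) X Y Z m = extDerivTwo om X Y Z m + (1 / 2 : ℝ) *
      (triple e (mcR Φ₂ m (Z m)) (mcL Φ₁ m (X m)) (mcL Φ₁ m (Y m))
        - triple e (mcR Φ₂ m (Y m)) (mcL Φ₁ m (X m)) (mcL Φ₁ m (Z m))
        + triple e (mcR Φ₂ m (X m)) (mcL Φ₁ m (Y m)) (mcL Φ₁ m (Z m))
        + triple e (mcL Φ₁ m (Z m)) (mcR Φ₂ m (X m)) (mcR Φ₂ m (Y m))
        - triple e (mcL Φ₁ m (Y m)) (mcR Φ₂ m (X m)) (mcR Φ₂ m (Z m))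
        + triple e (mcL Φ₁ m (X m)) (mcR Φ₂ m (Y m)) (mcR Φ₂ m (Z m))) := by
  unfold extDerivTwo
  rw [differential_fusedForm_eval h₁ h₂ hom hY hZ, differential_fusedForm_eval h₁ h₂ hom hX hZ,
    differential_fusedForm_eval h₁ h₂ hom hX hY, fusedForm_apply, fusedForm_apply,
    fusedForm_apply]
  simp only [triple, bracketMap_apply, coordDot_apply]
  let l : (∀ m : M, TangentSpace IM m) → ι → ℝ := fun Z a => e.coord a (mcL Φ₁ m (Z m))
  let r : (∀ m : M, TangentSpace IM m) → ι → ℝ := fun Z a => e.coord a (mcR Φ₂ m (Z m))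
  let dl : (∀ m : M, TangentSpace IM m) → (∀ m : M, TangentSpace IM m) → ι → ℝ := fun V Z a =>
    differential (fun n => e.coord a (mcL Φ₁ n (Z n))) m (V m)
  let dr : (∀ m : M, TangentSpace IM m) → (∀ m : M, TangentSpace IM m) → ι → ℝ := fun V Z a =>
    differential (fun n => e.coord a (mcR Φ₂ n (Z n))) m (V m)
  let cl : (∀ m : M, TangentSpace IM m) → (∀ m : M, TangentSpace IM m) → ι → ℝ := fun V Z a =>
    e.coord a ⁅(mcL Φ₁ m (V m) : GroupLieAlgebra I G), mcL Φ₁ m (Z m)⁆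
  let cr : (∀ m : M, TangentSpace IM m) → (∀ m : M, TangentSpace IM m) → ι → ℝ := fun V Z a =>
    e.coord a ⁅(mcR Φ₂ m (V m) : GroupLieAlgebra I G), mcR Φ₂ m (Z m)⁆
  let b := VectorField.mlieBracket IM (M := M)
  have hl : ∀ {V Z : ∀ m : M, TangentSpace IM m}, SmoothVectorField IM V →
      SmoothVectorField IM Z → ∀ U, ∑ a, (r U a * dl V Z a - r U a * dl Z V a
        - l (b V Z) a * r U a + r U a * cl V Z a) = 0 := fun hV hZ U =>
    Finset.sum_eq_zero fun a _ => by
      linear_combination r U a * maurerCartan_left h₁ (e.coord a) hV hZ m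
  have hr : ∀ {V Z : ∀ m : M, TangentSpace IM m}, SmoothVectorField IM V →
      SmoothVectorField IM Z → ∀ U, ∑ a, (l U a * dr V Z a - l U a * dr Z V a
        - l U a * r (b V Z) a - l U a * cr V Z a) = 0 := fun hV hZ U =>
    Finset.sum_eq_zero fun a _ => by
      linear_combination l U a * maurerCartan_right h₂ (e.coord a) hV hZ m
  have k1 := hl hX hY Z
  have k2 := hl hX hZ Y
  have k3 := hl hY hZ X
  have k4 := hr hX hY Z
  have k5 := hr hX hZ Y
  have k6 := hr hY hZ X
  simp only [Finset.sum_add_distrib, Finset.sum_sub_distrib, l, r, dl, dr, cl, cr, b]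
    at k1 k2 k3 k4 k5 k6 ⊢
  linear_combination (1 / 2 : ℝ) * (-k1 + k2 - k3 + k4 - k5 + k6)

lemma triple_doubleBasis (x y z : GroupLieAlgebra (I.prod I) (G × G)) :
    triple (doubleBasis e) x y z = triple e (fstAlgebra x) (fstAlgebra y) (fstAlgebra z)
      + triple e (sndAlgebra x) (sndAlgebra y) (sndAlgebra z) := by
  unfold triple
  rw [coordDot_doubleBasis, bracketMap_apply, fstAlgebra_bracket, sndAlgebra_bracket]
  rfl

/-- The exterior derivative of the fused 2-form. -/
lemma extDerivTwo_fusedForm_eq_eta (he : AdInvariant e) (h₁ : ContMDiff IM I ∞ Φ₁)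
    (h₂ : ContMDiff IM I ∞ Φ₂)
    {om : FlatField IM M} (hom : IsTwoForm om) {X Y Z : ∀ m : M, TangentSpace IM m}
    (hX : SmoothVectorField IM X) (hY : SmoothVectorField IM Y) (hZ : SmoothVectorField IM Z)
    (m : M) (h : extDerivTwo om X Y Z m = (1 / 2 : ℝ) * triple (doubleBasis e)
      (mcR (fun m => (Φ₁ m, Φ₂ m)) m (X m)) (mcR (fun m => (Φ₁ m, Φ₂ m)) m (Y m))
      (mcR (fun m => (Φ₁ m, Φ₂ m)) m (Z m))) :
    extDerivTwo (fusedForm e Φ₁ Φ₂ om) X Y Z m = (1 / 2 : ℝ) * triple e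
      (mcR (fun m => Φ₁ m * Φ₂ m) m (X m)) (mcR (fun m => Φ₁ m * Φ₂ m) m (Y m))
      (mcR (fun m => Φ₁ m * Φ₂ m) m (Z m)) := by
  have hmul : ∀ v : TangentSpace IM m, (mcR (fun m => Φ₁ m * Φ₂ m) m v : GroupLieAlgebra I G) =
      Ad (Φ₁ m) (mcL Φ₁ m v + mcR Φ₂ m v) := by
    intro v
    rw [mcR_mul h₁ h₂, map_add, mcR_eq_Ad_mcL h₁]
  rw [extDerivTwo_fusedForm h₁ h₂ hom hX hY hZ, h, triple_doubleBasis]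
  simp only [fstAlgebra_mcR h₁ h₂, sndAlgebra_mcR h₁ h₂]
  rw [mcR_eq_Ad_mcL h₁, mcR_eq_Ad_mcL h₁, mcR_eq_Ad_mcL h₁, hmul, hmul, hmul,
    triple_Ad he, triple_Ad he]
  simp only [triple_add_left, triple_add_middle, triple_add_right]
  generalize (mcL Φ₁ m (X m) : GroupLieAlgebra I G) = x
  generalize (mcL Φ₁ m (Y m) : GroupLieAlgebra I G) = y
  generalize (mcL Φ₁ m (Z m) : GroupLieAlgebra I G) = z
  generalize (mcR Φ₂ m (X m) : GroupLieAlgebra I G) = x'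
  generalize (mcR Φ₂ m (Y m) : GroupLieAlgebra I G) = y'
  generalize (mcR Φ₂ m (Z m) : GroupLieAlgebra I G) = z'
  rw [triple_swap_left he z' x y, triple_swap_right x z' y, triple_swap_left he y' x z,
    triple_swap_left he z x' y', triple_swap_right x' z y', triple_swap_left he y x' z']
  ring

end ExteriorDerivative

lemma sum_sum_eq_zero_of_antisymm {ι : Type*} [Fintype ι] {F : ι → ι → ℝ}
    (h : ∀ a b, F a b + F b a = 0) : ∑ a, ∑ b, F a b = 0 := by
  have h1 : ∑ a, ∑ b, F a b = ∑ a, ∑ b, F b a := Finset.sum_comm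
  have h2 : ∑ a, ∑ b, F a b + ∑ a, ∑ b, F b a = 0 := by
    simp_rw [← Finset.sum_add_distrib, h, Finset.sum_const_zero]
  linarith

section Schouten

variable {E : Type*} [NormedAddCommGroup E] [NormedSpace ℝ E]
  {H : Type*} [TopologicalSpace H] {I : ModelWithCorners ℝ E H}
  {G : Type*} [TopologicalSpace G] [ChartedSpace H G] [Group G] [LieGroup I ∞ G]
  {EM : Type*} [NormedAddCommGroup EM] [NormedSpace ℝ EM]
  {HM : Type*} [TopologicalSpace HM] {IM : ModelWithCorners ℝ EM HM}
  {M : Type*} [TopologicalSpace M] [ChartedSpace HM M] [IsManifold IM ∞ M]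
  {ι : Type*} [Fintype ι] {e : Module.Basis ι ℝ (GroupLieAlgebra I G)}
  {A : SmoothAction (I.prod I) (G × G) IM M} {P : SharpField IM M}

omit [IsManifold IM ∞ M] in
lemma bracket_sub_left {f g h : M → ℝ} (hf : SmoothFunction IM f) (hg : SmoothFunction IM g)
    (m : M) : bracket P (fun n => f n - g n) h m = bracket P f h m - bracket P g h m := by
  unfold bracket
  rw [differential_sub (hf.mdiff m) (hg.mdiff m), map_sub, map_sub]

lemma genDeriv_bracket_psiField {f g : M → ℝ} (hf : SmoothFunction IM f)
    (hg : SmoothFunction IM g) (x : GroupLieAlgebra (I.prod I) (G × G)) (m : M) :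
    A.genDeriv x (bracket (psiField e A) f g) m = ∑ a, (1 / 2 : ℝ) *
      (A.genDeriv x (A.genDeriv (inlAlgebra (e a)) f) m * A.genDeriv (inrAlgebra (e a)) g m
        + A.genDeriv (inlAlgebra (e a)) f m * A.genDeriv x (A.genDeriv (inrAlgebra (e a)) g) m
        - (A.genDeriv x (A.genDeriv (inrAlgebra (e a)) f) m * A.genDeriv (inlAlgebra (e a)) g m
        + A.genDeriv (inrAlgebra (e a)) f m
          * A.genDeriv x (A.genDeriv (inlAlgebra (e a)) g) m)) := by
  have h1 := fun a => (A.smoothFunction_genDeriv hf (inlAlgebra (e a)))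
  have h2 := fun a => (A.smoothFunction_genDeriv hf (inrAlgebra (e a)))
  have h3 := fun a => (A.smoothFunction_genDeriv hg (inlAlgebra (e a)))
  have h4 := fun a => (A.smoothFunction_genDeriv hg (inrAlgebra (e a)))
  have hs := fun a => ((h1 a).mul (h4 a)).sub ((h2 a).mul (h3 a))
  rw [bracket_psiField]
  unfold SmoothAction.genDeriv at *
  rw [(differential_sum _ fun a => ((SmoothFunction.const _).mul (hs a)).mdiff m).2,
    LinearMap.sum_apply]
  refine Finset.sum_congr rfl fun a _ => ?_
  rw [differential_const_mul _ ((hs a).mdiff m),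
    differential_sub (((h1 a).mul (h4 a)).mdiff m) (((h2 a).mul (h3 a)).mdiff m),
    differential_mul ((h1 a).mdiff m) ((h4 a).mdiff m),
    differential_mul ((h2 a).mdiff m) ((h3 a).mdiff m)]
  simp only [LinearMap.smul_apply, LinearMap.sub_apply, LinearMap.add_apply, smul_eq_mul]
  ring

lemma bracket_bracket_psiField {f g : M → ℝ} (hf : SmoothFunction IM f)
    (hg : SmoothFunction IM g) (h : M → ℝ) (m : M) :
    bracket P (bracket (psiField e A) f g) h m = ∑ a, (1 / 2 : ℝ) *
      (A.genDeriv (inlAlgebra (e a)) f m * bracket P (A.genDeriv (inrAlgebra (e a)) g) h m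
        + A.genDeriv (inrAlgebra (e a)) g m * bracket P (A.genDeriv (inlAlgebra (e a)) f) h m
        - (A.genDeriv (inrAlgebra (e a)) f m * bracket P (A.genDeriv (inlAlgebra (e a)) g) h m
        + A.genDeriv (inlAlgebra (e a)) g m
          * bracket P (A.genDeriv (inrAlgebra (e a)) f) h m)) := by
  have h1 := fun a => (A.smoothFunction_genDeriv hf (inlAlgebra (e a)))
  have h2 := fun a => (A.smoothFunction_genDeriv hf (inrAlgebra (e a)))
  have h3 := fun a => (A.smoothFunction_genDeriv hg (inlAlgebra (e a)))
  have h4 := fun a => (A.smoothFunction_genDeriv hg (inrAlgebra (e a)))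
  have hs := fun a => ((h1 a).mul (h4 a)).sub ((h2 a).mul (h3 a))
  rw [bracket_psiField]
  unfold bracket
  rw [(differential_sum _ fun a => ((SmoothFunction.const _).mul (hs a)).mdiff m).2, map_sum,
    map_sum]
  refine Finset.sum_congr rfl fun a _ => ?_
  rw [differential_const_mul _ ((hs a).mdiff m),
    differential_sub (((h1 a).mul (h4 a)).mdiff m) (((h2 a).mul (h3 a)).mdiff m),
    differential_mul ((h1 a).mdiff m) ((h4 a).mdiff m),
    differential_mul ((h2 a).mdiff m) ((h3 a).mdiff m)]
  simp only [map_smul, map_sub, map_add, smul_eq_mul]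

/-- An invariant bivector field has vanishing Schouten bracket with `ψ_M`. -/
lemma schouten_psiField_eq_zero [FiniteDimensional ℝ E] [I.Boundaryless] [T2Space G]
    [IM.Boundaryless] [FiniteDimensional ℝ EM] [T2Space M] (hP : A.InvariantBivector P)
    (hPs : IsBivectorField P)
    {f g h : M → ℝ} (hf : SmoothFunction IM f) (hg : SmoothFunction IM g)
    (hh : SmoothFunction IM h) (m : M) : schouten P (psiField e A) f g h m = 0 := by
  have hskew : ∀ u v : M → ℝ, bracket P u v m = -bracket P v u m := fun u v =>
    hPs.skew m _ _
  have key : ∀ u v w : M → ℝ, bracket (psiField e A) (bracket P u v) w m = ∑ a, (1 / 2 : ℝ) *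
      (A.genDeriv (inlAlgebra (e a)) (bracket P u v) m * A.genDeriv (inrAlgebra (e a)) w m
      - A.genDeriv (inrAlgebra (e a)) (bracket P u v) m * A.genDeriv (inlAlgebra (e a)) w m) :=
    fun u v w => congrFun (bracket_psiField _ _) m
  unfold schouten
  rw [key, key, key, bracket_bracket_psiField hf hg, bracket_bracket_psiField hg hh,
    bracket_bracket_psiField hh hf, neg_eq_zero]
  simp only [← Finset.sum_add_distrib]
  refine Finset.sum_eq_zero fun a _ => ?_
  simp only [hP.genDeriv_bracket hPs hf hg, hP.genDeriv_bracket hPs hg hh,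
    hP.genDeriv_bracket hPs hh hf]
  rw [hskew f, hskew f, hskew g, hskew g, hskew h, hskew h]
  ring

variable [FiniteDimensional ℝ E] [I.Boundaryless] [T2Space G]

lemma bracket_inl_inl (x y : GroupLieAlgebra I G) :
    ⁅(inlAlgebra x : GroupLieAlgebra (I.prod I) (G × G)), inlAlgebra y⁆ = inlAlgebra ⁅x, y⁆ := by
  refine prodAlgebra_ext ?_ ?_
  · rw [fstAlgebra_bracket]
    rfl
  · rw [sndAlgebra_bracket]
    exact map_zero (bracketMap 0)

lemma bracket_inr_inr (x y : GroupLieAlgebra I G) :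
    ⁅(inrAlgebra x : GroupLieAlgebra (I.prod I) (G × G)), inrAlgebra y⁆ = inrAlgebra ⁅x, y⁆ := by
  refine prodAlgebra_ext ?_ ?_
  · rw [fstAlgebra_bracket]
    exact map_zero (bracketMap 0)
  · rw [sndAlgebra_bracket]
    rfl

lemma bracket_inl_inr (x y : GroupLieAlgebra I G) :
    ⁅(inlAlgebra x : GroupLieAlgebra (I.prod I) (G × G)), inrAlgebra y⁆ = 0 := by
  refine prodAlgebra_ext ?_ ?_
  · rw [fstAlgebra_bracket]
    exact map_zero (bracketMap x)
  · rw [sndAlgebra_bracket]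
    exact LinearMap.map_zero₂ bracketMap y

/-- The generating vector fields of the two factors commute. -/
lemma genDeriv_inl_inr {f : M → ℝ} (hf : SmoothFunction IM f) (x y : GroupLieAlgebra I G) (m : M) :
    A.genDeriv (inrAlgebra y) (A.genDeriv (inlAlgebra x) f) m =
      A.genDeriv (inlAlgebra x) (A.genDeriv (inrAlgebra y) f) m := by
  have h := A.genDeriv_comm hf (inlAlgebra x) (inrAlgebra y) m
  rw [bracket_inl_inr] at h
  have h0 : A.genDeriv 0 f m = 0 := by
    unfold SmoothAction.genDeriv
    rw [map_zero, map_zero]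
  linarith

lemma schouten_psiField_self {f g h : M → ℝ} (hf : SmoothFunction IM f)
    (hg : SmoothFunction IM g) (hh : SmoothFunction IM h) {m : M}
    {p p' q q' r r' : GroupLieAlgebra I G}
    (hp : ∀ ξ, A.genDeriv (inlAlgebra ξ) f m = coordDot e p ξ)
    (hp' : ∀ ξ, A.genDeriv (inrAlgebra ξ) f m = coordDot e p' ξ)
    (hq : ∀ ξ, A.genDeriv (inlAlgebra ξ) g m = coordDot e q ξ)
    (hq' : ∀ ξ, A.genDeriv (inrAlgebra ξ) g m = coordDot e q' ξ)
    (hr : ∀ ξ, A.genDeriv (inlAlgebra ξ) h m = coordDot e r ξ)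
    (hr' : ∀ ξ, A.genDeriv (inrAlgebra ξ) h m = coordDot e r' ξ) :
    schouten (psiField e A) (psiField e A) f g h m = (1 / 2 : ℝ) *
      (triple e p q' r' + triple e p' q r + triple e q r' p' + triple e q' r p
        + triple e r p' q' + triple e r' p q) := by
  let x : (M → ℝ) → ι → ℝ := fun u a => A.genDeriv (inlAlgebra (e a)) u m
  let y : (M → ℝ) → ι → ℝ := fun u a => A.genDeriv (inrAlgebra (e a)) u m
  let xx : (M → ℝ) → ι → ι → ℝ := fun u b a =>
    A.genDeriv (inlAlgebra (e b)) (A.genDeriv (inlAlgebra (e a)) u) m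
  let xy : (M → ℝ) → ι → ι → ℝ := fun u b a =>
    A.genDeriv (inlAlgebra (e b)) (A.genDeriv (inrAlgebra (e a)) u) m
  let yy : (M → ℝ) → ι → ι → ℝ := fun u b a =>
    A.genDeriv (inrAlgebra (e b)) (A.genDeriv (inrAlgebra (e a)) u) m
  have key : ∀ {u v : M → ℝ} (w : M → ℝ), SmoothFunction IM u → SmoothFunction IM v →
      bracket (psiField e A) (bracket (psiField e A) u v) w m = ∑ b, ∑ a, (1 / 4 : ℝ) *
        ((xx u b a * y v a + x u a * xy v b a - (xy u b a * x v a + y u a * xx v b a)) * y w b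
        - (xy u a b * y v a + x u a * yy v b a - (yy u b a * x v a + y u a * xy v a b))
          * x w b) := by
    intro u v w hu hv
    refine (congrFun (bracket_psiField _ _) m).trans (Finset.sum_congr rfl fun b _ => ?_)
    rw [genDeriv_bracket_psiField hu hv, genDeriv_bracket_psiField hu hv, Finset.sum_mul,
      Finset.sum_mul, ← Finset.sum_sub_distrib, Finset.mul_sum]
    refine Finset.sum_congr rfl fun a _ => ?_
    rw [genDeriv_inl_inr hu, genDeriv_inl_inr hv]
    ring
  have cubic : ∀ u s t : GroupLieAlgebra I G,
      ∑ b, ∑ a, coordDot e u (bracketMap (e b) (e a)) * (e.coord b t * e.coord a s) =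
        -triple e u s t := fun u s t => by
    rw [sum_sum_coordDot_bracket, triple_swap_right]
  have hxx : ∀ {u : M → ℝ} {s : GroupLieAlgebra I G}, SmoothFunction IM u →
      (∀ ξ, A.genDeriv (inlAlgebra ξ) u m = coordDot e s ξ) → ∀ a b,
      xx u b a - xx u a b = coordDot e s (bracketMap (e b) (e a)) := fun hu hs a b => by
    have h := A.genDeriv_comm hu (inlAlgebra (e b)) (inlAlgebra (e a)) m
    rwa [bracket_inl_inl, hs] at h
  have hyy : ∀ {u : M → ℝ} {s : GroupLieAlgebra I G}, SmoothFunction IM u →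
      (∀ ξ, A.genDeriv (inrAlgebra ξ) u m = coordDot e s ξ) → ∀ a b,
      yy u b a - yy u a b = coordDot e s (bracketMap (e b) (e a)) := fun hu hs a b => by
    have h := A.genDeriv_comm hu (inrAlgebra (e b)) (inrAlgebra (e a)) m
    rwa [bracket_inr_inr, hs] at h
  have hx : ∀ {u : M → ℝ} {s : GroupLieAlgebra I G},
      (∀ ξ, A.genDeriv (inlAlgebra ξ) u m = coordDot e s ξ) → ∀ a, x u a = e.coord a s :=
    fun hs a => (hs _).trans (coordDot_basis_right e a _)
  have hy : ∀ {u : M → ℝ} {s : GroupLieAlgebra I G},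
      (∀ ξ, A.genDeriv (inrAlgebra ξ) u m = coordDot e s ξ) → ∀ a, y u a = e.coord a s :=
    fun hs a => (hs _).trans (coordDot_basis_right e a _)
  unfold schouten
  rw [key h hf hg, key f hg hh, key g hh hf]
  have c1 := cubic p q' r'
  have c2 := cubic p' q r
  have c3 := cubic q r' p'
  have c4 := cubic q' r p
  have c5 := cubic r p' q'
  have c6 := cubic r' p q
  simp only [← hxx hf hp, ← hxx hg hq, ← hxx hh hr, ← hyy hf hp', ← hyy hg hq', ← hyy hh hr',
    ← hx hp, ← hx hq, ← hx hr, ← hy hp', ← hy hq', ← hy hr'] at c1 c2 c3 c4 c5 c6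
  have hzero := sum_sum_eq_zero_of_antisymm (F := fun b a =>
    (1 / 4 : ℝ) * ((xx f b a * y g a + x f a * xy g b a
        - (xy f b a * x g a + y f a * xx g b a)) * y h b
        - (xy f a b * y g a + x f a * yy g b a - (yy f b a * x g a + y f a * xy g a b)) * x h b)
    + (1 / 4 : ℝ) * ((xx g b a * y h a + x g a * xy h b a
        - (xy g b a * x h a + y g a * xx h b a)) * y f b
        - (xy g a b * y h a + x g a * yy h b a - (yy g b a * x h a + y g a * xy h a b)) * x f b)
    + (1 / 4 : ℝ) * ((xx h b a * y f a + x h a * xy f b a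
        - (xy h b a * x f a + y h a * xx f b a)) * y g b
        - (xy h a b * y f a + x h a * yy f b a - (yy h b a * x f a + y h a * xy f a b)) * x g b)
    - (1 / 4 : ℝ) * ((xx f b a - xx f a b) * (y h b * y g a)
      + (yy f b a - yy f a b) * (x h b * x g a) + (xx g b a - xx g a b) * (y f b * y h a)
      + (yy g b a - yy g a b) * (x f b * x h a) + (xx h b a - xx h a b) * (y g b * y f a)
      + (yy h b a - yy h a b) * (x g b * x f a))) (fun a b => by ring)
  simp only [Finset.sum_sub_distrib, Finset.sum_add_distrib, ← Finset.mul_sum]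
    at hzero c1 c2 c3 c4 c5 c6 ⊢
  linear_combination -2 * hzero - (1 / 2 : ℝ) * (c1 + c2 + c3 + c4 + c5 + c6)

lemma schouten_fusedBivector [IM.Boundaryless] [FiniteDimensional ℝ EM] [T2Space M]
    (hP : A.InvariantBivector P) (hPs : IsBivectorField P)
    {f g h : M → ℝ} (hf : SmoothFunction IM f) (hg : SmoothFunction IM g)
    (hh : SmoothFunction IM h) (m : M) :
    schouten (fusedBivector e A P) (fusedBivector e A P) f g h m =
      schouten P P f g h m + schouten (psiField e A) (psiField e A) f g h m := by
  have h1 := schouten_psiField_eq_zero (e := e) hP hPs hf hg hh m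
  have key : ∀ {u v : M → ℝ} (w : M → ℝ), SmoothFunction IM u → SmoothFunction IM v →
      bracket (fusedBivector e A P) (bracket (fusedBivector e A P) u v) w m =
        bracket P (bracket P u v) w m - bracket P (bracket (psiField e A) u v) w m
        - (bracket (psiField e A) (bracket P u v) w m
          - bracket (psiField e A) (bracket (psiField e A) u v) w m) := by
    intro u v w hu hv
    have hs := hPs.smooth u v hu hv
    have hs' := smoothFunction_bracket_psiField (e := e) (A := A) hu hv
    rw [bracket_fusedBivector, bracket_fusedBivector]
    exact congrArg₂ _ (bracket_sub_left hs hs' m) (bracket_sub_left hs hs' m)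
  unfold schouten at h1 ⊢
  rw [key h hf hg, key f hg hh, key g hh hf]
  linear_combination -2 * h1

end Schouten

section Correspondence

variable {E : Type*} [NormedAddCommGroup E] [NormedSpace ℝ E] [FiniteDimensional ℝ E]
  {H : Type*} [TopologicalSpace H] {I : ModelWithCorners ℝ E H} [I.Boundaryless]
  {G : Type*} [TopologicalSpace G] [ChartedSpace H G] [Group G] [LieGroup I ∞ G] [T2Space G]
  {EM : Type*} [NormedAddCommGroup EM] [NormedSpace ℝ EM] [FiniteDimensional ℝ EM]
  {HM : Type*} [TopologicalSpace HM] {IM : ModelWithCorners ℝ EM HM} [IM.Boundaryless]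
  {M : Type*} [TopologicalSpace M] [ChartedSpace HM M] [IsManifold IM ∞ M] [T2Space M]
  {ι : Type*} [Fintype ι] {e : Module.Basis ι ℝ (GroupLieAlgebra I G)}
  {A : SmoothAction (I.prod I) (G × G) IM M} {Φ₁ Φ₂ : M → G}
  {om : FlatField IM M} {P : SharpField IM M}

/-- The fusion of a quasi-Poisson manifold is quasi-Poisson. -/
lemma IsQuasiPoisson.fusion (he : AdInvariant e) (h : IsQuasiPoisson (doubleBasis e) A P) :
    IsQuasiPoisson e A.diag (fusedBivector e A P) where
  bivector := fusedBivector_isBivectorField h.bivector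
  invariant := fusedBivector_invariant he h.invariant
  schouten_eq f g k hf hg hk m := by
    obtain ⟨p, hp⟩ := exists_coordDot_eq (doubleBasis e) (differential f m ∘ₗ A.gen m)
    obtain ⟨q, hq⟩ := exists_coordDot_eq (doubleBasis e) (differential g m ∘ₗ A.gen m)
    obtain ⟨r, hr⟩ := exists_coordDot_eq (doubleBasis e) (differential k m ∘ₗ A.gen m)
    have hinl : ∀ {u : M → ℝ} {s : GroupLieAlgebra (I.prod I) (G × G)},
        (∀ x, (differential u m ∘ₗ A.gen m) x = coordDot (doubleBasis e) s x) →
        ∀ ξ, A.genDeriv (inlAlgebra ξ) u m = coordDot e (fstAlgebra s) ξ := fun hs ξ => by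
      refine (hs (inlAlgebra ξ)).trans ?_
      rw [coordDot_doubleBasis, fstAlgebra_inl, sndAlgebra_inl, map_zero, add_zero]
    have hinr : ∀ {u : M → ℝ} {s : GroupLieAlgebra (I.prod I) (G × G)},
        (∀ x, (differential u m ∘ₗ A.gen m) x = coordDot (doubleBasis e) s x) →
        ∀ ξ, A.genDeriv (inrAlgebra ξ) u m = coordDot e (sndAlgebra s) ξ := fun hs ξ => by
      refine (hs (inrAlgebra ξ)).trans ?_
      rw [coordDot_doubleBasis, fstAlgebra_inr, sndAlgebra_inr, map_zero, zero_add]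
    have hdiag : ∀ {u : M → ℝ} {s : GroupLieAlgebra (I.prod I) (G × G)},
        (∀ x, (differential u m ∘ₗ A.gen m) x = coordDot (doubleBasis e) s x) →
        ∀ ξ, A.diag.genDeriv ξ u m = coordDot e (fstAlgebra s + sndAlgebra s) ξ := fun hs ξ => by
      rw [map_add, LinearMap.add_apply, ← hinl hs, ← hinr hs]
      exact (congrArg _ (SmoothAction.diag_gen m ξ)).trans (map_add _ _ _)
    rw [schouten_fusedBivector h.invariant h.bivector hf hg hk,
      h.schouten_eq f g k hf hg hk, cartanField_eq he.doubleBasis hp hq hr,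
      cartanField_eq he (hdiag hp) (hdiag hq) (hdiag hr), triple_doubleBasis,
      schouten_psiField_self hf hg hk (hinl hp) (hinr hp) (hinl hq) (hinr hq) (hinl hr)
        (hinr hr)]
    simp only [triple_add_left, triple_add_middle, triple_add_right]
    generalize fstAlgebra p = x
    generalize fstAlgebra q = y
    generalize fstAlgebra r = z
    generalize sndAlgebra p = x'
    generalize sndAlgebra q = y'
    generalize sndAlgebra r = z'
    rw [triple_swap_right y z' x', triple_swap_left he y x' z', triple_swap_right y' z x,
      triple_swap_left he y' x z, triple_swap_left he z x' y', triple_swap_right x' z y',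
      triple_swap_left he z' x y, triple_swap_right x z' y]
    ring

/-- Fusion preserves the correspondence between 2-forms and bivector fields. -/
lemma Corresponds.fusion (he : AdInvariant e)
    (h : Corresponds (doubleBasis e) A (fun m => (Φ₁ m, Φ₂ m)) P om) :
    Corresponds e A.diag (fun m => Φ₁ m * Φ₂ m) (fusedBivector e A P)
      (fusedForm e Φ₁ Φ₂ om) := by
  have hΦ := h.quasiHamiltonian.equivariant
  have hom := momentForm_iff.1 h.quasiHamiltonian.moment
  have hP := (momentBivector_iff he.doubleBasis hΦ.1).1 h.hamiltonian.moment
  have hrel := fused_related he hΦ hom h.quasiHamiltonian.twoForm.skew hP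
    (related_iff.1 h.related)
  have hom' := fused_momentForm he hΦ hom
  refine ⟨⟨fusedForm_isTwoForm hΦ.fst hΦ.snd h.quasiHamiltonian.twoForm,
    fusedForm_invariant he hΦ h.quasiHamiltonian.invariant, hΦ.diag, fun X Y Z hX hY hZ m => ?_,
    momentForm_iff.2 hom', ker_eq_of_related he hΦ.diag hom' hrel⟩,
    ⟨h.hamiltonian.quasiPoisson.fusion he, hΦ.diag,
      (momentBivector_iff he hΦ.diag.1).2 (fused_momentBivector he hΦ hP)⟩,
    nonDegenerate_of_related hrel, related_iff.2 hrel⟩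
  have h1 := h.quasiHamiltonian.extDeriv_eq X Y Z hX hY hZ m
  rw [eta_eq he.doubleBasis] at h1
  rw [eta_eq he]
  exact extDerivTwo_fusedForm_eq_eta he hΦ.fst hΦ.snd h.quasiHamiltonian.twoForm hX hY hZ m h1

end Correspondence

end QuasiPoisson

end

theorem proposition10p5
    {E : Type*} [NormedAddCommGroup E] [NormedSpace ℝ E] [FiniteDimensional ℝ E]
    {H : Type*} [TopologicalSpace H] (I : ModelWithCorners ℝ E H) [I.Boundaryless]
    {G : Type*} [TopologicalSpace G] [ChartedSpace H G] [Group G] [LieGroup I ∞ G]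
    [T2Space G] [CompactSpace G]
    {EM : Type*} [NormedAddCommGroup EM] [NormedSpace ℝ EM] [FiniteDimensional ℝ EM]
    {HM : Type*} [TopologicalSpace HM] (IM : ModelWithCorners ℝ EM HM) [IM.Boundaryless]
    {M : Type*} [TopologicalSpace M] [ChartedSpace HM M] [IsManifold IM ∞ M]
    [T2Space M] [SecondCountableTopology M]
    (B : QuasiPoisson.InvariantInnerProduct I G)
    {ι : Type*} [Fintype ι] (e : Module.Basis ι ℝ (GroupLieAlgebra I G)) (he : B.IsOrthonormal e)
    (A : QuasiPoisson.SmoothAction (I.prod I) (G × G) IM M)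
    (Φ₁ Φ₂ : M → G) (om : QuasiPoisson.FlatField IM M) (P : QuasiPoisson.SharpField IM M)
    (h : QuasiPoisson.Corresponds (QuasiPoisson.doubleBasis e) A (fun m => (Φ₁ m, Φ₂ m)) P om) :
    (∀ (m : M) (v : TangentSpace IM m),
      QuasiPoisson.fusedBivector e A P m (QuasiPoisson.fusedForm e Φ₁ Φ₂ om m v) =
        v - (1 / 4 : ℝ) • ∑ a,
          (QuasiPoisson.pullL e (fun x => Φ₁ x * Φ₂ x) a m v
            - QuasiPoisson.pullR e (fun x => Φ₁ x * Φ₂ x) a m v)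
          • (QuasiPoisson.gen₁ A m (e a) + QuasiPoisson.gen₂ A m (e a))) ∧
    QuasiPoisson.Corresponds e A.diag (fun m => Φ₁ m * Φ₂ m)
      (QuasiPoisson.fusedBivector e A P) (QuasiPoisson.fusedForm e Φ₁ Φ₂ om) := by
  have hc := h.fusion he.adInvariant
  refine ⟨fun m v => ?_, hc⟩
  simp only [← QuasiPoisson.SmoothAction.diag_gen]
  exact hc.related m v
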